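/- **Programs and computations.** A program $P$ consists of threads, each with an initial label, local registers and a finite list of labelled instructions (several instructions may share a label): loads $r\leftarrow \mathrm{mem}[e]$, stores $\mathrm{mem}[e]\leftarrow e'$, local assignments, assertions, $\texttt{scfence}$, and $\texttt{fence}\ e_1\dots e_n$. The elements of the data domain $\mathrm{DOM}\ni 0$ also serve as addresses; all registers and addresses are initially $0$. Expressions are functions of registers, and an assertion can be passed iff its value is not $0$. Every thread has a FIFO buffer per address and one all-addresses FIFO buffer. Issuing a store (action $\mathrm{isu}_{\mathrm{st}}$) appends it to the buffer of its address; silently, the oldest store of a per-address buffer moves to the end of the all-addresses buffer; issuing a $\texttt{fence}$ (action $\mathrm{isu}_{\mathrm{fence}}$) requires that the thread's per-address buffers of the listed addresses are empty and appends the fence to the all-addresses buffer. A store or fence action removes the oldest entry of the all-addresses buffer; a store action then writes its value to the memory. An $\texttt{scfence}$ requires that all buffers of the thread are empty. A load returns the value of the thread's most recently issued store to the address that is still buffered, if there is one, and otherwise the value in memory. A computation of $P$ is the sequence of actions (issues, stores, fences, loads, scfences, local actions, each with its thread, and with addresses and values where applicable) of a run from the initial state to a state with empty buffers; $\mathrm{isu}_x$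 denotes the issue of the store or fence action $x$. A computation is SC if every $\mathrm{isu}_x$ is immediately followed by $x$. **Traces.** The trace of $\tau$ is the graph whose nodes are the actions of $\tau$, where $x$ and $\mathrm{isu}_x$ are the same node, with the following edges. Program order $\to_{\mathrm{po}}$: the order in $\tau$ of the actions of one thread, where for a store or fence the position of its issue counts. Store order $\to_{\mathrm{st}}$: the order in $\tau$ of the store actions to one address. Source: $w\to_{\mathrm{src}}\mathrm{ld}$ if $w$ is the latest-issued store of the thread of $\mathrm{ld}$ to its address that is issued before and executed after $\mathrm{ld}$ or, if there is none, $w$ is the last store action to this address before $\mathrm{ld}$. Conflict: $\mathrm{ld}\to_{\mathrm{cf}}\mathrm{st}$ if $w\to_{\mathrm{src}}\mathrm{ld}$ and $w\to_{\mathrm{st}}\mathrm{st}$ for some $w$, or if $\mathrm{ld}$ has no source and $\mathrm{st}$ is the first store action to the address of $\mathrm{ld}$. $P$ is robust if the trace of every computation of $P$ is the trace of an SC computation of $P$; a computation for which this fails is a violation. **Minimal violations.** A store or fence action $x$ overtakes the actions of its thread that lie strictly between $\mathrm{isu}_x$ and $x$; it is delayed if it overtakes at least one action. The cost of $\tau$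 is the triple (number of delays, number of reorders, length of $\tau$), compared lexicographically, where the number of delays is the number of pairs $(x,b)$ such that $x$ overtakes $b$, and the number of reorders is the number of pairs $(x,y)$ of stores or fences such that $x$ overtakes both $\mathrm{isu}_y$ and $y$. A violation is minimal if its cost is minimal among all violations of $P$. For positions $b$ before $c$ in $\tau$, "$b\to_{\mathrm{hb}}^+c$ through the actions in between" means that there is a subsequence $b=b_0,b_1,\dots,b_{n+1}=c$ of $\tau$ with $b_i\to_{\mathrm{po}}^+b_{i+1}$, $b_i\to_{\mathrm{src}}b_{i+1}$, $b_i\to_{\mathrm{st}}b_{i+1}$ or $b_i\to_{\mathrm{cf}}b_{i+1}$ for all $i$, where an issue action takes part in $\to_{\mathrm{po}}$ only. **Proposition (Witnesses).** A program $P$ is robust if and only if there is no minimal violation $$\tau=\tau_1\cdot\mathrm{isu}_{\mathrm{st}}\cdot\tau_2\cdot a\cdot\tau_3\cdot\mathrm{st}\cdot\tau_4$$ of $P$, where $\mathrm{st}$ is a store action, $\mathrm{isu}_{\mathrm{st}}$ is its issue and $a$ is an action of the same thread $t_A$ as $\mathrm{st}$, such that - (W1) only $t_A$ delays actions, that is,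 every delayed action of $\tau$ belongs to $t_A$; - (W2) $\tau_3$ contains no action of $t_A$; - (W3) $\tau_1$ and $\tau_2\cdot a\cdot\tau_3$ contain no delayed actions; - (W4) for every $b$ in $\tau_3\cdot\mathrm{st}$ we have $a\to_{\mathrm{hb}}^+b$ through the actions in between; - (W5) $\tau_4$ contains only delayed stores and fences of $t_A$. -/

import Mathlib

namespace Pgas

/-! ### Programs -/

/-- An expression: a function on data values applied to a list of registers. -/
structure Expr (Reg Dom : Type*) where
  fn : List Dom → Dom
  args : List Reg

/-- The value of an expression under a register valuation. -/
def Expr.eval {Reg Dom : Type*} (e : Expr Reg Dom) (val : Reg → Dom) : Dom :=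
  e.fn (e.args.map val)

/-- The instructions. `Dom` serves both as data domain and as set of memory addresses. -/
inductive Instr (Reg Dom : Type*) where
  /-- `r ← mem[addr]` -/
  | load (r : Reg) (addr : Expr Reg Dom)
  /-- `mem[addr] ← value` -/
  | store (addr value : Expr Reg Dom)
  /-- `r ← value` -/
  | assign (r : Reg) (value : Expr Reg Dom)
  | assert (cond : Expr Reg Dom)
  | scfence
  | fence (addrs : List (Expr Reg Dom))

/-- A labelled instruction `src: instr; goto tgt`. -/
structure LInstr (Reg Lab Dom : Type*) where
  src : Lab
  instr : Instr Reg Dom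
  tgt : Lab

/-- A concurrent program with threads named by `Thr`. Every thread has its own initial label, its
own finite list of labelled instructions (several may share a label), and its own copy of the
registers named by `Reg`. -/
structure Program (Thr Reg Lab Dom : Type*) where
  init : Thr → Lab
  code : Thr → List (LInstr Reg Lab Dom)

/-! ### Actions -/

/-- What sits in a buffer: a store of a value to an address, or a fence with its addresses. -/
inductive Entry (Dom : Type*) where
  | store (a v : Dom)
  | fence (as : List Dom)

/-- The operation of an action. `isu x` issues the store or fence `x`, and `exec x` is the store or
fence action `x` itself (the moment at which it leaves the all-addresses buffer). -/
inductive Op (Dom : Type*) where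
  | ld (a v : Dom)
  | loc
  | scfence
  | isu (x : Entry Dom)
  | exec (x : Entry Dom)

/-- An action is an operation together with the executing thread. -/
structure Act (Thr Dom : Type*) where
  thr : Thr
  op : Op Dom

/-! ### Operational semantics -/

/-- A state: program counters, register values, memory, the per-address buffers `buf₁` and the
all-addresses buffers `buf₂`. The oldest element of a buffer is the head of the list. -/
structure State (Thr Reg Lab Dom : Type*) where
  pc : Thr → Lab
  reg : Thr → Reg → Dom
  mem : Dom → Dom
  buf₁ : Thr → Dom → List Dom
  buf₂ : Thr → List (Entry Dom)

/-- The initial state. -/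
def Program.initState {Thr Reg Lab Dom : Type*} [Zero Dom] (P : Program Thr Reg Lab Dom) :
    State Thr Reg Lab Dom where
  pc := P.init
  reg := fun _ _ => 0
  mem := fun _ => 0
  buf₁ := fun _ _ => []
  buf₂ := fun _ => []

/-- The values of the stores to address `a` in an all-addresses buffer, oldest first. -/
def storesTo {Dom : Type*} [DecidableEq Dom] (a : Dom) (b : List (Entry Dom)) : List Dom :=
  b.filterMap fun x => match x with
    | .store a' v => if a' = a then some v else none
    | .fence _ => none

variable {Thr Reg Lab Dom : Type*} [DecidableEq Thr] [DecidableEq Reg] [DecidableEq Dom] [Zero Dom]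

/-- The transition relation. Transitions are labelled by an action, or by `none` for the silent
move of a store from a per-address buffer to the all-addresses buffer. -/
inductive Step (P : Program Thr Reg Lab Dom) :
    State Thr Reg Lab Dom → Option (Act Thr Dom) → State Thr Reg Lab Dom → Prop where
  | earlyRead₁ (s : State Thr Reg Lab Dom) (t : Thr) (l l' : Lab) (r : Reg) (ea : Expr Reg Dom)
      (a v : Dom) (hI : ⟨l, .load r ea, l'⟩ ∈ P.code t) (hpc : s.pc t = l)
      (ha : a = ea.eval (s.reg t)) (hv : (s.buf₁ t a).getLast? = some v) :
      Step P s (some ⟨t, .ld a v⟩)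
        { s with
          pc := Function.update s.pc t l'
          reg := Function.update s.reg t (Function.update (s.reg t) r v) }
  | earlyRead₂ (s : State Thr Reg Lab Dom) (t : Thr) (l l' : Lab) (r : Reg) (ea : Expr Reg Dom)
      (a v : Dom) (hI : ⟨l, .load r ea, l'⟩ ∈ P.code t) (hpc : s.pc t = l)
      (ha : a = ea.eval (s.reg t)) (h₁ : s.buf₁ t a = [])
      (hv : (storesTo a (s.buf₂ t)).getLast? = some v) :
      Step P s (some ⟨t, .ld a v⟩)
        { s with
          pc := Function.update s.pc t l'
          reg := Function.update s.reg t (Function.update (s.reg t) r v) }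
  | readMemory (s : State Thr Reg Lab Dom) (t : Thr) (l l' : Lab) (r : Reg) (ea : Expr Reg Dom)
      (a v : Dom) (hI : ⟨l, .load r ea, l'⟩ ∈ P.code t) (hpc : s.pc t = l)
      (ha : a = ea.eval (s.reg t)) (h₁ : s.buf₁ t a = [])
      (h₂ : storesTo a (s.buf₂ t) = []) (hv : v = s.mem a) :
      Step P s (some ⟨t, .ld a v⟩)
        { s with
          pc := Function.update s.pc t l'
          reg := Function.update s.reg t (Function.update (s.reg t) r v) }
  | issueStore (s : State Thr Reg Lab Dom) (t : Thr) (l l' : Lab) (ea ev : Expr Reg Dom)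
      (a v : Dom) (hI : ⟨l, .store ea ev, l'⟩ ∈ P.code t) (hpc : s.pc t = l)
      (ha : a = ea.eval (s.reg t)) (hv : v = ev.eval (s.reg t)) :
      Step P s (some ⟨t, .isu (.store a v)⟩)
        { s with
          pc := Function.update s.pc t l'
          buf₁ := Function.update s.buf₁ t
            (Function.update (s.buf₁ t) a (s.buf₁ t a ++ [v])) }
  | advance (s : State Thr Reg Lab Dom) (t : Thr) (a v : Dom) (b : List Dom)
      (hb : s.buf₁ t a = v :: b) :
      Step P s none
        { s with
          buf₁ := Function.update s.buf₁ t (Function.update (s.buf₁ t) a b)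
          buf₂ := Function.update s.buf₂ t (s.buf₂ t ++ [.store a v]) }
  | storeToMemory (s : State Thr Reg Lab Dom) (t : Thr) (a v : Dom) (b : List (Entry Dom))
      (hb : s.buf₂ t = .store a v :: b) :
      Step P s (some ⟨t, .exec (.store a v)⟩)
        { s with
          mem := Function.update s.mem a v
          buf₂ := Function.update s.buf₂ t b }
  | scfence (s : State Thr Reg Lab Dom) (t : Thr) (l l' : Lab)
      (hI : ⟨l, .scfence, l'⟩ ∈ P.code t) (hpc : s.pc t = l)
      (h₂ : s.buf₂ t = []) (h₁ : ∀ a, s.buf₁ t a = []) :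
      Step P s (some ⟨t, .scfence⟩) { s with pc := Function.update s.pc t l' }
  | issueFence (s : State Thr Reg Lab Dom) (t : Thr) (l l' : Lab) (es : List (Expr Reg Dom))
      (as : List Dom) (hI : ⟨l, .fence es, l'⟩ ∈ P.code t) (hpc : s.pc t = l)
      (has : as = es.map fun e => e.eval (s.reg t)) (h₁ : ∀ a ∈ as, s.buf₁ t a = []) :
      Step P s (some ⟨t, .isu (.fence as)⟩)
        { s with
          pc := Function.update s.pc t l'
          buf₂ := Function.update s.buf₂ t (s.buf₂ t ++ [.fence as]) }
  | fence (s : State Thr Reg Lab Dom) (t : Thr) (as : List Dom) (b : List (Entry Dom))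
      (hb : s.buf₂ t = .fence as :: b) :
      Step P s (some ⟨t, .exec (.fence as)⟩) { s with buf₂ := Function.update s.buf₂ t b }
  | assign (s : State Thr Reg Lab Dom) (t : Thr) (l l' : Lab) (r : Reg) (e : Expr Reg Dom)
      (hI : ⟨l, .assign r e, l'⟩ ∈ P.code t) (hpc : s.pc t = l) :
      Step P s (some ⟨t, .loc⟩)
        { s with
          pc := Function.update s.pc t l'
          reg := Function.update s.reg t (Function.update (s.reg t) r (e.eval (s.reg t))) }
  | assert (s : State Thr Reg Lab Dom) (t : Thr) (l l' : Lab) (e : Expr Reg Dom)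
      (hI : ⟨l, .assert e, l'⟩ ∈ P.code t) (hpc : s.pc t = l) (he : e.eval (s.reg t) ≠ 0) :
      Step P s (some ⟨t, .loc⟩) { s with pc := Function.update s.pc t l' }

/-- `Steps P s τ s'`: there is a run from `s` to `s'` whose sequence of actions is `τ`. -/
inductive Steps (P : Program Thr Reg Lab Dom) :
    State Thr Reg Lab Dom → List (Act Thr Dom) → State Thr Reg Lab Dom → Prop where
  | refl (s : State Thr Reg Lab Dom) : Steps P s [] s
  | silent (s s' s'' : State Thr Reg Lab Dom) (τ : List (Act Thr Dom))
      (h : Step P s none s') (hs : Steps P s' τ s'') : Steps P s τ s''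
  | act (s s' s'' : State Thr Reg Lab Dom) (x : Act Thr Dom) (τ : List (Act Thr Dom))
      (h : Step P s (some x) s') (hs : Steps P s' τ s'') : Steps P s (x :: τ) s''

/-- The computations of a program: action sequences of runs from the initial state to a state with
empty buffers. -/
def Program.Comp (P : Program Thr Reg Lab Dom) : Set (List (Act Thr Dom)) :=
  {τ | ∃ s, Steps P P.initState τ s ∧ ∀ t, s.buf₂ t = [] ∧ ∀ a, s.buf₁ t a = []}

/-! ### Issue actions and the actions they belong to

Positions in a computation are natural numbers, starting with `0`. -/

/-- The FIFO channel of a buffer entry: stores of one thread to one address reach the memory in the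
order of their issues, and so do the fences of one thread. -/
def Entry.chan {Dom : Type*} : Entry Dom → Option Dom
  | .store a _ => some a
  | .fence _ => none

/-- Thread and channel of an issue action. -/
def Act.isuChan {Thr Dom : Type*} (x : Act Thr Dom) : Option (Thr × Option Dom) :=
  match x.op with
  | .isu e => some (x.thr, e.chan)
  | _ => none

/-- Thread and channel of a store or fence action. -/
def Act.execChan {Thr Dom : Type*} (x : Act Thr Dom) : Option (Thr × Option Dom) :=
  match x.op with
  | .exec e => some (x.thr, e.chan)
  | _ => none

/-- The action at position `i` is the issue of the store or fence action at position `j`: they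
belong to the same thread and channel `k`, and as many actions of `k` are issued before `i` as are
executed before `j`. -/
def IssueOf (τ : List (Act Thr Dom)) (i j : ℕ) : Prop :=
  ∃ k, τ[i]?.bind Act.isuChan = some k ∧ τ[j]?.bind Act.execChan = some k ∧
    ((τ.take i).filterMap Act.isuChan).count k = ((τ.take j).filterMap Act.execChan).count k

/-- The positions `i` and `j` carry actions of the same thread. -/
def SameThread {Thr Dom : Type*} (τ : List (Act Thr Dom)) (i j : ℕ) : Prop :=
  ∃ x y, τ[i]? = some x ∧ τ[j]? = some y ∧ x.thr = y.thr

/-- The sequentially consistent computations: every issue is immediately followed by the store or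
fence it belongs to. -/
def Program.SCComp (P : Program Thr Reg Lab Dom) : Set (List (Act Thr Dom)) :=
  {τ | τ ∈ P.Comp ∧ ∀ i j, IssueOf τ i j → j = i + 1}

/-! ### Happens-before -/

/-- Position `i` is a node of the trace. A store or fence action is represented by its issue. -/
def IsNode {Thr Dom : Type*} (τ : List (Act Thr Dom)) (i : ℕ) : Prop :=
  ∃ x, τ[i]? = some x ∧ x.execChan = none

/-- The node that represents the action at position `m` is `i`. -/
def Rep (τ : List (Act Thr Dom)) (m i : ℕ) : Prop :=
  (m = i ∧ IsNode τ i) ∨ IssueOf τ i m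

/-- Position `i` carries a store action to address `a` (not its issue). -/
def StoreAt {Thr Dom : Type*} (τ : List (Act Thr Dom)) (i : ℕ) (a : Dom) : Prop :=
  ∃ t v, τ[i]? = some ⟨t, .exec (.store a v)⟩

/-- Position `i` carries a load of thread `t` from address `a`. -/
def LoadAt {Thr Dom : Type*} (τ : List (Act Thr Dom)) (i : ℕ) (t : Thr) (a : Dom) : Prop :=
  ∃ v, τ[i]? = some ⟨t, .ld a v⟩

/-- The (transitive) program order: for stores and fences, the moment of the issue counts. -/
def Po (τ : List (Act Thr Dom)) (m n : ℕ) : Prop :=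
  SameThread τ m n ∧ ∃ i j, Rep τ m i ∧ Rep τ n j ∧ i < j

/-- The (transitive) store order. -/
def St {Thr Dom : Type*} (τ : List (Act Thr Dom)) (m n : ℕ) : Prop :=
  m < n ∧ ∃ a, StoreAt τ m a ∧ StoreAt τ n a

/-- At position `l`, the store of thread `t` to address `a` that is issued at `i` and reaches the
memory at `s` is issued but not yet in the memory. -/
def Pending (τ : List (Act Thr Dom)) (t : Thr) (a : Dom) (l i s : ℕ) : Prop :=
  i < l ∧ l < s ∧ IssueOf τ i s ∧ ∃ v, τ[s]? = some ⟨t, .exec (.store a v)⟩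

/-- The source relation: the load at `l` reads from the store at `s`, which is the most recently
issued pending store of the own thread if there is one (early read), and otherwise the last store
to the address that has reached the memory. -/
def Src (τ : List (Act Thr Dom)) (s l : ℕ) : Prop :=
  ∃ t a, LoadAt τ l t a ∧
    ((∃ i, Pending τ t a l i s ∧ ∀ i' s', Pending τ t a l i' s' → i' ≤ i) ∨
      ((¬ ∃ i' s', Pending τ t a l i' s') ∧ StoreAt τ s a ∧ s < l ∧
        ∀ s', StoreAt τ s' a → s' < l → s' ≤ s))

/-- The conflict relation. -/
def Cf (τ : List (Act Thr Dom)) (l s : ℕ) : Prop :=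
  ∃ t a, LoadAt τ l t a ∧ StoreAt τ s a ∧
    ((∃ s', Src τ s' l ∧ St τ s' s) ∨ ((¬ ∃ s', Src τ s' l) ∧ ¬ ∃ s', St τ s' s))

/-- The union of the four relations, between positions. -/
def Hb (τ : List (Act Thr Dom)) (m n : ℕ) : Prop :=
  Po τ m n ∨ St τ m n ∨ Src τ m n ∨ Cf τ m n

/-- The action at `m` happens before the action at `n` through the actions in between: there is a
chain of happens-before steps along increasing positions from `m` to `n`. -/
def HbThrough (τ : List (Act Thr Dom)) (m n : ℕ) : Prop :=
  Relation.TransGen (fun i j => i < j ∧ Hb τ i j) m n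

/-- A directed graph with nodes labelled by actions and four kinds of edges. -/
structure Trace (Thr Dom : Type*) where
  Node : Type
  label : Node → Option (Act Thr Dom)
  po : Node → Node → Prop
  st : Node → Node → Prop
  src : Node → Node → Prop
  cf : Node → Node → Prop

/-- Equality of traces, i.e. isomorphism of labelled graphs. -/
def Trace.Same {Thr Dom : Type*} (G H : Trace Thr Dom) : Prop :=
  ∃ f : G.Node ≃ H.Node, (∀ x, G.label x = H.label (f x)) ∧
    (∀ x y, G.po x y ↔ H.po (f x) (f y)) ∧ (∀ x y, G.st x y ↔ H.st (f x) (f y)) ∧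
    (∀ x y, G.src x y ↔ H.src (f x) (f y)) ∧ (∀ x y, G.cf x y ↔ H.cf (f x) (f y))

/-- A relation between positions, transferred to the nodes that represent them. -/
def onNodes (τ : List (Act Thr Dom)) (R : ℕ → ℕ → Prop) (x y : {i : ℕ // IsNode τ i}) : Prop :=
  ∃ m n, Rep τ m x ∧ Rep τ n y ∧ R m n

/-- The happens-before trace of a computation. -/
def trace (τ : List (Act Thr Dom)) : Trace Thr Dom where
  Node := {i : ℕ // IsNode τ i}
  label := fun x => τ[x.1]?
  po := onNodes τ (Po τ)
  st := onNodes τ (St τ)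
  src := onNodes τ (Src τ)
  cf := onNodes τ (Cf τ)

/-! ### Robustness and minimal violations -/

/-- Every trace of a computation is the trace of a sequentially consistent computation. -/
def Program.Robust (P : Program Thr Reg Lab Dom) : Prop :=
  ∀ τ ∈ P.Comp, ∃ σ ∈ P.SCComp, (trace τ).Same (trace σ)

/-- A computation whose trace is not the trace of a sequentially consistent computation. -/
def Program.Violation (P : Program Thr Reg Lab Dom) (τ : List (Act Thr Dom)) : Prop :=
  τ ∈ P.Comp ∧ ¬ ∃ σ ∈ P.SCComp, (trace τ).Same (trace σ)

/-- The store or fence at position `j` overtakes the action at position `m`: the latter lies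
strictly between the issue and the execution and belongs to the same thread. -/
def Overtakes (τ : List (Act Thr Dom)) (j m : ℕ) : Prop :=
  ∃ i, IssueOf τ i j ∧ i < m ∧ m < j ∧ SameThread τ m j

/-- The store or fence at position `j` is delayed. -/
def Delayed (τ : List (Act Thr Dom)) (j : ℕ) : Prop := ∃ m, Overtakes τ j m

/-- The number of delays. -/
noncomputable def delays (τ : List (Act Thr Dom)) : ℕ :=
  ∑ j ∈ Finset.range τ.length, {m | Overtakes τ j m}.ncard

/-- The number of reorders: for every store or fence, count the stores and fences that it overtakes
together with their issue. -/
noncomputable def reorders (τ : List (Act Thr Dom)) : ℕ :=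
  ∑ j ∈ Finset.range τ.length,
    {m | Overtakes τ j m ∧ ∃ i, IssueOf τ i m ∧ Overtakes τ j i}.ncard

/-- The cost: delays, reorders, length, ordered lexicographically. -/
noncomputable def cost (τ : List (Act Thr Dom)) : ℕ ×ₗ (ℕ ×ₗ ℕ) :=
  toLex (delays τ, toLex (reorders τ, τ.length))

/-- A violation whose cost is minimal among all violations of the program. -/
def Program.MinViolation (P : Program Thr Reg Lab Dom) (τ : List (Act Thr Dom)) : Prop :=
  P.Violation τ ∧ ∀ σ, P.Violation σ → cost τ ≤ cost σ

/-! ### Witness form -/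

/-- `τ = τ₁ · isu_st · τ₂ · a · τ₃ · st · τ₄` where `st` is a store of the thread of `a` and
`isu_st` is its issue, subject to the five requirements on witnesses. -/
structure IsWitness (τ τ₁ τ₂ τ₃ τ₄ : List (Act Thr Dom)) (isuSt a st : Act Thr Dom) : Prop where
  eq : τ = τ₁ ++ [isuSt] ++ τ₂ ++ [a] ++ τ₃ ++ [st] ++ τ₄
  /-- `st` is a store action. -/
  store : ∃ x v, st.op = .exec (.store x v)
  /-- `isuSt` is the issue of `st`. -/
  issue : IssueOf τ τ₁.length (τ₁ ++ [isuSt] ++ τ₂ ++ [a] ++ τ₃).length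
  thread : a.thr = st.thr
  /-- Only the thread of `st` delays actions. -/
  w1 : ∀ j x, τ[j]? = some x → Delayed τ j → x.thr = st.thr
  /-- `τ₃` contains no action of this thread. -/
  w2 : ∀ x ∈ τ₃, x.thr ≠ st.thr
  /-- `τ₁` and `τ₂ · a · τ₃` contain no delayed actions. -/
  w3 : ∀ j < (τ₁ ++ [isuSt] ++ τ₂ ++ [a] ++ τ₃).length, ¬ Delayed τ j
  /-- Every action of `τ₃ · st` depends on `a` through the actions in between. -/
  w4 : ∀ j, (τ₁ ++ [isuSt] ++ τ₂).length < j →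
    j ≤ (τ₁ ++ [isuSt] ++ τ₂ ++ [a] ++ τ₃).length →
      HbThrough τ (τ₁ ++ [isuSt] ++ τ₂).length j
  /-- `τ₄` contains only delayed stores and fences of this thread. -/
  w5 : ∀ j x, (τ₁ ++ [isuSt] ++ τ₂ ++ [a] ++ τ₃ ++ [st]).length ≤ j → τ[j]? = some x →
    Delayed τ j ∧ x.thr = st.thr ∧ ∃ e, x.op = .exec e

end Pgas

set_option linter.unusedSectionVars false

namespace Pgas

variable {Thr Reg Lab Dom : Type*}

/-! A robust program has no violation at all, so only the other direction has content. A computation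
without delayed actions can be reordered into a sequentially consistent one with the same trace, by
pushing every issue to the right until it meets its action (`exists_sc_of_not_delayed`). Hence every
violation contains a delayed action. Costs are well-founded, so a program that is not robust has a
minimal violation, and it remains to bring one into witness form.

Let `j` be the first delayed action, `i` its issue and `p` the last action that it overtakes. As
long as some action in `(p, j]` does not depend on `p`, the first such action can be moved to the
left: either it passes `p`, at the same cost, or it is `j` itself, which can then be swapped with
`p` into a cheaper violation (`exists_cost_lt`). So all of `(p, j]` may be assumed to depend on `p`
(`Front.exists_closer`, `Front.exists_tight`). The step into `j` cannot come from `p` or from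
another action of its thread, so `j` is a store, and together with `j` before `p` in program order
there is a happens-before cycle inside the prefix that ends with `j`. Sequentially consistent traces
are acyclic (`Cyclic.not_same`), so any computation that keeps this cycle is a violation.

The cycle controls what follows `j`. An issue, load or other action of program order behind `j`
could be deleted, which is cheaper (`Front.execAt_of_lt`). Thus only stores and fences follow. They
are delayed, since otherwise their issues could be moved behind `j` (`Front.delayed_of_issue`). They
belong to the thread of `j`, since otherwise the first one of another thread could be pulled forward
to `j` or just before it without destroying the cycle, and minimality would fail
(`Front.sameThread_of_lt`).

All of this runs on an equivalent semantics in which each thread has one list of pending entries and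
there are no silent moves (`mem_comp_iff`). Loads are handled through the stores visible to them:
the source is the last visible store (`src_iff`), so a swap keeps the trace if it affects the
visibility of overwritten stores only. -/

/-! ### A semantics without silent moves -/

/-- The entry `y` has to leave the buffers before every later issued entry that it blocks. -/
def Entry.Blocks : Entry Dom → Entry Dom → Prop
  | .fence _, _ => True
  | .store a _, .store b _ => a = b
  | .store a _, .fence as => a ∈ as

/-- `p'` results from `p` by removing an entry `x` that no earlier entry blocks. -/
def Removes (x : Entry Dom) (p p' : List (Entry Dom)) : Prop :=
  ∃ l r, p = l ++ x :: r ∧ p' = l ++ r ∧ ∀ y ∈ l, ¬ y.Blocks x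

/-- States with a single list of pending entries per thread, in the order of their issues. -/
structure PState (Thr Reg Lab Dom : Type*) where
  ctl : Thr → Lab × (Reg → Dom)
  mem : Dom → Dom
  pend : Thr → List (Entry Dom)

/-- The effect of an operation on program counter and registers. -/
inductive Ctl [DecidableEq Reg] [Zero Dom] (code : List (LInstr Reg Lab Dom)) :
    Lab × (Reg → Dom) → Op Dom → Lab × (Reg → Dom) → Prop where
  | ld (l l' : Lab) (r : Reg) (ea : Expr Reg Dom) (ρ : Reg → Dom) (v : Dom)
      (h : ⟨l, .load r ea, l'⟩ ∈ code) :
      Ctl code (l, ρ) (.ld (ea.eval ρ) v) (l', Function.update ρ r v)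
  | store (l l' : Lab) (ea ev : Expr Reg Dom) (ρ : Reg → Dom)
      (h : ⟨l, .store ea ev, l'⟩ ∈ code) :
      Ctl code (l, ρ) (.isu (.store (ea.eval ρ) (ev.eval ρ))) (l', ρ)
  | fence (l l' : Lab) (es : List (Expr Reg Dom)) (ρ : Reg → Dom)
      (h : ⟨l, .fence es, l'⟩ ∈ code) :
      Ctl code (l, ρ) (.isu (.fence (es.map fun e => e.eval ρ))) (l', ρ)
  | scfence (l l' : Lab) (ρ : Reg → Dom) (h : ⟨l, .scfence, l'⟩ ∈ code) :
      Ctl code (l, ρ) .scfence (l', ρ)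
  | assign (l l' : Lab) (r : Reg) (e : Expr Reg Dom) (ρ : Reg → Dom)
      (h : ⟨l, .assign r e, l'⟩ ∈ code) :
      Ctl code (l, ρ) .loc (l', Function.update ρ r (e.eval ρ))
  | assert (l l' : Lab) (e : Expr Reg Dom) (ρ : Reg → Dom)
      (h : ⟨l, .assert e, l'⟩ ∈ code) (he : e.eval ρ ≠ 0) : Ctl code (l, ρ) .loc (l', ρ)
  | exec (q : Lab × (Reg → Dom)) (x : Entry Dom) : Ctl code q (.exec x) q

/-- The effect of an operation on the pending list, including the value read by a load. -/
def BufStep [DecidableEq Dom] (m : Dom → Dom) :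
    Op Dom → List (Entry Dom) → List (Entry Dom) → Prop
  | .ld a v, p, p' => p' = p ∧ v = (storesTo a p).getLast?.getD (m a)
  | .loc, p, p' => p' = p
  | .scfence, p, p' => p = [] ∧ p' = p
  | .isu e, p, p' => p' = p ++ [e]
  | .exec e, p, p' => Removes e p p'

/-- The memory after an operation. -/
def Op.memAfter [DecidableEq Dom] : Op Dom → (Dom → Dom) → Dom → Dom
  | .exec (.store a v), m => Function.update m a v
  | _, m => m

variable [DecidableEq Thr] [DecidableEq Reg] [DecidableEq Dom] [Zero Dom]

/-- Transitions of the semantics without silent moves. -/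
def PStep (P : Program Thr Reg Lab Dom) (s : PState Thr Reg Lab Dom) (x : Act Thr Dom)
    (s' : PState Thr Reg Lab Dom) : Prop :=
  ∃ q p, Ctl (P.code x.thr) (s.ctl x.thr) x.op q ∧ BufStep s.mem x.op (s.pend x.thr) p ∧
    s' = ⟨Function.update s.ctl x.thr q, x.op.memAfter s.mem, Function.update s.pend x.thr p⟩

/-- Runs of the semantics without silent moves. -/
def PSteps (P : Program Thr Reg Lab Dom) :
    PState Thr Reg Lab Dom → List (Act Thr Dom) → PState Thr Reg Lab Dom → Prop
  | s, [], s' => s' = s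
  | s, x :: τ, s' => ∃ s₁, PStep P s x s₁ ∧ PSteps P s₁ τ s'

def Program.initP (P : Program Thr Reg Lab Dom) : PState Thr Reg Lab Dom where
  ctl := fun t => (P.init t, fun _ => 0)
  mem := fun _ => 0
  pend := fun _ => []

theorem PSteps_append {P : Program Thr Reg Lab Dom} {s s' : PState Thr Reg Lab Dom}
    {τ σ : List (Act Thr Dom)} :
    PSteps P s (τ ++ σ) s' ↔ ∃ s₁, PSteps P s τ s₁ ∧ PSteps P s₁ σ s' := by
  induction τ generalizing s with
  | nil => simp [PSteps]
  | cons x τ ih =>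
    simp only [List.cons_append, PSteps, ih]
    constructor
    · rintro ⟨a, h, b, h1, h2⟩; exact ⟨b, ⟨a, h, h1⟩, h2⟩
    · rintro ⟨b, ⟨a, h, h1⟩, h2⟩; exact ⟨a, h, b, h1, h2⟩

/-! ### Removal of pending entries -/



theorem Entry.blocks_self (x : Entry Dom) : x.Blocks x := by
  cases x <;> simp [Entry.Blocks]

/-- An entry blocks itself, so the removed occurrence is always the first one in the list. -/
theorem Removes.det {x : Entry Dom} {p p₁ p₂ : List (Entry Dom)} (h₁ : Removes x p p₁)
    (h₂ : Removes x p p₂) : p₁ = p₂ := by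
  obtain ⟨l, r, rfl, rfl, hl⟩ := h₁
  obtain ⟨l', r', h, rfl, hl'⟩ := h₂
  rw [List.append_eq_append_iff] at h
  rcases h with ⟨as, rfl, h⟩ | ⟨as, rfl, h⟩
  · cases as with
    | nil => simp at h; simp [h]
    | cons a as =>
      simp only [List.cons_append, List.cons.injEq] at h
      exact absurd (h.1 ▸ x.blocks_self) (hl' a (by simp))
  · cases as with
    | nil => simp at h; simp [h]
    | cons a as =>
      simp only [List.cons_append, List.cons.injEq] at h
      exact absurd (h.1 ▸ x.blocks_self) (hl a (by simp))

theorem Removes.append {x : Entry Dom} {p p' : List (Entry Dom)} (h : Removes x p p')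
    (q : List (Entry Dom)) : Removes x (p ++ q) (p' ++ q) := by
  obtain ⟨l, r, rfl, rfl, hl⟩ := h
  exact ⟨l, r ++ q, by simp, by simp, hl⟩

theorem Removes.last {x : Entry Dom} {p : List (Entry Dom)} (h : ∀ y ∈ p, ¬ y.Blocks x) :
    Removes x (p ++ [x]) p := ⟨p, [], rfl, by simp, h⟩

theorem not_removes_nil {x : Entry Dom} {p' : List (Entry Dom)} : ¬ Removes x [] p' := by
  rintro ⟨l, r, h, -⟩; simp at h

/-- Removal from a list with a further last entry. -/
theorem Removes.snoc_cases {x e : Entry Dom} {p p' : List (Entry Dom)}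
    (h : Removes x (p ++ [e]) p') :
    (∃ p₁, Removes x p p₁ ∧ p' = p₁ ++ [e]) ∨
      (x = e ∧ p' = p ∧ ∀ y ∈ p, ¬ y.Blocks e) := by
  obtain ⟨l, r, h, rfl, hl⟩ := h
  rcases List.eq_nil_or_concat r with rfl | ⟨r, z, rfl⟩
  · right
    obtain ⟨h1, h2⟩ := List.append_inj' h rfl
    simp only [List.cons.injEq, and_true] at h2
    subst h1 h2
    exact ⟨rfl, by simp, hl⟩
  · left
    rw [List.concat_eq_append, ← List.cons_append, ← List.append_assoc] at h
    obtain ⟨h1, h2⟩ := List.append_inj' h rfl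
    simp only [List.cons.injEq, and_true] at h2
    subst h1 h2
    exact ⟨l ++ r, ⟨l, r, rfl, rfl, hl⟩, by simp⟩

/-! ### Stores to one address in a pending list -/

theorem storesTo_append (a : Dom) (p q : List (Entry Dom)) :
    storesTo a (p ++ q) = storesTo a p ++ storesTo a q := by
  simp [storesTo]

theorem storesTo_eq_nil {a : Dom} {p : List (Entry Dom)} :
    storesTo a p = [] ↔ ∀ v, Entry.store a v ∉ p := by
  simp only [storesTo, List.filterMap_eq_nil_iff]
  constructor
  · intro h v hv
    simpa using h _ hv
  · rintro h (⟨b, v⟩ | as) hx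
    · by_cases hb : b = a
      · subst hb; exact absurd hx (h v)
      · simp [hb]
    · rfl

/-- An older store to the same address would block the removal, so a removed store is the oldest one
to its address. -/
theorem Removes.storesTo_eq {x : Entry Dom} {p p' : List (Entry Dom)} (h : Removes x p p')
    (a : Dom) : storesTo a p = storesTo a [x] ++ storesTo a p' := by
  obtain ⟨l, r, rfl, rfl, hl⟩ := h
  rw [List.append_cons, storesTo_append, storesTo_append, storesTo_append]
  rcases x with ⟨b, v⟩ | as
  · by_cases hb : b = a
    · subst hb
      have : storesTo b l = [] := storesTo_eq_nil.2 fun v hv => hl _ hv rfl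
      simp [this]
    · have : storesTo a [Entry.store b v] = [] := by simp [storesTo, hb]
      simp [this]
  · have : storesTo a [Entry.fence as] = [] := by simp [storesTo]
    simp [this]

/-- The pending list `p` is split into the per-address buffers `b₁` and the all-addresses buffer
`b₂`. -/
inductive Split (b₁ : Dom → List Dom) : List (Entry Dom) → List (Entry Dom) → Prop where
  | nil (p : List (Entry Dom)) (h : ∀ a, storesTo a p = b₁ a) (hs : ∀ as, Entry.fence as ∉ p) :
      Split b₁ [] p
  | cons (x : Entry Dom) (b p p' : List (Entry Dom)) (hx : Removes x p p') (h : Split b₁ b p') :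
      Split b₁ (x :: b) p

theorem Split.storesTo_eq {b₁ : Dom → List Dom} {b₂ p : List (Entry Dom)} (h : Split b₁ b₂ p)
    (a : Dom) : storesTo a p = storesTo a b₂ ++ b₁ a := by
  induction h with
  | nil p h hs => rw [h]; simp [storesTo]
  | cons x b p p' hx h ih =>
    rw [hx.storesTo_eq, ih, ← List.append_assoc, ← storesTo_append]; rfl

theorem Split.of_nil {b₁ : Dom → List Dom} {b₂ : List (Entry Dom)} (h : Split b₁ b₂ []) :
    b₂ = [] ∧ ∀ a, b₁ a = [] := by
  cases h with
  | nil p h hs => exact ⟨rfl, fun a => by rw [← h]; rfl⟩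
  | cons x b p p' hx h => exact absurd hx not_removes_nil

theorem Split.eq_nil {b₁ : Dom → List Dom} {p : List (Entry Dom)} (h : Split b₁ [] p)
    (h₁ : ∀ a, b₁ a = []) : p = [] := by
  cases h with
  | nil p h hs =>
    rw [List.eq_nil_iff_forall_not_mem]
    rintro (⟨a, v⟩ | as) hx
    · exact storesTo_eq_nil.1 ((h a).trans (h₁ a)) v hx
    · exact hs as hx

theorem Split.issue_store {b₁ : Dom → List Dom} {b₂ p : List (Entry Dom)} (h : Split b₁ b₂ p)
    (a v : Dom) :
    Split (Function.update b₁ a (b₁ a ++ [v])) b₂ (p ++ [.store a v]) := by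
  induction h with
  | nil p h hs =>
    refine .nil _ (fun c => ?_) (by simpa using hs)
    rw [storesTo_append, h]
    by_cases hc : c = a
    · subst hc; simp [storesTo]
    · have : ¬ a = c := fun e => hc e.symm
      simp [storesTo, hc, this]
  | cons x b p p' hx h ih => exact .cons _ _ _ _ (hx.append _) ih

theorem Split.issue_fence {b₁ : Dom → List Dom} {b₂ p : List (Entry Dom)} (h : Split b₁ b₂ p)
    {as : List Dom} (has : ∀ a ∈ as, b₁ a = []) :
    Split b₁ (b₂ ++ [.fence as]) (p ++ [.fence as]) := by
  induction h with
  | nil p h hs =>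
    refine .cons _ _ _ p (Removes.last ?_) (.nil _ h hs)
    rintro (⟨a, v⟩ | bs) hy
    · exact fun ha => storesTo_eq_nil.1 ((h a).trans (has a ha)) v hy
    · exact absurd hy (hs _)
  | cons x b p p' hx h ih => exact .cons _ _ _ _ (hx.append _) ih

/-- Removal of several entries one after the other. -/
def RemovesAll : List (Entry Dom) → List (Entry Dom) → List (Entry Dom) → Prop
  | [], p, p' => p' = p
  | x :: e, p, p' => ∃ p₁, Removes x p p₁ ∧ RemovesAll e p₁ p'

theorem RemovesAll.det {e p p₁ p₂ : List (Entry Dom)} (h₁ : RemovesAll e p p₁)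
    (h₂ : RemovesAll e p p₂) : p₁ = p₂ := by
  induction e generalizing p with
  | nil => exact h₁.trans h₂.symm
  | cons x e ih =>
    obtain ⟨q₁, hq₁, h₁⟩ := h₁
    obtain ⟨q₂, hq₂, h₂⟩ := h₂
    rw [hq₁.det hq₂] at h₁
    exact ih h₁ h₂

theorem RemovesAll_append {e f p p' : List (Entry Dom)} :
    RemovesAll (e ++ f) p p' ↔ ∃ p₁, RemovesAll e p p₁ ∧ RemovesAll f p₁ p' := by
  induction e generalizing p with
  | nil => simp [RemovesAll]
  | cons x e ih =>
    simp only [List.cons_append, RemovesAll, ih]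
    constructor
    · rintro ⟨a, h, b, h1, h2⟩; exact ⟨b, ⟨a, h, h1⟩, h2⟩
    · rintro ⟨b, ⟨a, h, h1⟩, h2⟩; exact ⟨a, h, b, h1, h2⟩

/-- The all-addresses buffer fixes what leaves next and in which order. Once this is gone, only
stores are left, and nothing but their order at each address matters. -/
theorem split_iff {b₁ : Dom → List Dom} {b₂ p : List (Entry Dom)} :
    Split b₁ b₂ p ↔ ∃ p₁, RemovesAll b₂ p p₁ ∧ (∀ a, storesTo a p₁ = b₁ a) ∧
      ∀ as, Entry.fence as ∉ p₁ := by
  constructor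
  · intro h
    induction h with
    | nil p h hs => exact ⟨p, rfl, h, hs⟩
    | cons x b p p' hx h ih =>
      obtain ⟨p₁, h1, h2⟩ := ih
      exact ⟨p₁, ⟨p', hx, h1⟩, h2⟩
  · rintro ⟨p₁, h, h1, h2⟩
    induction b₂ generalizing p with
    | nil => cases h; exact .nil _ h1 h2
    | cons x b ih =>
      obtain ⟨q, hq, h⟩ := h
      exact .cons _ _ _ _ hq (ih h)

/-- An advance step that prepares the removal of `y`. -/
theorem Split.advance {b₁ : Dom → List Dom} {b₂ p p' : List (Entry Dom)} {y : Entry Dom}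
    (h : Split b₁ b₂ p) (hy : RemovesAll (b₂ ++ [y]) p p') :
    ∃ a v l, y = .store a v ∧ b₁ a = v :: l ∧
      Split (Function.update b₁ a l) (b₂ ++ [y]) p := by
  obtain ⟨p₁, h1, h2, h3⟩ := split_iff.1 h
  obtain ⟨p₂, h4, p₃, h5, rfl⟩ := RemovesAll_append.1 hy
  rw [h4.det h1] at h5
  rcases y with ⟨a, v⟩ | as
  · have h6 := h5.storesTo_eq a
    have h7 : storesTo a [Entry.store a v] = [v] := by simp [storesTo]
    rw [h2, h7] at h6
    refine ⟨a, v, storesTo a p', rfl, h6, split_iff.2 ⟨p', hy, fun c => ?_, fun as has => ?_⟩⟩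
    · by_cases hc : c = a
      · subst hc; simp
      · have h8 := h5.storesTo_eq c
        have : ¬ a = c := fun e => hc e.symm
        rw [h2] at h8
        simp [hc, h8, storesTo, this]
    · obtain ⟨l, r, rfl, rfl, -⟩ := h5
      apply h3 as
      simp only [List.mem_append, List.mem_cons] at has ⊢
      tauto
  · obtain ⟨l, r, rfl, rfl, -⟩ := h5
    exact absurd (by simp) (h3 as)

theorem Split.exec {b₁ : Dom → List Dom} {b p p' : List (Entry Dom)} {x : Entry Dom}
    (h : Split b₁ (x :: b) p) (hx : Removes x p p') : Split b₁ b p' := by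
  cases h with
  | cons _ _ _ q hq h => rwa [hx.det hq]

/-! ### The two semantics have the same computations -/

/-- A state corresponds to a state of the semantics without silent moves. -/
structure Sim (s : State Thr Reg Lab Dom) (u : PState Thr Reg Lab Dom) : Prop where
  ctl : ∀ t, u.ctl t = (s.pc t, s.reg t)
  mem : u.mem = s.mem
  split : ∀ t, Split (s.buf₁ t) (s.buf₂ t) (u.pend t)

theorem Sim.init (P : Program Thr Reg Lab Dom) : Sim P.initState P.initP where
  ctl _ := rfl
  mem := rfl
  split t := .nil _ (fun _ => rfl) (by simp [Program.initP])

end Pgas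

namespace Pgas

variable {Thr Reg Lab Dom : Type*}
variable [DecidableEq Thr] [DecidableEq Reg] [DecidableEq Dom] [Zero Dom]

theorem exists_removes_store {a v : Dom} {l : List Dom} {p : List (Entry Dom)}
    (h : storesTo a p = v :: l) (hs : ∀ as, Entry.fence as ∉ p) :
    ∃ p', Removes (.store a v) p p' := by
  induction p with
  | nil => simp [storesTo] at h
  | cons y p ih =>
    rcases y with ⟨b, w⟩ | as
    · by_cases hb : b = a
      · subst hb
        simp [storesTo] at h
        obtain ⟨rfl, h⟩ := h
        exact ⟨p, [], p, rfl, rfl, by simp⟩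
      · have h' : storesTo a p = v :: l := by
          rw [← h, ← List.singleton_append, storesTo_append]; simp [storesTo, hb]
        obtain ⟨p', l₁, r, rfl, rfl, hl⟩ := ih h' fun as has => hs as (by simp [has])
        refine ⟨_, .store b w :: l₁, r, rfl, rfl, ?_⟩
        simpa [Entry.Blocks, hb] using hl
    · exact absurd (by simp) (hs as)

/-- Silent moves are invisible in the pending list: after the all-addresses buffer has been removed
no fence is left, so nothing blocks the oldest store of an address. -/
theorem Split.silent {b₁ : Dom → List Dom} {b₂ p : List (Entry Dom)} (h : Split b₁ b₂ p)
    {a v : Dom} {l : List Dom} (ha : b₁ a = v :: l) :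
    Split (Function.update b₁ a l) (b₂ ++ [.store a v]) p := by
  obtain ⟨p₁, h1, h2, h3⟩ := split_iff.1 h
  obtain ⟨p', hp'⟩ := exists_removes_store ((h2 a).trans ha) h3
  obtain ⟨a', v', l', h4, h5, h6⟩ :=
    h.advance (y := .store a v) (p' := p') (RemovesAll_append.2 ⟨p₁, h1, p', hp', rfl⟩)
  cases h4
  rw [ha] at h5
  cases h5
  exact h6

theorem Sim.silent {P : Program Thr Reg Lab Dom} {s s' : State Thr Reg Lab Dom}
    {u : PState Thr Reg Lab Dom} (h : Sim s u) (hs : Step P s none s') : Sim s' u := by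
  cases hs with
  | advance t a v b hb =>
    refine ⟨h.ctl, h.mem, fun t' => ?_⟩
    by_cases ht : t' = t
    · subst ht; simpa using (h.split t').silent hb
    · simpa [ht] using h.split t'

/-- The stores in the per-address buffer are younger than those in the all-addresses buffer, so the
last pending store accounts for the three load rules at once. -/
theorem Sim.read {s : State Thr Reg Lab Dom} {u : PState Thr Reg Lab Dom} (h : Sim s u) (t : Thr)
    (a v : Dom) :
    v = (storesTo a (u.pend t)).getLast?.getD (u.mem a) ↔
      (s.buf₁ t a).getLast? = some v ∨
        (s.buf₁ t a = [] ∧ (storesTo a (s.buf₂ t)).getLast? = some v) ∨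
        (s.buf₁ t a = [] ∧ storesTo a (s.buf₂ t) = [] ∧ v = s.mem a) := by
  rw [(h.split t).storesTo_eq, h.mem]
  rcases List.eq_nil_or_concat (s.buf₁ t a) with h1 | ⟨l, z, h1⟩
  · rw [h1]
    rcases List.eq_nil_or_concat (storesTo a (s.buf₂ t)) with h2 | ⟨l, z, h2⟩
    · simp [h2]
    · simp [h2, eq_comm (a := v)]
  · rw [h1]
    simp [eq_comm (a := v)]

theorem Sim.ctl_update {s : State Thr Reg Lab Dom} {u : PState Thr Reg Lab Dom} (h : Sim s u)
    (t : Thr) (l : Lab) (ρ : Reg → Dom) (t' : Thr) :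
    Function.update u.ctl t (l, ρ) t' =
      (Function.update s.pc t l t', Function.update s.reg t ρ t') := by
  by_cases ht : t' = t
  · subst ht; simp
  · simp [ht, h.ctl]

theorem Sim.ctl_update_pc {s : State Thr Reg Lab Dom} {u : PState Thr Reg Lab Dom} (h : Sim s u)
    (t : Thr) (l : Lab) (t' : Thr) :
    Function.update u.ctl t (l, s.reg t) t' = (Function.update s.pc t l t', s.reg t') := by
  by_cases ht : t' = t
  · subst ht; simp
  · simp [ht, h.ctl]

theorem Sim.step {P : Program Thr Reg Lab Dom} {s s' : State Thr Reg Lab Dom}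
    {u : PState Thr Reg Lab Dom} {x : Act Thr Dom} (h : Sim s u) (hs : Step P s (some x) s') :
    ∃ u', PStep P u x u' ∧ Sim s' u' := by
  have load : ∀ (t : Thr) (l l' : Lab) (r : Reg) (ea : Expr Reg Dom) (a v : Dom),
      ⟨l, .load r ea, l'⟩ ∈ P.code t → s.pc t = l → a = ea.eval (s.reg t) →
      v = (storesTo a (u.pend t)).getLast?.getD (u.mem a) →
      ∃ u', PStep P u ⟨t, .ld a v⟩ u' ∧ Sim { s with
          pc := Function.update s.pc t l'
          reg := Function.update s.reg t (Function.update (s.reg t) r v) } u' := by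
    rintro t _ l' r ea a v hI rfl rfl hv
    refine ⟨_, ⟨_, _, ?_, ⟨rfl, hv⟩, rfl⟩, h.ctl_update _ _ _, h.mem, ?_⟩
    · exact h.ctl t ▸ .ld _ _ _ _ _ _ hI
    · simpa using h.split
  have loc : ∀ (t : Thr) (l : Lab) (ρ : Reg → Dom),
      Ctl (P.code t) (s.pc t, s.reg t) .loc (l, ρ) →
      ∃ u', PStep P u ⟨t, .loc⟩ u' ∧ Sim { s with
          pc := Function.update s.pc t l
          reg := Function.update s.reg t ρ } u' := by
    intro t l ρ hc
    refine ⟨_, ⟨_, _, by rw [h.ctl]; exact hc, rfl, rfl⟩, h.ctl_update _ _ _, h.mem, ?_⟩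
    simpa using h.split
  cases hs with
  | earlyRead₁ t l l' r ea a v hI hpc ha hv =>
    exact load t l l' r ea a v hI hpc ha ((h.read t a v).2 (.inl hv))
  | earlyRead₂ t l l' r ea a v hI hpc ha h₁ hv =>
    exact load t l l' r ea a v hI hpc ha ((h.read t a v).2 (.inr (.inl ⟨h₁, hv⟩)))
  | readMemory t l l' r ea a v hI hpc ha h₁ h₂ hv =>
    exact load t l l' r ea a v hI hpc ha ((h.read t a v).2 (.inr (.inr ⟨h₁, h₂, hv⟩)))
  | issueStore t l l' ea ev a v hI hpc ha hv =>
    subst hpc ha hv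
    refine ⟨_, ⟨(l', s.reg t), _, by rw [h.ctl]; exact .store _ _ _ _ _ hI, rfl, rfl⟩,
      h.ctl_update_pc _ _, h.mem, fun t' => ?_⟩
    by_cases ht : t' = t
    · subst ht; simpa using (h.split t').issue_store _ _
    · simpa [ht] using h.split t'
  | storeToMemory t a v b hb =>
    have h1 := h.split t
    rw [hb] at h1
    obtain ⟨p, hp, -⟩ := split_iff.1 h1
    obtain ⟨p', hp', -⟩ := hp
    refine ⟨_, ⟨u.ctl t, p', .exec _ _, hp', rfl⟩, by simpa using h.ctl, ?_, fun t' => ?_⟩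
    · simp [Op.memAfter, h.mem]
    · by_cases ht : t' = t
      · subst ht; simpa using h1.exec hp'
      · simpa [ht] using h.split t'
  | scfence t l l' hI hpc h₂ h₁ =>
    subst hpc
    have h1 := h.split t
    rw [h₂] at h1
    refine ⟨_, ⟨(l', s.reg t), _, by rw [h.ctl]; exact .scfence _ _ _ hI,
      ⟨h1.eq_nil h₁, rfl⟩, rfl⟩, h.ctl_update_pc _ _, h.mem, ?_⟩
    simpa using h.split
  | issueFence t l l' es as hI hpc has h₁ =>
    subst hpc has
    refine ⟨_, ⟨(l', s.reg t), _, by rw [h.ctl]; exact .fence _ _ _ _ hI, rfl, rfl⟩,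
      h.ctl_update_pc _ _, h.mem, fun t' => ?_⟩
    by_cases ht : t' = t
    · subst ht; simpa using (h.split t').issue_fence h₁
    · simpa [ht] using h.split t'
  | fence t as b hb =>
    have h1 := h.split t
    rw [hb] at h1
    obtain ⟨p, hp, -⟩ := split_iff.1 h1
    obtain ⟨p', hp', -⟩ := hp
    refine ⟨_, ⟨u.ctl t, p', .exec _ _, hp', rfl⟩, by simpa using h.ctl, ?_, fun t' => ?_⟩
    · simp [Op.memAfter, h.mem]
    · by_cases ht : t' = t
      · subst ht; simpa using h1.exec hp'
      · simpa [ht] using h.split t'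
  | assign t l l' r e hI hpc =>
    subst hpc
    exact loc t l' _ (.assign _ _ _ _ _ hI)
  | assert t l l' e hI hpc he =>
    subst hpc
    have := loc t l' (s.reg t) (.assert _ _ _ _ hI he)
    simpa using this

theorem Sim.steps {P : Program Thr Reg Lab Dom} {s s' : State Thr Reg Lab Dom}
    {u : PState Thr Reg Lab Dom} {τ : List (Act Thr Dom)} (h : Sim s u) (hs : Steps P s τ s') :
    ∃ u', PSteps P u τ u' ∧ Sim s' u' := by
  induction hs generalizing u with
  | refl s => exact ⟨u, rfl, h⟩
  | silent s s' s'' τ h1 hs ih => exact ih (h.silent h1)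
  | act s s' s'' x τ h1 hs ih =>
    obtain ⟨u₁, h2, h3⟩ := h.step h1
    obtain ⟨u', h4, h5⟩ := ih h3
    exact ⟨u', ⟨u₁, h2, h4⟩, h5⟩

/-! ### From runs without silent moves to runs -/

/-- The entries of thread `t` that are executed in `τ`. -/
def execsOf (t : Thr) (τ : List (Act Thr Dom)) : List (Entry Dom) :=
  τ.filterMap fun x => if x.thr = t then
    match x.op with
    | .exec e => some e
    | _ => none
  else none

/-- A pending fence is executed after some of the entries issued earlier, and the others do not
block it. -/
theorem execsOf_of_fence {P : Program Thr Reg Lab Dom} {u u' : PState Thr Reg Lab Dom}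
    {τ : List (Act Thr Dom)} (h : PSteps P u τ u') {t : Thr} (ht : u'.pend t = [])
    {as : List Dom} {p r : List (Entry Dom)} (hp : u.pend t = p ++ .fence as :: r) :
    ∃ e₁ e₂ p₁, execsOf t τ = e₁ ++ .fence as :: e₂ ∧ RemovesAll e₁ p p₁ ∧
      ∀ y ∈ p₁, ¬ y.Blocks (.fence as) := by
  induction τ generalizing u p r with
  | nil => cases h; simp [hp] at ht
  | cons x τ ih =>
    obtain ⟨u₁, ⟨q, p', hc, hb, rfl⟩, h⟩ := h
    by_cases hx : x.thr = t
    swap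
    · have h1 : execsOf t (x :: τ) = execsOf t τ := by simp [execsOf, hx]
      rw [h1]
      refine ih h (p := p) (r := r) ?_
      have : t ≠ x.thr := fun e => hx e.symm
      simpa [this] using hp
    subst hx
    have pass : execsOf x.thr (x :: τ) = execsOf x.thr τ → (∃ r', p' = p ++ .fence as :: r') →
        ∃ e₁ e₂ p₁, execsOf x.thr (x :: τ) = e₁ ++ .fence as :: e₂ ∧ RemovesAll e₁ p p₁ ∧
      ∀ y ∈ p₁, ¬ y.Blocks (.fence as) := by
      rintro h1 ⟨r', rfl⟩
      rw [h1]
      exact ih h (p := p) (r := r') (by simp)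
    obtain ⟨t, op⟩ := x
    cases op with
    | ld a v => exact pass (by simp [execsOf]) ⟨r, hb.1.trans hp⟩
    | loc => exact pass (by simp [execsOf]) ⟨r, hb.trans hp⟩
    | scfence => exact pass (by simp [execsOf]) ⟨r, hb.2.trans hp⟩
    | isu e => exact pass (by simp [execsOf]) ⟨r ++ [e], by rw [show p' = _ from hb, hp]; simp⟩
    | exec e =>
      have h1 : execsOf t (⟨t, .exec e⟩ :: τ) = e :: execsOf t τ := by simp [execsOf]
      rw [h1]
      obtain ⟨l, r', hl, rfl, hbl⟩ := hb
      simp only [] at hl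
      rw [hp, List.append_eq_append_iff] at hl
      rcases hl with ⟨c, rfl, hc'⟩ | ⟨c, rfl, hc'⟩
      · cases c with
        | nil =>
          simp only [List.nil_append, List.cons.injEq] at hc'
          rw [← hc'.1]
          refine ⟨[], _, p, rfl, rfl, ?_⟩
          simpa [← hc'.1] using hbl
        | cons z c =>
          simp only [List.cons_append, List.cons.injEq] at hc'
          -- An entry issued after the fence cannot leave before it, since a fence blocks everything
          -- behind it.
          exact absurd (by simp [← hc'.1, Entry.Blocks]) (hbl z (by simp))
      · cases c with
        | nil =>
          simp only [List.nil_append, List.cons.injEq] at hc'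
          rw [hc'.1]
          refine ⟨[], _, l ++ [], rfl, rfl, ?_⟩
          simpa [hc'.1] using hbl
        | cons z c =>
          simp only [List.cons_append, List.cons.injEq] at hc'
          obtain ⟨rfl, rfl⟩ := hc'
          obtain ⟨e₁, e₂, p₁, h2, h3, h4⟩ := ih h (p := l ++ c) (r := r) (by simp)
          exact ⟨e :: e₁, e₂, p₁, by simp [h2], ⟨_, ⟨l, c, rfl, rfl, hbl⟩, h3⟩, h4⟩

theorem Steps.trans {P : Program Thr Reg Lab Dom} {s₁ s₂ s₃ : State Thr Reg Lab Dom}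
    {τ σ : List (Act Thr Dom)} (h₁ : Steps P s₁ τ s₂) (h₂ : Steps P s₂ σ s₃) :
    Steps P s₁ (τ ++ σ) s₃ := by
  induction h₁ with
  | refl s => exact h₂
  | silent s s' s'' τ h hs ih => exact .silent _ _ _ _ h (ih h₂)
  | act s s' s'' x τ h hs ih => exact .act _ _ _ _ _ h (ih h₂)

/-- Silent moves that prepare the removal of the entries `e`. -/
theorem Sim.advance_all {P : Program Thr Reg Lab Dom} {s : State Thr Reg Lab Dom}
    {u : PState Thr Reg Lab Dom} (h : Sim s u) (t : Thr) {e p : List (Entry Dom)}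
    (he : RemovesAll (s.buf₂ t ++ e) (u.pend t) p) :
    ∃ s', Steps P s [] s' ∧ Sim s' u ∧ s'.buf₂ = Function.update s.buf₂ t (s.buf₂ t ++ e) := by
  induction e generalizing s with
  | nil => exact ⟨s, .refl _, h, by simp⟩
  | cons y e ih =>
    rw [List.append_cons] at he
    obtain ⟨p₁, h1, h2⟩ := RemovesAll_append.1 he
    obtain ⟨a, v, l, rfl, hl, -⟩ := (h.split t).advance h1
    have hst := Step.advance (P := P) s t a v l hl
    obtain ⟨s', h3, h4, h5⟩ := ih (h.silent hst) (by simpa using he)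
    exact ⟨s', .silent _ _ _ _ hst h3, h4, by simp [h5]⟩

/-- The silent moves have to be chosen with regard to the future: the invariant `hpre` says that the
all-addresses buffer lists the next executions of its thread. A store is moved only when it is
executed next or when a fence that it precedes is issued. -/
theorem Sim.steps_of_psteps {P : Program Thr Reg Lab Dom} {u u' : PState Thr Reg Lab Dom}
    {τ : List (Act Thr Dom)} (h : PSteps P u τ u') (hu : ∀ t, u'.pend t = [])
    {s : State Thr Reg Lab Dom} (hs : Sim s u) (hpre : ∀ t, s.buf₂ t <+: execsOf t τ) :
    ∃ s', Steps P s τ s' ∧ ∀ t, s'.buf₂ t = [] ∧ ∀ a, s'.buf₁ t a = [] := by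
  induction τ generalizing u s with
  | nil =>
    cases h
    exact ⟨s, .refl _, fun t => (hu t ▸ hs.split t : Split _ _ []).of_nil⟩
  | cons x τ ih =>
    obtain ⟨u₁, hst, h⟩ := h
    have fin : ∀ s₁, Step P s (some x) s₁ → Sim s₁ u₁ →
        (∀ t, s₁.buf₂ t <+: execsOf t τ) →
        ∃ s', Steps P s (x :: τ) s' ∧ ∀ t, s'.buf₂ t = [] ∧ ∀ a, s'.buf₁ t a = [] := by
      intro s₁ h1 h2 h3
      obtain ⟨s', h4, h5⟩ := ih h h2 h3
      exact ⟨s', .act _ _ _ _ _ h1 h4, h5⟩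
    obtain ⟨q, p, hc, hb, rfl⟩ := hst
    obtain ⟨t, op⟩ := x
    simp only at hc hb h fin
    rw [hs.ctl] at hc
    have other : ∀ t', t' ≠ t → execsOf t' (⟨t, op⟩ :: τ) = execsOf t' τ := by
      intro t' ht
      have : t ≠ t' := fun e => ht e.symm
      simp [execsOf, this]
    have nonexec : (∀ e, op ≠ .exec e) → ∀ t', execsOf t' (⟨t, op⟩ :: τ) = execsOf t' τ := by
      intro ho t'
      cases op <;> simp_all [execsOf]
    cases hc with
    | ld l l' r ea ρ v hI =>
      obtain ⟨rfl, hv⟩ := hb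
      rw [hs.read] at hv
      have h1 := fun t' => nonexec (by simp) t' ▸ hpre t'
      rcases hv with hv | ⟨h₁, hv⟩ | ⟨h₁, h₂, hv⟩
      · refine fin _ (.earlyRead₁ s t _ _ _ _ _ _ hI rfl rfl hv)
          ⟨hs.ctl_update _ _ _, hs.mem, by simpa using hs.split⟩ h1
      · refine fin _ (.earlyRead₂ s t _ _ _ _ _ _ hI rfl rfl h₁ hv)
          ⟨hs.ctl_update _ _ _, hs.mem, by simpa using hs.split⟩ h1
      · refine fin _ (.readMemory s t _ _ _ _ _ _ hI rfl rfl h₁ h₂ hv)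
          ⟨hs.ctl_update _ _ _, hs.mem, by simpa using hs.split⟩ h1
    | store l l' ea ev ρ hI =>
      obtain rfl := hb
      have h1 := fun t' => nonexec (by simp) t' ▸ hpre t'
      refine fin _ (.issueStore s t _ _ _ _ _ _ hI rfl rfl rfl)
        ⟨hs.ctl_update_pc _ _, hs.mem, fun t' => ?_⟩ h1
      by_cases ht : t' = t
      · subst ht; simpa using (hs.split t').issue_store _ _
      · simpa [ht] using hs.split t'
    | fence l l' es ρ hI =>
      obtain rfl := hb
      have h1 := fun t' => nonexec (by simp) t' ▸ hpre t'
      obtain ⟨e₁, e₂, p₁, h2, h3, h4⟩ := execsOf_of_fence h (hu t)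
        (as := es.map fun e => e.eval (s.reg t)) (p := u.pend t) (r := []) (by simp)
      obtain ⟨p₂, h5, h6, h7⟩ := split_iff.1 (hs.split t)
      -- If the buffer extended beyond `e₁`, it would contain a fence equal to the new one. That
      -- older fence would still be pending after the removal of `e₁` and would block the new one.
      have h8 : s.buf₂ t <+: e₁ := by
        obtain ⟨c, hc⟩ := h1 t
        rw [h2, List.append_eq_append_iff] at hc
        rcases hc with ⟨d, rfl, -⟩ | ⟨d, hd, hd'⟩
        · exact ⟨d, rfl⟩
        · cases d with
          | nil => exact ⟨[], by simp [hd]⟩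
          | cons y d =>
            simp only [List.cons_append, List.cons.injEq] at hd'
            rw [hd, RemovesAll_append] at h5
            obtain ⟨p₃, h9, p₄, ⟨l₁, r₁, h10, -⟩, -⟩ := h5
            rw [h9.det h3] at h10
            exact absurd (by rw [← hd'.1]; trivial) (h4 y (by simp [h10]))
      obtain ⟨e, rfl⟩ := h8
      obtain ⟨s₁, h9, h10, h11⟩ := hs.advance_all (P := P) t h3
      have hctl := (h10.ctl t).symm.trans (hs.ctl t)
      simp only [Prod.mk.injEq] at hctl
      -- What is not in the all-addresses buffer after these moves does not block the fence, so it
      -- goes to none of the listed addresses.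
      have hemp : ∀ a ∈ es.map (fun e => e.eval (s.reg t)), s₁.buf₁ t a = [] := by
        intro a ha
        obtain ⟨p₅, h12, h13, -⟩ := split_iff.1 (h10.split t)
        rw [h11, Function.update_self] at h12
        rw [← h13, h12.det h3]
        exact storesTo_eq_nil.2 fun v hv => h4 _ hv ha
      have hst := Step.issueFence (P := P) s₁ t _ _ es _ hI hctl.1 (by rw [hctl.2]) hemp
      have hctl' : ∀ t', Function.update u.ctl t (l', s.reg t) t' =
          (Function.update s₁.pc t l' t', s₁.reg t') := by
        rw [← hctl.2]; exact h10.ctl_update_pc _ _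
      have hsplit : ∀ t', Split (s₁.buf₁ t')
          (Function.update s₁.buf₂ t (s₁.buf₂ t ++ [.fence (es.map fun e => e.eval (s.reg t))]) t')
          (Function.update u.pend t
            (u.pend t ++ [.fence (es.map fun e => e.eval (s.reg t))]) t') := by
        intro t'
        by_cases ht : t' = t
        · subst ht; simpa using (h10.split t').issue_fence hemp
        · simpa [ht] using h10.split t'
      have hpre' : ∀ t', Function.update s₁.buf₂ t
          (s₁.buf₂ t ++ [.fence (es.map fun e => e.eval (s.reg t))]) t' <+: execsOf t' τ := by
        intro t'
        by_cases ht : t' = t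
        · subst ht
          simp only [h11, Function.update_self]
          exact ⟨e₂, by simp [h2]⟩
        · simpa [ht, h11] using h1 t'
      obtain ⟨s', h14, h15⟩ := ih h (s := { s₁ with
          pc := Function.update s₁.pc t l'
          buf₂ := Function.update s₁.buf₂ t
            (s₁.buf₂ t ++ [.fence (es.map fun e => e.eval (s.reg t))]) })
          ⟨hctl', h10.mem, hsplit⟩ hpre'
      exact ⟨s', h9.trans (.act _ _ _ _ _ hst h14), h15⟩
    | scfence l l' ρ hI =>
      obtain ⟨hp, rfl⟩ := hb
      have h1 := fun t' => nonexec (by simp) t' ▸ hpre t'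
      have h2 := (hp ▸ hs.split t : Split _ _ []).of_nil
      exact fin _ (.scfence s t _ _ hI rfl h2.1 h2.2)
        ⟨hs.ctl_update_pc _ _, hs.mem, by simpa using hs.split⟩ h1
    | assign l l' r e ρ hI =>
      obtain rfl := hb
      have h1 := fun t' => nonexec (by simp) t' ▸ hpre t'
      exact fin _ (.assign s t _ _ _ _ hI rfl)
        ⟨hs.ctl_update _ _ _, hs.mem, by simpa using hs.split⟩ h1
    | assert l l' e ρ hI he =>
      obtain rfl := hb
      have h1 := fun t' => nonexec (by simp) t' ▸ hpre t'
      exact fin _ (.assert s t _ _ _ hI rfl he)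
        ⟨hs.ctl_update_pc _ _, hs.mem, by simpa using hs.split⟩ h1
    | exec q y =>
      have h1 : execsOf t (⟨t, .exec y⟩ :: τ) = y :: execsOf t τ := by simp [execsOf]
      have key : ∃ s₁ b, Steps P s [] s₁ ∧ Sim s₁ u ∧ s₁.buf₂ t = y :: b ∧
          ∀ t', s₁.buf₂ t' <+: execsOf t' (⟨t, .exec y⟩ :: τ) := by
        -- If the buffer is empty, `y` has to be moved there first; otherwise the invariant forces
        -- its head to be `y`.
        cases hbuf : s.buf₂ t with
        | nil =>
          obtain ⟨s₁, h2, h3, h4⟩ := hs.advance_all (P := P) t (e := [y]) (p := p)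
            (by rw [hbuf]; exact ⟨_, hb, rfl⟩)
          refine ⟨s₁, [], h2, h3, by simp [h4, hbuf], fun t' => ?_⟩
          by_cases ht : t' = t
          · subst ht; simp [h4, h1, hbuf]
          · simpa [ht, h4] using hpre t'
        | cons z b =>
          have h2 := hpre t
          rw [hbuf, h1, List.cons_prefix_cons] at h2
          exact ⟨s, b, .refl _, hs, by rw [hbuf, h2.1], hpre⟩
      obtain ⟨s₁, b, h2, h3, h4, h5⟩ := key
      have h6 := h3.split t
      rw [h4] at h6
      have hpre' : ∀ t', Function.update s₁.buf₂ t b t' <+: execsOf t' τ := by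
        intro t'
        by_cases ht : t' = t
        · subst ht
          have h7 := h5 t'
          rw [h4, h1, List.cons_prefix_cons] at h7
          simpa using h7.2
        · simpa [ht, other t' ht] using h5 t'
      have hsplit : ∀ t', Split (s₁.buf₁ t') (Function.update s₁.buf₂ t b t')
          (Function.update u.pend t p t') := by
        intro t'
        by_cases ht : t' = t
        · subst ht; simpa using h6.exec hb
        · simpa [ht] using h3.split t'
      rw [← hs.ctl t] at h
      simp only [Function.update_eq_self] at h
      cases y with
      | store a v =>
        obtain ⟨s', h7, h8⟩ := ih h (s := { s₁ with
            mem := Function.update s₁.mem a v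
            buf₂ := Function.update s₁.buf₂ t b })
          ⟨h3.ctl, by simp [Op.memAfter, h3.mem], hsplit⟩ hpre'
        exact ⟨s', h2.trans (.act _ _ _ _ _ (.storeToMemory s₁ t a v b h4) h7), h8⟩
      | fence as =>
        obtain ⟨s', h7, h8⟩ := ih h (s := { s₁ with buf₂ := Function.update s₁.buf₂ t b })
          ⟨h3.ctl, by simp [Op.memAfter, h3.mem], hsplit⟩ hpre'
        exact ⟨s', h2.trans (.act _ _ _ _ _ (.fence s₁ t as b h4) h7), h8⟩

/-- All later arguments about executability rest on this description, and silent moves do not occur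
again. -/
theorem mem_comp_iff {P : Program Thr Reg Lab Dom} {τ : List (Act Thr Dom)} :
    τ ∈ P.Comp ↔ ∃ u, PSteps P P.initP τ u ∧ ∀ t, u.pend t = [] := by
  constructor
  · rintro ⟨s, h, hs⟩
    obtain ⟨u, h1, h2⟩ := (Sim.init P).steps h
    refine ⟨u, h1, fun t => ?_⟩
    have h3 := h2.split t
    rw [(hs t).1] at h3
    exact h3.eq_nil (hs t).2
  · rintro ⟨u, h, hu⟩
    exact Sim.steps_of_psteps h hu (Sim.init P) fun t => ⟨_, rfl⟩

end Pgas

namespace Pgas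

variable {Thr Dom : Type*} [DecidableEq Thr] [DecidableEq Dom]

/-! ### Issue and execution counts -/

/-- Position `i` carries an issue of channel `k`. -/
def IsuAt (τ : List (Act Thr Dom)) (k : Thr × Option Dom) (i : ℕ) : Prop :=
  τ[i]?.bind Act.isuChan = some k

/-- Position `j` carries a store or fence action of channel `k`. -/
def ExecAt (τ : List (Act Thr Dom)) (k : Thr × Option Dom) (j : ℕ) : Prop :=
  τ[j]?.bind Act.execChan = some k

instance (τ : List (Act Thr Dom)) (k : Thr × Option Dom) : DecidablePred (IsuAt τ k) :=
  fun i => inferInstanceAs (Decidable (τ[i]?.bind Act.isuChan = some k))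

instance (τ : List (Act Thr Dom)) (k : Thr × Option Dom) : DecidablePred (ExecAt τ k) :=
  fun i => inferInstanceAs (Decidable (τ[i]?.bind Act.execChan = some k))

/-- This replaces counting in a mapped list by counting positions, for which `Nat.count` supplies
monotonicity and injectivity. -/
theorem count_filterMap_take {α K : Type*} [BEq K] [LawfulBEq K] (f : α → Option K) (k : K)
    (τ : List α) (p : ℕ → Prop) [DecidablePred p] (hp : ∀ i, p i ↔ τ[i]?.bind f = some k)
    (n : ℕ) : ((τ.take n).filterMap f).count k = Nat.count p n := by
  induction n with
  | zero => simp
  | succ n ih =>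
    rw [Nat.count_succ, List.take_add_one, List.filterMap_append, List.count_append, ih]
    congr 1
    have hpn := hp n
    cases h : τ[n]? with
    | none => simp [h] at hpn; simp [hpn]
    | some x =>
      cases h' : f x with
      | none => simp [h, h'] at hpn; simp [h', hpn]
      | some y => simp [h, h'] at hpn; simp [h', List.count_singleton, ← hpn]

theorem issueOf_iff {τ : List (Act Thr Dom)} {i j : ℕ} :
    IssueOf τ i j ↔ ∃ k, IsuAt τ k i ∧ ExecAt τ k j ∧
      Nat.count (IsuAt τ k) i = Nat.count (ExecAt τ k) j := by
  unfold IssueOf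
  refine exists_congr fun k => and_congr_right fun _ => and_congr_right fun _ => ?_
  rw [count_filterMap_take Act.isuChan k τ (IsuAt τ k) (fun _ => Iff.rfl),
    count_filterMap_take Act.execChan k τ (ExecAt τ k) (fun _ => Iff.rfl)]

theorem IsuAt.unique {τ : List (Act Thr Dom)} {k k' : Thr × Option Dom} {i : ℕ}
    (h : IsuAt τ k i) (h' : IsuAt τ k' i) : k = k' := Option.some.inj (h.symm.trans h')

theorem ExecAt.unique {τ : List (Act Thr Dom)} {k k' : Thr × Option Dom} {i : ℕ}
    (h : ExecAt τ k i) (h' : ExecAt τ k' i) : k = k' := Option.some.inj (h.symm.trans h')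

theorem isuAt_iff {τ : List (Act Thr Dom)} {k : Thr × Option Dom} {i : ℕ} :
    IsuAt τ k i ↔ ∃ e, τ[i]? = some ⟨k.1, .isu e⟩ ∧ e.chan = k.2 := by
  unfold IsuAt
  cases h : τ[i]? with
  | none => simp
  | some x =>
    obtain ⟨t, op⟩ := x
    obtain ⟨t', c⟩ := k
    cases op <;> simp [Act.isuChan]

theorem execAt_iff {τ : List (Act Thr Dom)} {k : Thr × Option Dom} {i : ℕ} :
    ExecAt τ k i ↔ ∃ e, τ[i]? = some ⟨k.1, .exec e⟩ ∧ e.chan = k.2 := by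
  unfold ExecAt
  cases h : τ[i]? with
  | none => simp
  | some x =>
    obtain ⟨t, op⟩ := x
    obtain ⟨t', c⟩ := k
    cases op <;> simp [Act.execChan]

theorem IsuAt.not_execAt {τ : List (Act Thr Dom)} {k k' : Thr × Option Dom} {i : ℕ}
    (h : IsuAt τ k i) : ¬ ExecAt τ k' i := by
  intro h'
  obtain ⟨e, h, -⟩ := isuAt_iff.1 h
  obtain ⟨e', h', -⟩ := execAt_iff.1 h'
  simp [h] at h'

theorem storeAt_iff {τ : List (Act Thr Dom)} {i : ℕ} {a : Dom} :
    StoreAt τ i a ↔ ∃ t, ExecAt τ (t, some a) i := by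
  simp only [execAt_iff, StoreAt]
  refine exists_congr fun t => ⟨?_, ?_⟩
  · rintro ⟨v, h⟩; exact ⟨_, h, rfl⟩
  · rintro ⟨⟨b, v⟩ | as, h, h'⟩
    · cases h'; exact ⟨v, h⟩
    · simp [Entry.chan] at h'

theorem StoreAt.unique {τ : List (Act Thr Dom)} {i : ℕ} {a b : Dom} (h : StoreAt τ i a)
    (h' : StoreAt τ i b) : a = b := by
  obtain ⟨t, h⟩ := storeAt_iff.1 h
  obtain ⟨t', h'⟩ := storeAt_iff.1 h'
  simpa using (Prod.ext_iff.1 (h.unique h')).2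

theorem LoadAt.unique {τ : List (Act Thr Dom)} {i : ℕ} {t t' : Thr} {a b : Dom}
    (h : LoadAt τ i t a) (h' : LoadAt τ i t' b) : t = t' ∧ a = b := by
  obtain ⟨v, h⟩ := h
  obtain ⟨v', h'⟩ := h'
  rw [h] at h'
  simp at h'
  exact ⟨h'.1, h'.2.1⟩

theorem LoadAt.not_execAt {τ : List (Act Thr Dom)} {i : ℕ} {t : Thr} {a : Dom}
    {k : Thr × Option Dom} (h : LoadAt τ i t a) : ¬ ExecAt τ k i := by
  intro h'
  obtain ⟨v, h⟩ := h
  obtain ⟨e', h', -⟩ := execAt_iff.1 h'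
  simp [h] at h'

theorem LoadAt.not_isuAt {τ : List (Act Thr Dom)} {i : ℕ} {t : Thr} {a : Dom}
    {k : Thr × Option Dom} (h : LoadAt τ i t a) : ¬ IsuAt τ k i := by
  intro h'
  obtain ⟨v, h⟩ := h
  obtain ⟨e', h', -⟩ := isuAt_iff.1 h'
  simp [h] at h'

theorem LoadAt.not_storeAt {τ : List (Act Thr Dom)} {i : ℕ} {t : Thr} {a b : Dom}
    (h : LoadAt τ i t a) : ¬ StoreAt τ i b := by
  intro h'
  obtain ⟨t', h'⟩ := storeAt_iff.1 h'
  exact h.not_execAt h'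

theorem isNode_iff {τ : List (Act Thr Dom)} {i : ℕ} :
    IsNode τ i ↔ i < τ.length ∧ ∀ k, ¬ ExecAt τ k i := by
  unfold IsNode ExecAt
  cases h : τ[i]? with
  | none => simp at h; simp [h]
  | some x =>
    have : i < τ.length := by
      by_contra h'
      simp at h'
      simp [h'] at h
    simp [this, Option.eq_none_iff_forall_not_mem]

theorem IsuAt.lt_length {τ : List (Act Thr Dom)} {k : Thr × Option Dom} {i : ℕ}
    (h : IsuAt τ k i) : i < τ.length := by
  by_contra h'
  simp at h'
  simp [IsuAt, h'] at h

theorem ExecAt.lt_length {τ : List (Act Thr Dom)} {k : Thr × Option Dom} {i : ℕ}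
    (h : ExecAt τ k i) : i < τ.length := by
  by_contra h'
  simp at h'
  simp [ExecAt, h'] at h

theorem StoreAt.lt_length {τ : List (Act Thr Dom)} {i : ℕ} {a : Dom}
    (h : StoreAt τ i a) : i < τ.length := by
  obtain ⟨t, h⟩ := storeAt_iff.1 h
  exact h.lt_length

theorem IsuAt.isNode {τ : List (Act Thr Dom)} {k : Thr × Option Dom} {i : ℕ}
    (h : IsuAt τ k i) : IsNode τ i := isNode_iff.2 ⟨h.lt_length, fun _ => h.not_execAt⟩

theorem LoadAt.isNode {τ : List (Act Thr Dom)} {i : ℕ} {t : Thr} {a : Dom}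
    (h : LoadAt τ i t a) : IsNode τ i := by
  obtain ⟨v, h⟩ := h
  exact ⟨_, h, rfl⟩

theorem IssueOf.isuAt {τ : List (Act Thr Dom)} {i j : ℕ} (h : IssueOf τ i j) :
    ∃ k, IsuAt τ k i ∧ ExecAt τ k j := by
  obtain ⟨k, h1, h2, -⟩ := issueOf_iff.1 h
  exact ⟨k, h1, h2⟩

/-- The number of earlier issues of a channel determines the position of an issue of this channel.
-/
theorem IssueOf.issue_unique {τ : List (Act Thr Dom)} {i i' j : ℕ} (h : IssueOf τ i j)
    (h' : IssueOf τ i' j) : i = i' := by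
  obtain ⟨k, h1, h2, h3⟩ := issueOf_iff.1 h
  obtain ⟨k', h1', h2', h3'⟩ := issueOf_iff.1 h'
  obtain rfl := h2.unique h2'
  exact Nat.count_injective h1 h1' (h3.trans h3'.symm)

theorem IssueOf.exec_unique {τ : List (Act Thr Dom)} {i j j' : ℕ} (h : IssueOf τ i j)
    (h' : IssueOf τ i j') : j = j' := by
  obtain ⟨k, h1, h2, h3⟩ := issueOf_iff.1 h
  obtain ⟨k', h1', h2', h3'⟩ := issueOf_iff.1 h'
  obtain rfl := h1.unique h1'
  exact Nat.count_injective h2 h2' (h3.symm.trans h3')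

/-- Actions of one channel are executed in the order of their issues. -/
theorem IssueOf.lt_of_lt {τ : List (Act Thr Dom)} {i j i' j' : ℕ} {k : Thr × Option Dom}
    (h : IssueOf τ i j) (h' : IssueOf τ i' j') (hk : ExecAt τ k j) (hk' : ExecAt τ k j')
    (hlt : i < i') : j < j' := by
  obtain ⟨k₁, h1, h2, h3⟩ := issueOf_iff.1 h
  obtain ⟨k₂, h1', h2', h3'⟩ := issueOf_iff.1 h'
  obtain rfl := hk.unique h2
  obtain rfl := hk'.unique h2'
  have h4 := Nat.count_strict_mono h1 hlt
  rw [h3, h3'] at h4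
  exact Nat.lt_of_count_lt_count h4

theorem IssueOf.lt_iff {τ : List (Act Thr Dom)} {i j i' j' : ℕ} {k : Thr × Option Dom}
    (h : IssueOf τ i j) (h' : IssueOf τ i' j') (hk : ExecAt τ k j) (hk' : ExecAt τ k j') :
    i < i' ↔ j < j' := by
  refine ⟨h.lt_of_lt h' hk hk', fun hlt => ?_⟩
  rcases lt_trichotomy i i' with h1 | h1 | h1
  · exact h1
  · subst h1; exact absurd (h.exec_unique h') hlt.ne
  · exact absurd (h'.lt_of_lt h hk' hk h1) hlt.le.not_gt

theorem SameThread.symm {τ : List (Act Thr Dom)} {i j : ℕ} (h : SameThread τ i j) :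
    SameThread τ j i := by
  obtain ⟨x, y, h1, h2, h3⟩ := h
  exact ⟨y, x, h2, h1, h3.symm⟩

theorem SameThread.trans {τ : List (Act Thr Dom)} {i j l : ℕ} (h : SameThread τ i j)
    (h' : SameThread τ j l) : SameThread τ i l := by
  obtain ⟨x, y, h1, h2, h3⟩ := h
  obtain ⟨y', z, h4, h5, h6⟩ := h'
  rw [h2] at h4
  cases h4
  exact ⟨x, z, h1, h5, h3.trans h6⟩

theorem sameThread_iff {τ : List (Act Thr Dom)} {i j : ℕ} :
    SameThread τ i j ↔ ∃ t, τ[i]?.map Act.thr = some t ∧ τ[j]?.map Act.thr = some t := by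
  simp only [Option.map_eq_some_iff]
  constructor
  · rintro ⟨x, y, h1, h2, h3⟩; exact ⟨_, ⟨x, h1, rfl⟩, y, h2, h3.symm⟩
  · rintro ⟨t, ⟨x, h1, rfl⟩, y, h2, h3⟩; exact ⟨x, y, h1, h2, h3.symm⟩

theorem IsuAt.thr {τ : List (Act Thr Dom)} {k : Thr × Option Dom} {i : ℕ}
    (h : IsuAt τ k i) : τ[i]?.map Act.thr = some k.1 := by
  obtain ⟨e, h, -⟩ := isuAt_iff.1 h; simp [h]

theorem ExecAt.thr {τ : List (Act Thr Dom)} {k : Thr × Option Dom} {i : ℕ}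
    (h : ExecAt τ k i) : τ[i]?.map Act.thr = some k.1 := by
  obtain ⟨e, h, -⟩ := execAt_iff.1 h; simp [h]

theorem LoadAt.thr {τ : List (Act Thr Dom)} {i : ℕ} {t : Thr} {a : Dom}
    (h : LoadAt τ i t a) : τ[i]?.map Act.thr = some t := by
  obtain ⟨v, h⟩ := h; simp [h]

theorem IssueOf.sameThread {τ : List (Act Thr Dom)} {i j : ℕ} (h : IssueOf τ i j) :
    SameThread τ i j := by
  obtain ⟨k, h1, h2⟩ := h.isuAt
  exact sameThread_iff.2 ⟨_, h1.thr, h2.thr⟩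

/-- Issues precede the actions they belong to, and every issue has its action. -/
structure Complete (τ : List (Act Thr Dom)) : Prop where
  le : ∀ k n, Nat.count (ExecAt τ k) n ≤ Nat.count (IsuAt τ k) n
  eq : ∀ k, Nat.count (ExecAt τ k) τ.length = Nat.count (IsuAt τ k) τ.length

/-- A count grows in steps of one, so every smaller value is attained, at a position that satisfies
`p`. -/
theorem exists_count_eq {p : ℕ → Prop} [DecidablePred p] {c n : ℕ} (h : c < Nat.count p n) :
    ∃ i < n, p i ∧ Nat.count p i = c := by
  induction n with
  | zero => simp at h
  | succ n ih =>
    by_cases hc : c < Nat.count p n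
    · obtain ⟨i, h1, h2⟩ := ih hc
      exact ⟨i, by omega, h2⟩
    · rw [Nat.count_succ] at h
      by_cases hp : p n
      · simp only [hp, if_true] at h
        exact ⟨n, by omega, hp, by omega⟩
      · simp [hp] at h; omega

/-- Otherwise the prefix of length `j + 1` would contain more executions than issues of the channel.
-/
theorem Complete.lt {τ : List (Act Thr Dom)} (hτ : Complete τ) {i j : ℕ} (h : IssueOf τ i j) :
    i < j := by
  obtain ⟨k, h1, h2, h3⟩ := issueOf_iff.1 h
  by_contra hlt
  have hne : i ≠ j := fun e => h1.not_execAt (e ▸ h2)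
  have h4 := hτ.le k (j + 1)
  have h5 := Nat.count_monotone (IsuAt τ k) (show j + 1 ≤ i by omega)
  have h6 : Nat.count (ExecAt τ k) (j + 1) = Nat.count (ExecAt τ k) j + 1 := by
    rw [Nat.count_succ]; simp [h2]
  omega

theorem Complete.exists_issue {τ : List (Act Thr Dom)} (hτ : Complete τ) {j : ℕ}
    {k : Thr × Option Dom} (h : ExecAt τ k j) : ∃ i, IssueOf τ i j := by
  have h4 := hτ.le k (j + 1)
  have h6 : Nat.count (ExecAt τ k) (j + 1) = Nat.count (ExecAt τ k) j + 1 := by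
    rw [Nat.count_succ]; simp [h]
  obtain ⟨i, -, h7, h8⟩ := exists_count_eq (lt_of_lt_of_le (by omega) h4 :
    Nat.count (ExecAt τ k) j < _)
  exact ⟨i, issueOf_iff.2 ⟨k, h7, h, h8⟩⟩

theorem Complete.exists_exec {τ : List (Act Thr Dom)} (hτ : Complete τ) {i : ℕ}
    {k : Thr × Option Dom} (h : IsuAt τ k i) : ∃ j, IssueOf τ i j := by
  have h1 := Nat.count_strict_mono h h.lt_length
  rw [← hτ.eq] at h1
  obtain ⟨j, -, h7, h8⟩ := exists_count_eq h1
  exact ⟨j, issueOf_iff.2 ⟨k, h, h7, h8.symm⟩⟩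

theorem not_isNode_iff {τ : List (Act Thr Dom)} {i : ℕ} (h : i < τ.length) :
    ¬ IsNode τ i ↔ ∃ k, ExecAt τ k i := by
  rw [isNode_iff]; simp [h]

theorem Rep.unique {τ : List (Act Thr Dom)} {m i i' : ℕ} (h : Rep τ m i) (h' : Rep τ m i') :
    i = i' := by
  have aux : ∀ i i', IsNode τ i → ¬ IssueOf τ i' i := by
    intro i i' h h'
    obtain ⟨k, -, h2⟩ := h'.isuAt
    exact (isNode_iff.1 h).2 _ h2
  rcases h with ⟨rfl, h⟩ | h <;> rcases h' with ⟨rfl, h'⟩ | h'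
  · rfl
  · exact absurd h' (aux _ _ h)
  · exact absurd h (aux _ _ h')
  · exact h.issue_unique h'

theorem Rep.isNode {τ : List (Act Thr Dom)} {m i : ℕ} (h : Rep τ m i) : IsNode τ i := by
  rcases h with ⟨rfl, h⟩ | h
  · exact h
  · obtain ⟨k, h1, -⟩ := h.isuAt
    exact h1.isNode

theorem Rep.sameThread {τ : List (Act Thr Dom)} {m i : ℕ} (h : Rep τ m i) :
    SameThread τ m i := by
  rcases h with ⟨rfl, x, h, -⟩ | h
  · exact ⟨x, x, h, h, rfl⟩
  · exact h.sameThread.symm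

theorem IsNode.rep {τ : List (Act Thr Dom)} {i : ℕ} (h : IsNode τ i) : Rep τ i i := .inl ⟨rfl, h⟩

theorem Rep.eq_of_isNode {τ : List (Act Thr Dom)} {m i : ℕ} (h : Rep τ m i) (hm : IsNode τ m) :
    i = m := h.unique hm.rep

theorem Complete.exists_rep {τ : List (Act Thr Dom)} (hτ : Complete τ) {m : ℕ}
    (hm : m < τ.length) : ∃ i, Rep τ m i := by
  by_cases h : IsNode τ m
  · exact ⟨m, h.rep⟩
  · obtain ⟨k, hk⟩ := (not_isNode_iff hm).1 h
    obtain ⟨i, hi⟩ := hτ.exists_issue hk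
    exact ⟨i, .inr hi⟩

theorem Complete.rep_le {τ : List (Act Thr Dom)} (hτ : Complete τ) {m i : ℕ} (h : Rep τ m i) :
    i ≤ m := by
  rcases h with ⟨rfl, h⟩ | h
  · exact le_rfl
  · exact (hτ.lt h).le

/-! ### Visible stores -/

/-- The store at `s` is visible to the load at `l`: it goes to the same address, and it has reached
the memory before `l` or is a store of the own thread that is issued before `l`. -/
def Vis (τ : List (Act Thr Dom)) (s l : ℕ) : Prop :=
  ∃ t a, LoadAt τ l t a ∧ StoreAt τ s a ∧ (s < l ∨ ∃ i < l, IssueOf τ i s ∧ SameThread τ i l)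

theorem pending_iff {τ : List (Act Thr Dom)} {t : Thr} {a : Dom} {l i s : ℕ}
    (hl : LoadAt τ l t a) : Pending τ t a l i s ↔
      i < l ∧ l < s ∧ IssueOf τ i s ∧ StoreAt τ s a ∧ SameThread τ i l := by
  constructor
  · rintro ⟨h1, h2, h3, v, h4⟩
    refine ⟨h1, h2, h3, ⟨t, v, h4⟩, h3.sameThread.trans ?_⟩
    exact sameThread_iff.2 ⟨t, by simp [h4], hl.thr⟩
  · rintro ⟨h1, h2, h3, ⟨t', v, h4⟩, h5⟩
    refine ⟨h1, h2, h3, v, ?_⟩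
    obtain ⟨t₁, h6, h7⟩ := sameThread_iff.1 (h3.sameThread.symm.trans h5)
    rw [hl.thr] at h7
    simp [h4] at h6
    simp at h7
    rw [h4, h6, h7]

/-- The source of a load is the latest visible store. -/
theorem src_iff {τ : List (Act Thr Dom)} {s l : ℕ} :
    Src τ s l ↔ Vis τ s l ∧ ∀ s', Vis τ s' l → s' ≤ s := by
  constructor
  · rintro ⟨t, a, hl, ⟨i, hp, hmax⟩ | ⟨hno, hs, hlt, hmax⟩⟩
    · obtain ⟨h1, h2, h3, h4, h5⟩ := (pending_iff hl).1 hp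
      refine ⟨⟨t, a, hl, h4, .inr ⟨i, h1, h3, h5⟩⟩, ?_⟩
      rintro s' ⟨t', a', hl', hs', h⟩
      obtain ⟨rfl, rfl⟩ := hl.unique hl'
      by_cases hlt : s' < l
      · omega
      obtain ⟨i', h6, h7, h8⟩ := h.resolve_left hlt
      have hne : s' ≠ l := by rintro rfl; exact hl.not_storeAt hs'
      have h9 := hmax i' s' ((pending_iff hl).2 ⟨h6, by omega, h7, hs', h8⟩)
      by_contra hss
      obtain ⟨t₁, hk⟩ := storeAt_iff.1 h4
      obtain ⟨t₂, hk'⟩ := storeAt_iff.1 hs'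
      have h10 := h3.sameThread.symm.trans (h5.trans (h8.symm.trans h7.sameThread))
      obtain ⟨t₃, h11, h12⟩ := sameThread_iff.1 h10
      rw [hk.thr] at h11
      rw [hk'.thr] at h12
      simp at h11 h12
      subst h11 h12
      -- Both stores lie in the channel of the load's thread and address, so the later executed one
      -- is issued later.
      have := (h3.lt_iff h7 hk hk').2 (by omega)
      omega
    · refine ⟨⟨t, a, hl, hs, .inl hlt⟩, ?_⟩
      rintro s' ⟨t', a', hl', hs', h⟩
      obtain ⟨rfl, rfl⟩ := hl.unique hl'
      by_cases hlt : s' < l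
      · exact hmax _ hs' hlt
      obtain ⟨i', h6, h7, h8⟩ := h.resolve_left hlt
      have hne : s' ≠ l := by rintro rfl; exact hl.not_storeAt hs'
      exact absurd ⟨i', s', (pending_iff hl).2 ⟨h6, by omega, h7, hs', h8⟩⟩ hno
  · rintro ⟨⟨t, a, hl, hs, h⟩, hmax⟩
    refine ⟨t, a, hl, ?_⟩
    by_cases hlt : s < l
    · refine .inr ⟨?_, hs, hlt, fun s' hs' hlt' => hmax s' ⟨t, a, hl, hs', .inl hlt'⟩⟩
      rintro ⟨i, s', hp⟩
      obtain ⟨h1, h2, h3, h4, h5⟩ := (pending_iff hl).1 hp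
      have := hmax s' ⟨t, a, hl, h4, .inr ⟨i, h1, h3, h5⟩⟩
      omega
    · obtain ⟨i, h1, h2, h3⟩ := h.resolve_left hlt
      have hne : s ≠ l := by rintro rfl; exact hl.not_storeAt hs
      have hp := (pending_iff hl).2 ⟨h1, by omega, h2, hs, h3⟩
      refine .inl ⟨i, hp, fun i' s' hp' => ?_⟩
      obtain ⟨h4, h5, h6, h7, h8⟩ := (pending_iff hl).1 hp'
      have h9 := hmax s' ⟨t, a, hl, h7, .inr ⟨i', h4, h6, h8⟩⟩
      obtain ⟨v, hv⟩ := hp.2.2.2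
      obtain ⟨v', hv'⟩ := hp'.2.2.2
      by_contra hlt
      have := h2.lt_of_lt h6 (k := (t, some a)) (execAt_iff.2 ⟨_, hv, rfl⟩)
        (execAt_iff.2 ⟨_, hv', rfl⟩) (by omega)
      omega

theorem exists_src {τ : List (Act Thr Dom)} {s l : ℕ} (h : Vis τ s l) :
    ∃ s', Src τ s' l ∧ s ≤ s' := by
  classical
  have hb : ∀ s', Vis τ s' l → s' ≤ τ.length := by
    rintro s' ⟨t, a, -, h, -⟩
    exact h.lt_length.le
  refine ⟨Nat.findGreatest (fun s' => Vis τ s' l) τ.length, src_iff.2 ⟨?_, ?_⟩, ?_⟩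
  · exact Nat.findGreatest_spec (P := fun s' => Vis τ s' l) (hb s h) h
  · exact fun s' h' => Nat.le_findGreatest (P := fun s' => Vis τ s' l) (hb _ h') h'
  · exact Nat.le_findGreatest (P := fun s' => Vis τ s' l) (hb _ h) h

theorem st_iff {τ : List (Act Thr Dom)} {m n : ℕ} {a : Dom} (hn : StoreAt τ n a) :
    St τ m n ↔ m < n ∧ StoreAt τ m a := by
  constructor
  · rintro ⟨h, b, h1, h2⟩
    exact ⟨h, h2.unique hn ▸ h1⟩
  · rintro ⟨h, h1⟩
    exact ⟨h, a, h1, hn⟩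

/-- By `exists_src` a load has no source exactly if no store is visible to it. In this form
conflicts can be compared between computations without mentioning pending stores. -/
theorem cf_iff {τ : List (Act Thr Dom)} {l s : ℕ} :
    Cf τ l s ↔ ∃ t a, LoadAt τ l t a ∧ StoreAt τ s a ∧
      ((∃ s', Src τ s' l ∧ s' < s) ∨
        ((∀ s', ¬ Vis τ s' l) ∧ ∀ s', StoreAt τ s' a → s ≤ s')) := by
  unfold Cf
  refine exists_congr fun t => exists_congr fun a => and_congr_right fun hl =>
    and_congr_right fun hs => or_congr ?_ (and_congr ?_ ?_)
  · refine exists_congr fun s' => and_congr_right fun h => ?_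
    rw [st_iff hs]
    refine and_iff_left_of_imp fun _ => ?_
    obtain ⟨⟨t', a', hl', hs', -⟩, -⟩ := src_iff.1 h
    rwa [(hl.unique hl').2]
  · constructor
    · intro h s' hv
      obtain ⟨s₁, h1, -⟩ := exists_src hv
      exact h ⟨s₁, h1⟩
    · rintro h ⟨s', h1⟩
      exact h s' (src_iff.1 h1).1
  · constructor
    · intro h s' hs'
      by_contra hlt
      exact h ⟨s', (st_iff hs).2 ⟨by omega, hs'⟩⟩
    · rintro h ⟨s', h1⟩
      rw [st_iff hs] at h1
      have := h s' h1.2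
      omega

/-- A store that is not visible to a load of its address conflicts with it, possibly through other
stores, and directly if all visible stores are earlier and no invisible one is. -/
theorem Cf.of_vis_lt {τ : List (Act Thr Dom)} {l s : ℕ} {t : Thr} {a : Dom}
    (hl : LoadAt τ l t a) (hs : StoreAt τ s a) (h : ∀ s', Vis τ s' l → s' < s)
    (h' : ∀ s', StoreAt τ s' a → s' < s → Vis τ s' l) : Cf τ l s := by
  refine cf_iff.2 ⟨t, a, hl, hs, ?_⟩
  by_cases hv : ∃ s', Vis τ s' l
  · obtain ⟨s', hv⟩ := hv
    obtain ⟨s₁, h1, -⟩ := exists_src hv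
    exact .inl ⟨s₁, h1, h _ (src_iff.1 h1).1⟩
  · push Not at hv
    refine .inr ⟨hv, fun s' hs' => ?_⟩
    by_contra hlt
    exact hv s' (h' s' hs' (by omega))

theorem not_vis_of_cf {τ : List (Act Thr Dom)} {l s : ℕ} (h : Cf τ l s) : ¬ Vis τ s l := by
  intro hv
  obtain ⟨t, a, -, -, ⟨s', h1, h2⟩ | ⟨h1, -⟩⟩ := cf_iff.1 h
  · have := (src_iff.1 h1).2 s hv
    omega
  · exact h1 s hv

/-! ### Cycles -/

/-- The happens-before relation has a cycle. -/
def Cyclic (τ : List (Act Thr Dom)) : Prop := ∃ j, Relation.TransGen (Hb τ) j j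

/-- The union of the edges of a trace. -/
def Trace.Edge (G : Trace Thr Dom) (x y : G.Node) : Prop :=
  G.po x y ∨ G.st x y ∨ G.src x y ∨ G.cf x y

theorem Hb.exists_rep {τ : List (Act Thr Dom)} (hτ : Complete τ) {m n : ℕ} (h : Hb τ m n) :
    (∃ i, Rep τ m i) ∧ ∃ j, Rep τ n j := by
  have store : ∀ {s a}, StoreAt τ s a → ∃ i, Rep τ s i := by
    intro s a h
    obtain ⟨t, h⟩ := storeAt_iff.1 h
    obtain ⟨i, h⟩ := hτ.exists_issue h
    exact ⟨i, .inr h⟩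
  rcases h with ⟨-, i, j, hi, hj, -⟩ | ⟨-, a, h1, h2⟩ | h | h
  · exact ⟨⟨i, hi⟩, j, hj⟩
  · exact ⟨store h1, store h2⟩
  · obtain ⟨⟨t, a, hl, hs, -⟩, -⟩ := src_iff.1 h
    exact ⟨store hs, _, hl.isNode.rep⟩
  · obtain ⟨t, a, hl, hs, -⟩ := cf_iff.1 h
    exact ⟨⟨_, hl.isNode.rep⟩, store hs⟩

/-- `Hb` relates positions, where stores occur at their execution, whereas the nodes are their
issues. A position has only one node, so consecutive edges of a chain fit together and the cycle
closes. -/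
theorem Cyclic.exists_edge_cycle {τ : List (Act Thr Dom)} (hτ : Complete τ) (h : Cyclic τ) :
    ∃ x, Relation.TransGen (trace τ).Edge x x := by
  have key : ∀ m n, Relation.TransGen (Hb τ) m n → ∃ x y : {i : ℕ // IsNode τ i},
      Rep τ m x ∧ Rep τ n y ∧ Relation.TransGen (trace τ).Edge x y := by
    intro m n h
    have edge : ∀ {m n : ℕ} {x y : {i : ℕ // IsNode τ i}}, Hb τ m n → Rep τ m x → Rep τ n y →
        (trace τ).Edge x y := by
      intro m n x y h hx hy
      rcases h with h | h | h | h
      · exact .inl ⟨m, n, hx, hy, h⟩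
      · exact .inr (.inl ⟨m, n, hx, hy, h⟩)
      · exact .inr (.inr (.inl ⟨m, n, hx, hy, h⟩))
      · exact .inr (.inr (.inr ⟨m, n, hx, hy, h⟩))
    induction h with
    | single h =>
      obtain ⟨⟨i, hi⟩, j, hj⟩ := h.exists_rep hτ
      exact ⟨⟨i, hi.isNode⟩, ⟨j, hj.isNode⟩, hi, hj, .single (edge h hi hj)⟩
    | tail _ h ih =>
      obtain ⟨x, y, hx, hy, h1⟩ := ih
      obtain ⟨-, j, hj⟩ := h.exists_rep hτ
      exact ⟨x, ⟨j, hj.isNode⟩, hx, hj, h1.tail (edge h hy hj)⟩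
  obtain ⟨j, h⟩ := h
  obtain ⟨x, y, hx, hy, h⟩ := key j j h
  obtain rfl : x = y := Subtype.ext (hx.unique hy)
  exact ⟨x, h⟩

/-- A store sits directly behind its node, so edges point forward: a source is visible to its load
and has been issued before it, and a conflicting store is not visible and therefore comes after the
load. -/
theorem edge_lt_of_sc {σ : List (Act Thr Dom)} (hσ : ∀ i j, IssueOf σ i j → j = i + 1)
    {x y : {i : ℕ // IsNode σ i}} (h : (trace σ).Edge x y) : x.1 < y.1 := by
  have store : ∀ {s a i}, StoreAt σ s a → Rep σ s i → s = i + 1 := by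
    intro s a i h hi
    obtain ⟨t, h⟩ := storeAt_iff.1 h
    rcases hi with ⟨rfl, hi⟩ | hi
    · exact absurd h ((isNode_iff.1 hi).2 _)
    · exact hσ _ _ hi
  rcases h with ⟨m, n, hx, hy, h⟩ | ⟨m, n, hx, hy, h⟩ | ⟨m, n, hx, hy, h⟩ | ⟨m, n, hx, hy, h⟩
  · obtain ⟨-, i, j, hi, hj, hlt⟩ := h
    rwa [hx.unique hi, hy.unique hj]
  · obtain ⟨hlt, a, h1, h2⟩ := h
    have := store h1 hx
    have := store h2 hy
    omega
  · obtain ⟨⟨t, a, hl, hs, h⟩, -⟩ := src_iff.1 h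
    have h1 := store hs hx
    have h2 := hy.eq_of_isNode hl.isNode
    rcases h with h | ⟨i, h3, h4, -⟩
    · omega
    · have := hσ _ _ h4
      omega
  · have hv := not_vis_of_cf h
    obtain ⟨t, a, hl, hs, -⟩ := cf_iff.1 h
    have h1 := store hs hy
    have h2 := hx.eq_of_isNode hl.isNode
    have h3 : ¬ n < m := fun hlt => hv ⟨t, a, hl, hs, .inl hlt⟩
    have h4 : n ≠ m := by rintro rfl; exact hl.not_storeAt hs
    -- The store only gives `m ≤ y`, because its node is one position earlier; equality is excluded
    -- because a load is not an issue.
    have h5 : y.1 ≠ m := by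
      rintro h5
      rcases hy with ⟨h6, -⟩ | hy
      · omega
      · obtain ⟨k, h6, -⟩ := hy.isuAt
        exact hl.not_isuAt (h5 ▸ h6)
    omega

/-- A computation with a cycle does not have the trace of a sequentially consistent one. -/
theorem Cyclic.not_same {τ σ : List (Act Thr Dom)} (h : Cyclic τ) (hτ : Complete τ)
    (hσ : ∀ i j, IssueOf σ i j → j = i + 1) : ¬ (trace τ).Same (trace σ) := by
  rintro ⟨f, -, h1, h2, h3, h4⟩
  obtain ⟨x, hx⟩ := h.exists_edge_cycle hτ
  have key : ∀ y, Relation.TransGen (trace τ).Edge x y → (f x).1 < (f y).1 := by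
    have edge : ∀ y z, (trace τ).Edge y z → (f y).1 < (f z).1 := by
      intro y z hyz
      refine edge_lt_of_sc hσ ?_
      rcases hyz with h | h | h | h
      · exact .inl ((h1 _ _).1 h)
      · exact .inr (.inl ((h2 _ _).1 h))
      · exact .inr (.inr (.inl ((h3 _ _).1 h)))
      · exact .inr (.inr (.inr ((h4 _ _).1 h)))
    intro y hy
    induction hy with
    | single h => exact edge _ _ h
    | tail _ h ih => exact ih.trans (edge _ _ h)
  exact lt_irrefl _ (key x hx)

theorem Trace.Same.trans {G H K : Trace Thr Dom} (h : G.Same H) (h' : H.Same K) : G.Same K := by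
  obtain ⟨f, h0, h1, h2, h3, h4⟩ := h
  obtain ⟨g, k0, k1, k2, k3, k4⟩ := h'
  refine ⟨f.trans g, fun x => ?_, fun x y => ?_, fun x y => ?_, fun x y => ?_, fun x y => ?_⟩
  · rw [h0, k0]; rfl
  · rw [h1, k1]; rfl
  · rw [h2, k2]; rfl
  · rw [h3, k3]; rfl
  · rw [h4, k4]; rfl

theorem Trace.Same.refl (G : Trace Thr Dom) : G.Same G :=
  ⟨Equiv.refl _, fun _ => rfl, fun _ _ => Iff.rfl, fun _ _ => Iff.rfl, fun _ _ => Iff.rfl,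
    fun _ _ => Iff.rfl⟩

end Pgas

namespace Pgas

variable {Thr Dom : Type*} [DecidableEq Thr] [DecidableEq Dom]

/-! ### Reorderings -/

/-- The list `τ'` results from `τ` by moving position `i` to `π i`, where loads may change their
values. -/
structure Relabelling (τ τ' : List (Act Thr Dom)) (π : Equiv.Perm ℕ) : Prop where
  isu : ∀ k i, IsuAt τ' k (π i) ↔ IsuAt τ k i
  exec : ∀ k i, ExecAt τ' k (π i) ↔ ExecAt τ k i
  thr : ∀ i, τ'[π i]?.map Act.thr = τ[i]?.map Act.thr
  load : ∀ i t a, LoadAt τ' (π i) t a ↔ LoadAt τ i t a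

/-- An action up to the value of loads. -/
def Act.erase (x : Act Thr Dom) : Act Thr Dom :=
  match x.op with
  | .ld a _ => ⟨x.thr, .ld a a⟩
  | _ => x

theorem Relabelling.of_erase {τ τ' : List (Act Thr Dom)} {π : Equiv.Perm ℕ}
    (h : ∀ i, τ'[π i]?.map Act.erase = τ[i]?.map Act.erase) : Relabelling τ τ' π := by
  have hisu : ∀ x : Act Thr Dom, x.isuChan = x.erase.isuChan := by
    rintro ⟨t, op⟩; cases op <;> rfl
  have hexec : ∀ x : Act Thr Dom, x.execChan = x.erase.execChan := by
    rintro ⟨t, op⟩; cases op <;> rfl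
  have hthr : ∀ x : Act Thr Dom, x.thr = x.erase.thr := by
    rintro ⟨t, op⟩; cases op <;> rfl
  have hld : ∀ (x : Act Thr Dom) t a, (∃ v, x = ⟨t, .ld a v⟩) ↔ x.erase = ⟨t, .ld a a⟩ := by
    rintro ⟨t, op⟩ t' a'
    cases op <;> simp [Act.erase]
  have b : ∀ {β : Type _} (f : Act Thr Dom → Option β), (∀ x, f x = f x.erase) →
      ∀ o : Option (Act Thr Dom), o.bind f = (o.map Act.erase).bind f := by
    intro β f hf o
    cases o with
    | none => rfl
    | some x => exact hf x
  refine ⟨fun k i => ?_, fun k i => ?_, fun i => ?_, fun i t a => ?_⟩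
  · unfold IsuAt; rw [b _ hisu, h, ← b _ hisu]
  · unfold ExecAt; rw [b _ hexec, h, ← b _ hexec]
  · have c : ∀ o : Option (Act Thr Dom), o.map Act.thr = (o.map Act.erase).map Act.thr := by
      intro o
      cases o with
      | none => rfl
      | some x => exact congrArg some (hthr x)
    rw [c, h, ← c]
  · have c : ∀ o : Option (Act Thr Dom),
        (∃ v, o = some ⟨t, .ld a v⟩) ↔ o.map Act.erase = some ⟨t, .ld a a⟩ := by
      intro o
      cases o with
      | none => simp
      | some x => simpa using hld x t a
    unfold LoadAt
    rw [c, h, ← c]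

theorem Relabelling.of_eq {τ τ' : List (Act Thr Dom)} {π : Equiv.Perm ℕ}
    (h : ∀ i, τ'[π i]? = τ[i]?) : Relabelling τ τ' π := .of_erase fun i => by rw [h]

namespace Relabelling

variable {τ τ' : List (Act Thr Dom)} {π : Equiv.Perm ℕ}

theorem symm (R : Relabelling τ τ' π) : Relabelling τ' τ π.symm where
  isu k i := by rw [← R.isu]; simp
  exec k i := by rw [← R.exec]; simp
  thr i := by rw [← R.thr]; simp
  load i t a := by rw [← R.load]; simp

theorem store (R : Relabelling τ τ' π) {i : ℕ} {a : Dom} : StoreAt τ' (π i) a ↔ StoreAt τ i a := by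
  simp only [storeAt_iff, R.exec]

theorem sameThread (R : Relabelling τ τ' π) {i j : ℕ} :
    SameThread τ' (π i) (π j) ↔ SameThread τ i j := by
  simp only [sameThread_iff, R.thr]

theorem lt_length (R : Relabelling τ τ' π) {i : ℕ} : π i < τ'.length ↔ i < τ.length := by
  have : ∀ (σ : List (Act Thr Dom)) (m : ℕ), m < σ.length ↔ (σ[m]?.map Act.thr).isSome := by
    intro σ m; simp
  rw [this, this, R.thr]

theorem isNode (R : Relabelling τ τ' π) {i : ℕ} : IsNode τ' (π i) ↔ IsNode τ i := by
  simp only [isNode_iff, R.lt_length, R.exec]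

end Relabelling

theorem count_perm {π : Equiv.Perm ℕ} {p p' : ℕ → Prop} [DecidablePred p] [DecidablePred p']
    (h : ∀ m, p' (π m) ↔ p m) (hlt : ∀ m n, p m → p n → m < n → π m < π n) {i : ℕ} (hi : p i) :
    Nat.count p' (π i) = Nat.count p i := by
  have hiff : ∀ m, p m → (π m < π i ↔ m < i) := by
    intro m hm
    refine ⟨fun h1 => ?_, hlt m i hm hi⟩
    rcases lt_trichotomy m i with h2 | h2 | h2
    · exact h2
    · subst h2; omega
    · have := hlt i m hi hm h2; omega
  rw [Nat.count_eq_card_filter_range, Nat.count_eq_card_filter_range]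
  symm
  apply Finset.card_bij (fun m _ => π m)
  · intro m hm
    simp only [Finset.mem_filter, Finset.mem_range] at hm ⊢
    exact ⟨(hiff m hm.2).2 hm.1, (h m).2 hm.2⟩
  · intro m _ n _ hmn
    exact π.injective hmn
  · intro m hm
    simp only [Finset.mem_filter, Finset.mem_range] at hm
    have hp : p (π.symm m) := by rw [← h]; simpa using hm.2
    refine ⟨π.symm m, ?_, by simp⟩
    simp only [Finset.mem_filter, Finset.mem_range]
    exact ⟨(hiff _ hp).1 (by simpa using hm.1), hp⟩

/-- A reordering that preserves the program order and the order of each channel. -/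
structure Reord (τ τ' : List (Act Thr Dom)) (π : Equiv.Perm ℕ) : Prop
    extends Relabelling τ τ' π where
  node_lt : ∀ i j, IsNode τ i → IsNode τ j → SameThread τ i j → i < j → π i < π j
  exec_lt : ∀ k i j, ExecAt τ k i → ExecAt τ k j → i < j → π i < π j

theorem lt_iff_of_lt {π : Equiv.Perm ℕ} {i j : ℕ} (h : i < j → π i < π j)
    (h' : j < i → π j < π i) : π i < π j ↔ i < j := by
  refine ⟨fun h1 => ?_, h⟩
  rcases lt_trichotomy i j with h2 | h2 | h2
  · exact h2
  · subst h2; omega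
  · have := h' h2; omega

namespace Reord

variable {τ τ' : List (Act Thr Dom)} {π : Equiv.Perm ℕ}

/-- Issues and executions are matched by counting within one channel, and the order within each
channel is preserved on both sides. -/
theorem issueOf (R : Reord τ τ' π) {i j : ℕ} : IssueOf τ' (π i) (π j) ↔ IssueOf τ i j := by
  rw [issueOf_iff, issueOf_iff]
  refine exists_congr fun k => ?_
  rw [R.isu, R.exec]
  refine and_congr_right fun hi => and_congr_right fun hj => ?_
  rw [count_perm (R.isu k) (fun m n hm hn => R.node_lt m n hm.isNode hn.isNode
      (sameThread_iff.2 ⟨_, hm.thr, hn.thr⟩)) hi, count_perm (R.exec k) (R.exec_lt k) hj]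

theorem rep (R : Reord τ τ' π) {i j : ℕ} : Rep τ' (π i) (π j) ↔ Rep τ i j := by
  unfold Rep
  rw [R.issueOf, R.isNode, π.injective.eq_iff]

theorem po (R : Reord τ τ' π) {m n : ℕ} : Po τ' (π m) (π n) ↔ Po τ m n := by
  unfold Po
  rw [R.sameThread]
  refine and_congr_right fun h => ?_
  have key : ∀ i j, Rep τ m i → Rep τ n j → (π i < π j ↔ i < j) := by
    intro i j hi hj
    have hs := hi.sameThread.symm.trans (h.trans hj.sameThread)
    exact lt_iff_of_lt (R.node_lt _ _ hi.isNode hj.isNode hs)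
      (R.node_lt _ _ hj.isNode hi.isNode hs.symm)
  constructor
  · rintro ⟨i, j, hi, hj, hlt⟩
    obtain ⟨i, rfl⟩ := π.surjective i
    obtain ⟨j, rfl⟩ := π.surjective j
    rw [R.rep] at hi hj
    exact ⟨i, j, hi, hj, (key i j hi hj).1 hlt⟩
  · rintro ⟨i, j, hi, hj, hlt⟩
    exact ⟨π i, π j, R.rep.2 hi, R.rep.2 hj, (key i j hi hj).2 hlt⟩

end Reord

/-- A reordering that preserves the trace: it keeps the store order, and it changes the visibility
of stores only for stores that are overwritten by a later visible one. -/
structure Iso (τ τ' : List (Act Thr Dom)) (π : Equiv.Perm ℕ) : Prop extends Reord τ τ' π where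
  store_lt : ∀ a i j, StoreAt τ i a → StoreAt τ j a → i < j → π i < π j
  vis : ∀ s l, Vis τ s l → ∃ s', s ≤ s' ∧ Vis τ s' l ∧ Vis τ' (π s') (π l)
  vis_inv : ∀ s l, Vis τ' (π s) (π l) → ∃ s', s ≤ s' ∧ Vis τ s' l ∧ Vis τ' (π s') (π l)

namespace Iso

variable {τ τ' : List (Act Thr Dom)} {π : Equiv.Perm ℕ}

theorem store_lt_iff (R : Iso τ τ' π) {i j : ℕ} {a : Dom} (hi : StoreAt τ i a)
    (hj : StoreAt τ j a) : π i < π j ↔ i < j :=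
  lt_iff_of_lt (R.store_lt a i j hi hj) (R.store_lt a j i hj hi)

theorem st (R : Iso τ τ' π) {m n : ℕ} : St τ' (π m) (π n) ↔ St τ m n := by
  constructor
  · rintro ⟨h, a, h1, h2⟩
    rw [R.store] at h1 h2
    exact ⟨(R.store_lt_iff h1 h2).1 h, a, h1, h2⟩
  · rintro ⟨h, a, h1, h2⟩
    exact ⟨(R.store_lt_iff h1 h2).2 h, a, R.store.2 h1, R.store.2 h2⟩

theorem vis_store {s s' l : ℕ} (h : Vis τ s l) (h' : Vis τ s' l) :
    ∃ a, StoreAt τ s a ∧ StoreAt τ s' a := by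
  obtain ⟨t, a, hl, hs, -⟩ := h
  obtain ⟨t', a', hl', hs', -⟩ := h'
  exact ⟨a, hs, (hl.unique hl').2 ▸ hs'⟩

/-- A store whose visibility changes is dominated by a later store that is visible in both
computations, so the last visible store stays the same. -/
theorem src (R : Iso τ τ' π) {s l : ℕ} : Src τ' (π s) (π l) ↔ Src τ s l := by
  rw [src_iff, src_iff]
  have lt : ∀ {s₁ s₂}, Vis τ' (π s₁) (π l) → Vis τ' (π s₂) (π l) → (π s₁ < π s₂ ↔ s₁ < s₂) := by
    intro s₁ s₂ h1 h2
    obtain ⟨a, h3, h4⟩ := vis_store h1 h2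
    exact R.store_lt_iff (R.store.1 h3) (R.store.1 h4)
  constructor
  · rintro ⟨h, hmax⟩
    obtain ⟨s', h1, h2, h3⟩ := R.vis_inv s l h
    have h4 := hmax _ h3
    have h5 := lt h h3
    obtain rfl : s = s' := by omega
    refine ⟨h2, fun s'' hs'' => ?_⟩
    obtain ⟨s₁, h6, h7, h8⟩ := R.vis s'' l hs''
    have h9 := hmax _ h8
    have h10 := lt h h8
    omega
  · rintro ⟨h, hmax⟩
    obtain ⟨s', h1, h2, h3⟩ := R.vis s l h
    obtain rfl : s = s' := le_antisymm h1 (hmax _ h2)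
    refine ⟨h3, fun s'' hs'' => ?_⟩
    obtain ⟨s'', rfl⟩ := π.surjective s''
    obtain ⟨s₁, h6, h7, h8⟩ := R.vis_inv s'' l hs''
    have h9 := hmax _ h7
    have h10 := lt h3 hs''
    omega

theorem not_vis (R : Iso τ τ' π) {l : ℕ} : (∀ s, ¬ Vis τ' s (π l)) ↔ ∀ s, ¬ Vis τ s l := by
  constructor
  · intro h s hs
    obtain ⟨s', -, -, h3⟩ := R.vis s l hs
    exact h _ h3
  · intro h s hs
    obtain ⟨s, rfl⟩ := π.surjective s
    obtain ⟨s', -, h2, -⟩ := R.vis_inv s l hs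
    exact h _ h2

theorem cf (R : Iso τ τ' π) {l s : ℕ} : Cf τ' (π l) (π s) ↔ Cf τ l s := by
  rw [cf_iff, cf_iff]
  refine exists_congr fun t => exists_congr fun a => ?_
  rw [R.load, R.store]
  refine and_congr_right fun hl => and_congr_right fun hs => or_congr ?_ ?_
  · have key : ∀ s', Src τ s' l → (π s' < π s ↔ s' < s) := by
      intro s' h
      obtain ⟨⟨t', a', hl', hs', -⟩, -⟩ := src_iff.1 h
      rw [← (hl.unique hl').2] at hs'
      exact R.store_lt_iff hs' hs
    constructor
    · rintro ⟨s', h1, h2⟩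
      obtain ⟨s', rfl⟩ := π.surjective s'
      rw [R.src] at h1
      exact ⟨s', h1, (key s' h1).1 h2⟩
    · rintro ⟨s', h1, h2⟩
      exact ⟨π s', R.src.2 h1, (key s' h1).2 h2⟩
  · rw [R.not_vis]
    refine and_congr_right fun _ => ?_
    constructor
    · intro h s' hs'
      have h1 := h (π s') (R.store.2 hs')
      have h2 := R.store_lt_iff hs' hs
      omega
    · intro h s' hs'
      obtain ⟨s', rfl⟩ := π.surjective s'
      have h1 := h s' (R.store.1 hs')
      have h2 := R.store_lt_iff (R.store.1 hs') hs
      omega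

theorem hb (R : Iso τ τ' π) {m n : ℕ} : Hb τ' (π m) (π n) ↔ Hb τ m n := by
  unfold Hb
  rw [R.po, R.st, R.src, R.cf]

theorem same (R : Iso τ τ' π) (h : ∀ i, τ'[π i]? = τ[i]?) : (trace τ).Same (trace τ') := by
  have key : ∀ (S S' : ℕ → ℕ → Prop), (∀ m n, S' (π m) (π n) ↔ S m n) →
      ∀ (x y : {i : ℕ // IsNode τ i}) (x' y' : {i : ℕ // IsNode τ' i}), x'.1 = π x.1 →
        y'.1 = π y.1 → (onNodes τ S x y ↔ onNodes τ' S' x' y') := by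
    intro S S' hS x y x' y' hx hy
    unfold onNodes
    rw [hx, hy]
    constructor
    · rintro ⟨m, n, h1, h2, h3⟩
      exact ⟨π m, π n, R.rep.2 h1, R.rep.2 h2, (hS m n).2 h3⟩
    · rintro ⟨m, n, h1, h2, h3⟩
      obtain ⟨m, rfl⟩ := π.surjective m
      obtain ⟨n, rfl⟩ := π.surjective n
      exact ⟨m, n, R.rep.1 h1, R.rep.1 h2, (hS m n).1 h3⟩
  refine ⟨π.subtypeEquiv fun i => R.isNode.symm, fun x => (h x.1).symm, ?_, ?_, ?_, ?_⟩
  · exact fun x y => key _ _ (fun m n => R.po) x y _ _ rfl rfl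
  · exact fun x y => key _ _ (fun m n => R.st) x y _ _ rfl rfl
  · exact fun x y => key _ _ (fun m n => R.src) x y _ _ rfl rfl
  · exact fun x y => key _ _ (fun m n => R.cf) x y _ _ rfl rfl

end Iso

/-! ### Swapping neighbours -/

theorem swap_lt {n i j : ℕ} (h : i < j) (h' : ¬ (i = n ∧ j = n + 1)) :
    Equiv.swap n (n + 1) i < Equiv.swap n (n + 1) j := by
  simp only [Equiv.swap_apply_def]
  split_ifs <;> omega

/-- Only the order of the two neighbours changes. Visibility can change only for a store and a load
among them, and `hv` and `hv'` supply a visible store that accounts for this change. -/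
theorem Iso.of_swap {τ τ' : List (Act Thr Dom)} {n : ℕ}
    (R : Relabelling τ τ' (Equiv.swap n (n + 1)))
    (hnode : SameThread τ n (n + 1) → ¬ (IsNode τ n ∧ IsNode τ (n + 1)))
    (hexec : ∀ k, ¬ (ExecAt τ k n ∧ ExecAt τ k (n + 1)))
    (hstore : ∀ a, ¬ (StoreAt τ n a ∧ StoreAt τ (n + 1) a))
    (hv : Vis τ n (n + 1) → ∃ s > n + 1, Vis τ s (n + 1))
    (hv' : ∀ t a, LoadAt τ n t a → StoreAt τ (n + 1) a → ∃ s ≥ n + 1, Vis τ s n) :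
    Iso τ τ' (Equiv.swap n (n + 1)) := by
  have R' : Reord τ τ' (Equiv.swap n (n + 1)) := by
    refine ⟨R, fun i j hi hj hs h => swap_lt h ?_, fun k i j hi hj h => swap_lt h ?_⟩
    · rintro ⟨rfl, rfl⟩; exact hnode hs ⟨hi, hj⟩
    · rintro ⟨rfl, rfl⟩; exact hexec k ⟨hi, hj⟩
  set π := Equiv.swap n (n + 1) with hπ
  have visA : ∀ s l, Vis τ s l → ¬ (s = n ∧ l = n + 1) → Vis τ' (π s) (π l) := by
    rintro s l ⟨t, a, hl, hs, h⟩ hne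
    refine ⟨t, a, (R.load _ _ _).2 hl, R.store.2 hs, ?_⟩
    rcases h with h | ⟨i, h1, h2, h3⟩
    · exact .inl (swap_lt h hne)
    · obtain ⟨k, h4, -⟩ := h2.isuAt
      exact .inr ⟨π i, R'.node_lt _ _ h4.isNode hl.isNode h3 h1, R'.issueOf.2 h2,
        R.sameThread.2 h3⟩
  have visB : ∀ s l, Vis τ' (π s) (π l) → ¬ (s = n + 1 ∧ l = n) → Vis τ s l := by
    rintro s l ⟨t, a, hl, hs, h⟩ hne
    rw [R.load] at hl
    rw [R.store] at hs
    refine ⟨t, a, hl, hs, ?_⟩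
    rcases h with h | ⟨i, h1, h2, h3⟩
    · left
      rcases lt_trichotomy s l with h1 | h1 | h1
      · exact h1
      · subst h1; omega
      · have : π l < π s := swap_lt h1 (by omega)
        omega
    · obtain ⟨i, rfl⟩ := π.surjective i
      rw [R'.issueOf] at h2
      rw [R.sameThread] at h3
      obtain ⟨k, h4, -⟩ := h2.isuAt
      refine .inr ⟨i, ?_, h2, h3⟩
      exact (lt_iff_of_lt (R'.node_lt _ _ h4.isNode hl.isNode h3)
        (R'.node_lt _ _ hl.isNode h4.isNode h3.symm)).1 h1
  refine ⟨R', fun a i j hi hj h => swap_lt h ?_, fun s l h => ?_, fun s l h => ?_⟩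
  · rintro ⟨rfl, rfl⟩; exact hstore a ⟨hi, hj⟩
  · by_cases hne : s = n ∧ l = n + 1
    · obtain ⟨rfl, rfl⟩ := hne
      obtain ⟨s', h1, h2⟩ := hv h
      exact ⟨s', by omega, h2, visA _ _ h2 (by omega)⟩
    · exact ⟨s, le_rfl, h, visA _ _ h hne⟩
  · by_cases hne : s = n + 1 ∧ l = n
    · obtain ⟨rfl, rfl⟩ := hne
      obtain ⟨t, a, hl, hs, -⟩ := h
      obtain ⟨s', h1, h2⟩ := hv' t a ((R.load _ _ _).1 hl) (R.store.1 hs)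
      exact ⟨s', h1, h2, visA _ _ h2 (by omega)⟩
    · exact ⟨s, le_rfl, visB _ _ h hne, h⟩

theorem getElem?_swap {α : Type*} (l r : List α) (x y : α) (i : ℕ) :
    (l ++ y :: x :: r)[Equiv.swap l.length (l.length + 1) i]? = (l ++ x :: y :: r)[i]? := by
  rw [Equiv.swap_apply_def]
  split_ifs with h1 h2
  · subst h1; simp
  · subst h2; simp
  · rcases lt_or_ge i l.length with h | h
    · rw [List.getElem?_append_left h, List.getElem?_append_left h]
    · obtain ⟨k, rfl⟩ : ∃ k, i = l.length + (k + 2) := ⟨i - l.length - 2, by omega⟩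
      rw [List.getElem?_append_right (by omega), List.getElem?_append_right (by omega)]
      simp

/-! ### Moving an execution to the left -/

/-- The permutation that moves `q` to `lo` and shifts the positions in between. -/
def rotate (lo q : ℕ) (h : lo ≤ q) : Equiv.Perm ℕ where
  toFun i := if i = q then lo else if lo ≤ i ∧ i < q then i + 1 else i
  invFun i := if i = lo then q else if lo < i ∧ i ≤ q then i - 1 else i
  left_inv i := by dsimp only; split_ifs <;> omega
  right_inv i := by dsimp only; split_ifs <;> omega

theorem rotate_apply {lo q : ℕ} (h : lo ≤ q) (i : ℕ) :
    rotate lo q h i = if i = q then lo else if lo ≤ i ∧ i < q then i + 1 else i := rfl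

theorem rotate_lt_iff {lo q : ℕ} (h : lo ≤ q) {i j : ℕ} (hi : i ≠ q) (hj : j ≠ q) :
    rotate lo q h i < rotate lo q h j ↔ i < j := by
  simp only [rotate_apply]
  split_ifs <;> omega

theorem rotate_lt_of_lt {lo q : ℕ} (h : lo ≤ q) {j : ℕ} (hj : q < j) :
    rotate lo q h q < rotate lo q h j := by
  simp only [rotate_apply]
  split_ifs <;> omega

theorem rotate_lt_self_iff {lo q : ℕ} (h : lo ≤ q) {i : ℕ} :
    rotate lo q h i < rotate lo q h q ↔ i < lo := by
  simp only [rotate_apply]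
  split_ifs <;> omega

theorem rotate_self_lt_iff {lo q : ℕ} (h : lo ≤ q) {i : ℕ} (hi : i ≠ q) :
    rotate lo q h q < rotate lo q h i ↔ lo ≤ i := by
  simp only [rotate_apply]
  split_ifs <;> omega

/-- When the positions that are passed belong to other threads, the order of each thread is kept. -/
theorem rotate_lt_of_sameThread {τ : List (Act Thr Dom)} {lo q : ℕ} (h : lo ≤ q)
    (hthr : ∀ m, lo ≤ m → m < q → ¬ SameThread τ m q) {i j : ℕ} (hs : SameThread τ i j)
    (hlt : i < j) : rotate lo q h i < rotate lo q h j := by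
  by_cases hi : i = q
  · subst hi; exact rotate_lt_of_lt h hlt
  · by_cases hj : j = q
    · subst hj
      rw [rotate_lt_self_iff h]
      by_contra hlo
      exact hthr i (by omega) hlt hs
    · exact (rotate_lt_iff h hi hj).2 hlt

theorem Reord.of_rotate {τ τ' : List (Act Thr Dom)} {lo q : ℕ} (h : lo ≤ q)
    (R : Relabelling τ τ' (rotate lo q h)) (hthr : ∀ m, lo ≤ m → m < q → ¬ SameThread τ m q) :
    Reord τ τ' (rotate lo q h) :=
  ⟨R, fun _ _ _ _ hs hlt => rotate_lt_of_sameThread h hthr hs hlt,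
    fun _ _ _ hi hj hlt => rotate_lt_of_sameThread h hthr
      (sameThread_iff.2 ⟨_, hi.thr, hj.thr⟩) hlt⟩

/-- Dependencies between other actions survive when an execution moves to the left. -/
theorem Hb.rotate {τ τ' : List (Act Thr Dom)} {lo q : ℕ} (h : lo ≤ q)
    (R : Relabelling τ τ' (rotate lo q h)) (hthr : ∀ m, lo ≤ m → m < q → ¬ SameThread τ m q)
    {k : Thr × Option Dom} (hq : ExecAt τ k q) {m n : ℕ} (hm : m ≠ q) (hn : n ≠ q)
    (hmn : Hb τ m n) :
    Relation.TransGen (Hb τ') (Pgas.rotate lo q h m) (Pgas.rotate lo q h n) := by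
  have R' := Reord.of_rotate h R hthr
  set π := Pgas.rotate lo q h with hπ
  have hld : ∀ {l t a}, LoadAt τ l t a → l ≠ q := by
    rintro l t a hl rfl; exact hl.not_execAt hq
  have vis : ∀ s l, Vis τ s l → Vis τ' (π s) (π l) := by
    rintro s l ⟨t, a, hl, hs, h1⟩
    refine ⟨t, a, (R.load _ _ _).2 hl, R.store.2 hs, ?_⟩
    rcases h1 with h1 | ⟨i, h1, h2, h3⟩
    · left
      by_cases hsq : s = q
      · subst hsq; exact rotate_lt_of_lt h h1
      · exact (rotate_lt_iff h hsq (hld hl)).2 h1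
    · exact .inr ⟨π i, rotate_lt_of_sameThread h hthr h3 h1, R'.issueOf.2 h2, R.sameThread.2 h3⟩
  -- Nothing loses visibility, and only the moved store gains it, for the loads that it passes.
  have vis_inv : ∀ s l, Vis τ' (π s) (π l) → Vis τ s l ∨ (s = q ∧ lo ≤ l ∧ l < q) := by
    rintro s l ⟨t, a, hl, hs, h1⟩
    rw [R.load] at hl
    rw [R.store] at hs
    rcases h1 with h1 | ⟨i, h1, h2, h3⟩
    · by_cases hsq : s = q
      · subst hsq
        rw [rotate_self_lt_iff h (hld hl)] at h1
        by_cases hlt : s < l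
        · exact .inl ⟨t, a, hl, hs, .inl hlt⟩
        · have := hld hl
          exact .inr ⟨rfl, h1, by omega⟩
      · exact .inl ⟨t, a, hl, hs, .inl ((rotate_lt_iff h hsq (hld hl)).1 h1)⟩
    · left
      obtain ⟨i, rfl⟩ := π.surjective i
      rw [R'.issueOf] at h2
      rw [R.sameThread] at h3
      refine ⟨t, a, hl, hs, .inr ⟨i, ?_, h2, h3⟩⟩
      exact (lt_iff_of_lt (fun h => rotate_lt_of_sameThread _ hthr h3 h)
        (fun h => rotate_lt_of_sameThread _ hthr h3.symm h)).1 h1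
  rcases hmn with h1 | ⟨h1, a, h2, h3⟩ | h1 | h1
  · exact .single (.inl (R'.po.2 h1))
  · exact .single (.inr (.inl ⟨(rotate_lt_iff h hm hn).2 h1, a, R.store.2 h2, R.store.2 h3⟩))
  · obtain ⟨hv, hmax⟩ := src_iff.1 h1
    -- The load may now read from a later store. The old edge is then replaced by a store-order edge
    -- to this new source, followed by the source edge.
    obtain ⟨s, hs, hle⟩ := exists_src (vis _ _ hv)
    obtain ⟨s, rfl⟩ := π.surjective s
    have src : Hb τ' (π s) (π n) := .inr (.inr (.inl hs))
    by_cases hsm : s = m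
    · subst hsm; exact .single src
    · have hlt : π m < π s := lt_of_le_of_ne hle fun e => hsm (π.injective e.symm)
      obtain ⟨a, h2, h3⟩ := Iso.vis_store (vis _ _ hv) (src_iff.1 hs).1
      exact .head (.inr (.inl ⟨hlt, a, h2, h3⟩)) (.single src)
  · obtain ⟨t, a, hl, hs, hc⟩ := cf_iff.1 h1
    have hnv := not_vis_of_cf h1
    have hqn : ∀ {b}, (Vis τ q m → q < n) → Vis τ' (π q) (π m) → StoreAt τ n b →
        π q < π n := by
      intro b h2 h3 h4
      rw [rotate_self_lt_iff h hn]
      by_contra hlo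
      rcases vis_inv _ _ h3 with h5 | ⟨-, h5, h6⟩
      · have := h2 h5; omega
      · exact hnv ⟨t, a, hl, hs, .inl (by omega)⟩
    have hlt : ∀ s, Vis τ' (π s) (π m) → π s < π n := by
      intro s hv
      by_cases hsq : s = q
      · subst hsq
        refine hqn (fun h2 => ?_) hv hs
        rcases hc with ⟨s', h3, h4⟩ | ⟨h3, -⟩
        · have := (src_iff.1 h3).2 _ h2; omega
        · exact absurd h2 (h3 _)
      · rw [rotate_lt_iff h hsq hn]
        have h2 := (vis_inv _ _ hv).resolve_right (by omega)
        rcases hc with ⟨s', h3, h4⟩ | ⟨h3, -⟩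
        · have := (src_iff.1 h3).2 _ h2; omega
        · exact absurd h2 (h3 _)
    by_cases hex : ∃ s, Vis τ' s (π m)
    · obtain ⟨s, hv⟩ := hex
      obtain ⟨s', h2, -⟩ := exists_src hv
      obtain ⟨s', rfl⟩ := π.surjective s'
      refine .single (.inr (.inr (.inr (cf_iff.2 ⟨t, a, (R.load _ _ _).2 hl, R.store.2 hs, ?_⟩))))
      exact .inl ⟨π s', h2, hlt _ (src_iff.1 h2).1⟩
    · push Not at hex
      have hfirst : ∀ s', StoreAt τ s' a → n ≤ s' := by
        rcases hc with ⟨s', h3, h4⟩ | ⟨-, h3⟩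
        · exact absurd (vis _ _ (src_iff.1 h3).1) (hex _)
        · exact h3
      have cfOf : ∀ s, StoreAt τ s a → (∀ s', StoreAt τ s' a → π s ≤ π s') →
          Hb τ' (π m) (π s) := by
        intro s h2 h3
        refine .inr (.inr (.inr (cf_iff.2 ⟨t, a, (R.load _ _ _).2 hl, R.store.2 h2,
          .inr ⟨hex, ?_⟩⟩)))
        intro s' hs'
        obtain ⟨s', rfl⟩ := π.surjective s'
        exact h3 s' (R.store.1 hs')
      have hle : ∀ s', s' ≠ q → StoreAt τ s' a → π n ≤ π s' := by
        intro s' h2 h3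
        have h4 := hfirst s' h3
        have h5 : π s' < π n ↔ s' < n := rotate_lt_iff h h2 hn
        omega
      -- If the moved store has become the first store to `a`, the load conflicts with it instead of
      -- `n`, and store order leads from it to `n`.
      by_cases hqa : StoreAt τ q a ∧ π q < π n
      · refine .head (cfOf q hqa.1 fun s' hs' => ?_)
          (.single (.inr (.inl ⟨hqa.2, a, R.store.2 hqa.1, R.store.2 hs⟩)))
        by_cases hsq : s' = q
        · rw [hsq]
        · exact hqa.2.le.trans (hle s' hsq hs')
      · refine .single (cfOf n hs fun s' hs' => ?_)
        by_cases hsq : s' = q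
        · subst hsq
          by_contra hlt'
          exact hqa ⟨hs', by omega⟩
        · exact hle s' hsq hs'

/-! ### Common prefixes -/

theorem count_congr_lt {p p' : ℕ → Prop} [DecidablePred p] [DecidablePred p'] {n : ℕ}
    (h : ∀ m < n, p m ↔ p' m) : Nat.count p n = Nat.count p' n := by
  rw [Nat.count_eq_card_filter_range, Nat.count_eq_card_filter_range]
  congr 1
  apply Finset.filter_congr
  intro m hm
  exact h m (Finset.mem_range.1 hm)

theorem IssueOf.of_prefix {τ τ' : List (Act Thr Dom)} {N i j : ℕ}
    (h : ∀ m < N, τ[m]? = τ'[m]?) (hi : i < N) (hj : j < N) (hij : IssueOf τ i j) :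
    IssueOf τ' i j := by
  obtain ⟨k, h1, h2, h3⟩ := issueOf_iff.1 hij
  have e1 : ∀ m < N, IsuAt τ k m ↔ IsuAt τ' k m := fun m hm => by unfold IsuAt; rw [h m hm]
  have e2 : ∀ m < N, ExecAt τ k m ↔ ExecAt τ' k m := fun m hm => by unfold ExecAt; rw [h m hm]
  refine issueOf_iff.2 ⟨k, (e1 i hi).1 h1, (e2 j hj).1 h2, ?_⟩
  rw [← count_congr_lt fun m hm => e1 m (hm.trans hi), h3,
    count_congr_lt fun m hm => e2 m (hm.trans hj)]

theorem SameThread.of_prefix {τ τ' : List (Act Thr Dom)} {N i j : ℕ}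
    (h : ∀ m < N, τ[m]? = τ'[m]?) (hi : i < N) (hj : j < N) (hij : SameThread τ i j) :
    SameThread τ' i j := by
  unfold SameThread at *
  rwa [← h i hi, ← h j hj]

theorem StoreAt.of_prefix {τ τ' : List (Act Thr Dom)} {N i : ℕ} {a : Dom}
    (h : ∀ m < N, τ[m]? = τ'[m]?) (hi : i < N) (hs : StoreAt τ i a) : StoreAt τ' i a := by
  unfold StoreAt at *
  rwa [← h i hi]

theorem LoadAt.of_prefix {τ τ' : List (Act Thr Dom)} {N i : ℕ} {t : Thr} {a : Dom}
    (h : ∀ m < N, τ[m]? = τ'[m]?) (hi : i < N) (hs : LoadAt τ i t a) : LoadAt τ' i t a := by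
  unfold LoadAt at *
  rwa [← h i hi]

theorem Rep.of_prefix {τ τ' : List (Act Thr Dom)} (hτ : Complete τ) {N m i : ℕ}
    (h : ∀ m < N, τ[m]? = τ'[m]?) (hm : m < N) (hr : Rep τ m i) : Rep τ' m i := by
  rcases hr with ⟨rfl, hr⟩ | hr
  · left
    unfold IsNode at *
    exact ⟨rfl, by rwa [← h m hm]⟩
  · exact .inr (hr.of_prefix h ((hτ.lt hr).trans hm) hm)

/-- A store that is visible to a load within the common prefix corresponds to a visible store at
the same position or beyond the prefix. -/
theorem Vis.of_prefix {τ τ' : List (Act Thr Dom)} (hτ' : Complete τ')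
    {N s l : ℕ} (h : ∀ m < N, τ[m]? = τ'[m]?) (hl : l < N) (hv : Vis τ s l) :
    ∃ s', Vis τ' s' l ∧ (s < N → s' = s) ∧ (N ≤ s → N ≤ s') := by
  obtain ⟨t, a, hld, hs, hv⟩ := hv
  have hld' := hld.of_prefix h hl
  by_cases hsN : s < N
  · refine ⟨s, ⟨t, a, hld', hs.of_prefix h hsN, ?_⟩, fun _ => rfl, fun h => by omega⟩
    rcases hv with hv | ⟨i, h1, h2, h3⟩
    · exact .inl hv
    · exact .inr ⟨i, h1, h2.of_prefix h (h1.trans hl) hsN, h3.of_prefix h (h1.trans hl) hl⟩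
  · obtain ⟨i, h1, h2, h3⟩ := hv.resolve_left (by omega)
    obtain ⟨k, h4, h5⟩ := h2.isuAt
    have h6 : IsuAt τ' k i := by unfold IsuAt at *; rwa [← h i (h1.trans hl)]
    obtain ⟨s', hs'⟩ := hτ'.exists_exec h6
    obtain ⟨k', h7, h8⟩ := hs'.isuAt
    obtain rfl := h6.unique h7
    have hN : N ≤ s' := by
      by_contra hlt
      have := (hs'.of_prefix (fun m hm => (h m hm).symm) (h1.trans hl) (by omega)).exec_unique h2
      omega
    obtain ⟨t', h9⟩ := storeAt_iff.1 hs
    obtain rfl := h9.unique h5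
    exact ⟨s', ⟨t, a, hld', storeAt_iff.2 ⟨_, h8⟩,
      .inr ⟨i, h1, hs', h3.of_prefix h (h1.trans hl) hl⟩⟩, fun h => by omega, fun _ => hN⟩

theorem Src.of_prefix {τ τ' : List (Act Thr Dom)} (hτ : Complete τ) (hτ' : Complete τ')
    {N s l : ℕ} (h : ∀ m < N, τ[m]? = τ'[m]?) (hs : s < N) (hl : l < N) (hsrc : Src τ s l) :
    Src τ' s l := by
  obtain ⟨hv, hmax⟩ := src_iff.1 hsrc
  obtain ⟨s', h1, h2, -⟩ := hv.of_prefix hτ' h hl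
  rw [h2 hs] at h1
  refine src_iff.2 ⟨h1, fun s₁ hs₁ => ?_⟩
  obtain ⟨s₂, h3, h4, h5⟩ := hs₁.of_prefix hτ (fun m hm => (h m hm).symm) hl
  have h6 := hmax _ h3
  by_cases h7 : s₁ < N
  · have := h4 h7; omega
  · have := h5 (by omega); omega

/-- A store issued in the common prefix but executed beyond it in one computation is executed beyond
it in the other one too. So a load sees the same stores of the prefix in both, and it sees a store
beyond the prefix in both or in neither. -/
theorem Hb.of_prefix {τ τ' : List (Act Thr Dom)} (hτ : Complete τ) (hτ' : Complete τ')
    {N m n : ℕ} (h : ∀ m < N, τ[m]? = τ'[m]?) (hm : m < N) (hn : n < N) (hb : Hb τ m n) :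
    Hb τ' m n := by
  rcases hb with ⟨hs, i, j, hi, hj, hlt⟩ | ⟨hlt, a, h1, h2⟩ | h1 | h1
  · exact .inl ⟨hs.of_prefix h hm hn, i, j, hi.of_prefix hτ h hm, hj.of_prefix hτ h hn, hlt⟩
  · exact .inr (.inl ⟨hlt, a, h1.of_prefix h hm, h2.of_prefix h hn⟩)
  · exact .inr (.inr (.inl (h1.of_prefix hτ hτ' h hm hn)))
  · obtain ⟨t, a, hl, hs, hc⟩ := cf_iff.1 h1
    refine .inr (.inr (.inr (cf_iff.2 ⟨t, a, hl.of_prefix h hm, hs.of_prefix h hn, ?_⟩)))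
    rcases hc with ⟨s', h2, h3⟩ | ⟨h2, h3⟩
    · exact .inl ⟨s', h2.of_prefix hτ hτ' h (h3.trans hn) hm, h3⟩
    · refine .inr ⟨fun s' hs' => ?_, fun s' hs' => ?_⟩
      · obtain ⟨s₂, h4, -⟩ := hs'.of_prefix hτ (fun m hm => (h m hm).symm) hm
        exact h2 _ h4
      · by_contra hlt
        have := h3 s' (hs'.of_prefix (fun m hm => (h m hm).symm) (by omega : s' < N))
        omega

end Pgas

namespace Pgas

variable {Thr Reg Lab Dom : Type*} [DecidableEq Thr] [DecidableEq Reg] [DecidableEq Dom]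

/-! ### Costs of related computations -/

theorem sum_ncard_eq {L : ℕ} {Q : ℕ → ℕ → Prop} (h : ∀ j m, Q j m → j < L ∧ m < L) :
    ∑ j ∈ Finset.range L, {m | Q j m}.ncard = {x : ℕ × ℕ | Q x.1 x.2}.ncard := by
  classical
  have h1 : {x : ℕ × ℕ | Q x.1 x.2} =
      ((Finset.range L ×ˢ Finset.range L).filter fun x => Q x.1 x.2 : Finset (ℕ × ℕ)) := by
    ext ⟨j, m⟩
    simpa using h j m
  rw [h1, Set.ncard_coe_finset, Finset.card_filter, Finset.sum_product]
  refine Finset.sum_congr rfl fun j hj => ?_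
  rw [← Finset.card_filter, ← Set.ncard_coe_finset]
  congr 1
  ext m
  simpa using fun hm => (h j m hm).2

theorem Overtakes.bounds {τ : List (Act Thr Dom)} {j m : ℕ} (h : Overtakes τ j m) :
    j < τ.length ∧ m < τ.length := by
  obtain ⟨i, h1, h2, h3, h4⟩ := h
  obtain ⟨k, -, h5⟩ := h1.isuAt
  have := h5.lt_length
  omega

/-- The pairs counted by the number of delays. -/
def delaySet (τ : List (Act Thr Dom)) : Set (ℕ × ℕ) := {x | Overtakes τ x.1 x.2}

/-- The pairs counted by the number of reorders. -/
def reorderSet (τ : List (Act Thr Dom)) : Set (ℕ × ℕ) :=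
  {x | Overtakes τ x.1 x.2 ∧ ∃ i, IssueOf τ i x.2 ∧ Overtakes τ x.1 i}

theorem delays_eq (τ : List (Act Thr Dom)) : delays τ = (delaySet τ).ncard :=
  sum_ncard_eq fun _ _ h => h.bounds

theorem reorders_eq (τ : List (Act Thr Dom)) : reorders τ = (reorderSet τ).ncard :=
  sum_ncard_eq (Q := fun j m => Overtakes τ j m ∧ ∃ i, IssueOf τ i m ∧ Overtakes τ j i)
    fun _ _ h => h.1.bounds

theorem delaySet_finite (τ : List (Act Thr Dom)) : (delaySet τ).Finite := by
  refine ((Set.finite_Iio τ.length).prod (Set.finite_Iio τ.length)).subset ?_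
  intro x hx
  exact (Overtakes.bounds hx)

theorem reorderSet_finite (τ : List (Act Thr Dom)) : (reorderSet τ).Finite :=
  (delaySet_finite τ).subset fun _ h => h.1

/-- Both numbers count pairs of positions, and an embedding of positions that respects issues and
overtaking embeds these sets of pairs. -/
theorem costs_le_of_injective {τ τ' : List (Act Thr Dom)} {f : ℕ → ℕ} (hf : f.Injective)
    (h₁ : ∀ i j, IssueOf τ' i j → IssueOf τ (f i) (f j))
    (h₂ : ∀ j m, Overtakes τ' j m → Overtakes τ (f j) (f m)) :
    delays τ' ≤ delays τ ∧ reorders τ' ≤ reorders τ := by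
  rw [delays_eq, delays_eq, reorders_eq, reorders_eq]
  have hinj : Function.Injective (Prod.map f f) := hf.prodMap hf
  constructor
  · exact Set.ncard_le_ncard_of_injOn (Prod.map f f) (fun x hx => h₂ _ _ hx) hinj.injOn
      (delaySet_finite τ)
  · refine Set.ncard_le_ncard_of_injOn (Prod.map f f) (fun x hx => ?_) hinj.injOn
      (reorderSet_finite τ)
    obtain ⟨h3, i, h4, h5⟩ := hx
    exact ⟨h₂ _ _ h3, f i, h₁ _ _ h4, h₂ _ _ h5⟩

theorem cost_lt_iff {τ σ : List (Act Thr Dom)} : cost τ < cost σ ↔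
    delays τ < delays σ ∨ delays τ = delays σ ∧
      (reorders τ < reorders σ ∨ reorders τ = reorders σ ∧ τ.length < σ.length) := by
  simp [cost, Prod.Lex.toLex_lt_toLex]

theorem cost_lt_of_length {τ σ : List (Act Thr Dom)} (h₁ : delays τ ≤ delays σ)
    (h₂ : reorders τ ≤ reorders σ) (h₃ : τ.length < σ.length) : cost τ < cost σ := by
  rw [cost_lt_iff]
  omega

section

variable {τ τ' : List (Act Thr Dom)} {π : Equiv.Perm ℕ}

theorem Reord.symm (R : Reord τ τ' π) : Reord τ' τ π.symm := by
  refine ⟨R.toRelabelling.symm, fun i j hi hj hs h => ?_, fun k i j hi hj h => ?_⟩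
  · obtain ⟨i, rfl⟩ := π.surjective i
    obtain ⟨j, rfl⟩ := π.surjective j
    rw [R.isNode] at hi hj
    rw [R.sameThread] at hs
    simpa using (lt_iff_of_lt (R.node_lt i j hi hj hs) (R.node_lt j i hj hi hs.symm)).1 h
  · obtain ⟨i, rfl⟩ := π.surjective i
    obtain ⟨j, rfl⟩ := π.surjective j
    rw [R.exec] at hi hj
    simpa using (lt_iff_of_lt (R.exec_lt k i j hi hj) (R.exec_lt k j i hj hi)).1 h

theorem Reord.overtakes (R : Reord τ τ' π)
    (hlt : ∀ i j, SameThread τ i j → i < j → π i < π j) {j m : ℕ} :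
    Overtakes τ' (π j) (π m) ↔ Overtakes τ j m := by
  have hiff : ∀ i j, SameThread τ i j → (π i < π j ↔ i < j) := fun i j h =>
    lt_iff_of_lt (hlt i j h) (hlt j i h.symm)
  constructor
  · rintro ⟨i, h1, h2, h3, h4⟩
    obtain ⟨i, rfl⟩ := π.surjective i
    rw [R.issueOf] at h1
    rw [R.sameThread] at h4
    exact ⟨i, h1, (hiff _ _ (h1.sameThread.trans h4.symm)).1 h2, (hiff _ _ h4).1 h3, h4⟩
  · rintro ⟨i, h1, h2, h3, h4⟩
    exact ⟨π i, R.issueOf.2 h1, hlt _ _ (h1.sameThread.trans h4.symm) h2, hlt _ _ h4 h3,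
      R.sameThread.2 h4⟩

theorem Reord.cost_eq (R : Reord τ τ' π) (hlt : ∀ i j, SameThread τ i j → i < j → π i < π j)
    (hlen : τ'.length = τ.length) : cost τ' = cost τ := by
  have h1 := costs_le_of_injective (τ := τ') (τ' := τ) π.injective
    (fun i j => R.issueOf.2) (fun j m => (R.overtakes hlt).2)
  have h2 := costs_le_of_injective (τ := τ) (τ' := τ') π.symm.injective
    (fun i j => R.symm.issueOf.2) (fun j m h => by
      rw [← R.overtakes hlt]; simpa using h)
  unfold cost
  rw [le_antisymm h2.1 h1.1, le_antisymm h2.2 h1.2, hlen]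

end

/-! ### Pending lists and positions -/

variable [Zero Dom]

theorem Entry.blocks_of_chan {x y : Entry Dom} (h : x.chan = y.chan) : x.Blocks y := by
  cases x <;> cases y <;> simp_all [Entry.chan, Entry.Blocks]

theorem take_succ_of_getElem? {α : Type*} {τ : List α} {n : ℕ} {x : α} (h : τ[n]? = some x) :
    τ.take (n + 1) = τ.take n ++ [x] := by
  rw [List.take_add_one, h]; rfl

/-- The pending list of a thread consists of the issued entries that have not been executed, in the
order of their issues. -/
structure PendInv (τ : List (Act Thr Dom)) (t : Thr) (n : ℕ) (J : List (ℕ × Entry Dom)) :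
    Prop where
  sorted : J.Pairwise fun a b => a.1 < b.1
  total : ∀ c, Nat.count (IsuAt τ (t, c)) n =
    Nat.count (ExecAt τ (t, c)) n + (J.map fun x => x.2.chan).count c
  stamp : ∀ J₁ i e J₂, J = J₁ ++ (i, e) :: J₂ → i < n ∧ IsuAt τ (t, e.chan) i ∧
    Nat.count (IsuAt τ (t, e.chan)) i =
      Nat.count (ExecAt τ (t, e.chan)) n + (J₁.map fun x => x.2.chan).count e.chan

theorem map_eq_append_cons {α β : Type*} {f : α → β} {l : List α} {p r : List β} {x : β}
    (h : l.map f = p ++ x :: r) : ∃ l₁ y l₂, l = l₁ ++ y :: l₂ ∧ l₁.map f = p ∧ f y = x ∧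
      l₂.map f = r := by
  rw [List.map_eq_append_iff] at h
  obtain ⟨l₁, l₂, rfl, rfl, h⟩ := h
  rw [List.map_eq_cons_iff] at h
  obtain ⟨y, l₃, rfl, rfl, rfl⟩ := h
  exact ⟨l₁, y, l₃, rfl, rfl, rfl, rfl⟩

/-- Entries of one channel block each other, so an entry that can be removed is the oldest pending
one of its channel. -/
theorem count_chan_of_not_blocks {e : Entry Dom} {J : List (ℕ × Entry Dom)}
    (h : ∀ y ∈ J.map Prod.snd, ¬ y.Blocks e) : (J.map fun x => x.2.chan).count e.chan = 0 := by
  rw [List.count_eq_zero]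
  intro hm
  simp only [List.mem_map] at hm
  obtain ⟨y, hy, hc⟩ := hm
  exact h y.2 (List.mem_map_of_mem hy) (Entry.blocks_of_chan hc)

/-- Each pending entry is paired with the position of its issue. When an entry is executed, the
later pending entries of its channel lose one predecessor in the list and gain one execution, so
their stamps stay valid. -/
theorem exists_pendInv {P : Program Thr Reg Lab Dom} {τ : List (Act Thr Dom)} {n : ℕ}
    {s : PState Thr Reg Lab Dom} (hn : n ≤ τ.length) (h : PSteps P P.initP (τ.take n) s) (t : Thr) :
    ∃ J, s.pend t = J.map Prod.snd ∧ PendInv τ t n J := by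
  induction n generalizing s with
  | zero =>
    simp only [List.take_zero, PSteps] at h
    subst h
    exact ⟨[], rfl, by simp, by simp, by simp⟩
  | succ n ih =>
    obtain ⟨x, hx⟩ : ∃ x, τ[n]? = some x := ⟨τ[n], by simp⟩
    rw [take_succ_of_getElem? hx, PSteps_append] at h
    obtain ⟨s₁, h1, s₂, ⟨q, p, hc, hb, rfl⟩, rfl⟩ := h
    obtain ⟨J, hJ, hinv⟩ := ih (by omega) h1
    have hisu : ∀ k, IsuAt τ k n ↔ x.isuChan = some k := by intro k; simp [IsuAt, hx]
    have hexec : ∀ k, ExecAt τ k n ↔ x.execChan = some k := by intro k; simp [ExecAt, hx]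
    have same : (∀ c, ¬ IsuAt τ (t, c) n) → (∀ c, ¬ ExecAt τ (t, c) n) →
        PendInv τ t (n + 1) J := by
      intro h2 h3
      have e1 : ∀ c, Nat.count (ExecAt τ (t, c)) (n + 1) = Nat.count (ExecAt τ (t, c)) n := by
        intro c; simp [Nat.count_succ, h3]
      refine ⟨hinv.sorted, fun c => ?_, fun J₁ i e J₂ hs => ?_⟩
      · rw [e1, ← hinv.total, Nat.count_succ]; simp [h2]
      · obtain ⟨h4, h5, h6⟩ := hinv.stamp J₁ i e J₂ hs
        exact ⟨by omega, h5, by rw [e1, h6]⟩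
    by_cases ht : x.thr = t
    swap
    · have ht' : t ≠ x.thr := fun e => ht e.symm
      refine ⟨J, by simpa [ht'] using hJ, same (fun c hc => ?_) (fun c hc => ?_)⟩
      · have := hc.thr; simp [hx] at this; exact ht this
      · have := hc.thr; simp [hx] at this; exact ht this
    subst ht
    obtain ⟨t, op⟩ := x
    simp only at hb hJ hinv hisu hexec same ⊢
    simp only [Function.update_self]
    cases op with
    | ld a v => exact ⟨J, by rw [hb.1, hJ], same (by simp [hisu, Act.isuChan])
        (by simp [hexec, Act.execChan])⟩
    | loc => exact ⟨J, by rw [show p = _ from hb, hJ], same (by simp [hisu, Act.isuChan])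
        (by simp [hexec, Act.execChan])⟩
    | scfence => exact ⟨J, by rw [hb.2, hJ], same (by simp [hisu, Act.isuChan])
        (by simp [hexec, Act.execChan])⟩
    | isu e =>
      obtain rfl := hb
      have e1 : ∀ c, Nat.count (ExecAt τ (t, c)) (n + 1) = Nat.count (ExecAt τ (t, c)) n := by
        intro c; simp [Nat.count_succ, hexec, Act.execChan]
      have e2 : IsuAt τ (t, e.chan) n := by simp [hisu, Act.isuChan]
      refine ⟨J ++ [(n, e)], by simp [hJ], ?_, fun c => ?_, fun J₁ i e' J₂ hs => ?_⟩
      · rw [List.pairwise_append]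
        refine ⟨hinv.sorted, by simp, fun a ha b hb => ?_⟩
        obtain ⟨J₁, J₂, rfl⟩ := List.append_of_mem ha
        simp at hb
        subst hb
        exact (hinv.stamp J₁ a.1 a.2 J₂ rfl).1
      · rw [e1, Nat.count_succ, hinv.total]
        by_cases hcc : e.chan = c
        · subst hcc; simp [e2, add_assoc]
        · simp [hisu, Act.isuChan, hcc]
      · rw [e1]
        rcases List.eq_nil_or_concat J₂ with rfl | ⟨J₃, z, rfl⟩
        · obtain ⟨rfl, h2⟩ := List.append_inj' hs rfl
          simp only [List.cons.injEq, Prod.mk.injEq, and_true] at h2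
          obtain ⟨rfl, rfl⟩ := h2
          exact ⟨by omega, e2, hinv.total _⟩
        · rw [List.concat_eq_append, ← List.cons_append, ← List.append_assoc] at hs
          obtain ⟨rfl, -⟩ := List.append_inj' hs rfl
          obtain ⟨h4, h5, h6⟩ := hinv.stamp J₁ i e' J₃ rfl
          exact ⟨by omega, h5, h6⟩
    | exec e =>
      obtain ⟨l, r, hl, rfl, hbl⟩ := hb
      rw [hJ] at hl
      obtain ⟨J₁, ⟨i, e'⟩, J₂, rfl, rfl, rfl, rfl⟩ := map_eq_append_cons hl
      have e2 : ExecAt τ (t, e'.chan) n := by simp [hexec, Act.execChan]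
      have e1 : ∀ c, Nat.count (ExecAt τ (t, c)) (n + 1) =
          Nat.count (ExecAt τ (t, c)) n + if e'.chan = c then 1 else 0 := by
        intro c
        rw [Nat.count_succ]
        simp [hexec, Act.execChan]
      have hz := count_chan_of_not_blocks hbl
      refine ⟨J₁ ++ J₂, by simp, ?_, fun c => ?_, fun K₁ i₁ e₁ K₂ hs => ?_⟩
      · refine hinv.sorted.sublist ?_
        exact (List.Sublist.refl _).append (List.sublist_cons_self _ _)
      · rw [e1, Nat.count_succ, hinv.total]
        simp only [hisu, Act.isuChan, reduceCtorEq, if_false, List.map_append, List.map_cons,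
          List.count_append, List.count_cons, beq_iff_eq]
        omega
      · rw [List.append_eq_append_iff] at hs
        rcases hs with ⟨A, hA, hA'⟩ | ⟨A, hA, hA'⟩
        · have hsplit : J₁ ++ (i, e') :: J₂ = (J₁ ++ (i, e') :: A) ++ (i₁, e₁) :: K₂ := by
            rw [hA']; simp
          obtain ⟨h4, h5, h6⟩ := hinv.stamp _ i₁ e₁ K₂ hsplit
          refine ⟨by omega, h5, ?_⟩
          rw [h6, e1, hA]
          simp only [List.map_append, List.map_cons, List.count_append, List.count_cons,
            beq_iff_eq]
          omega
        · cases A with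
          | nil =>
            simp only [List.nil_append] at hA'
            have hsplit : J₁ ++ (i, e') :: J₂ = (J₁ ++ [(i, e')]) ++ (i₁, e₁) :: K₂ := by
              rw [← hA']; simp
            obtain ⟨h4, h5, h6⟩ := hinv.stamp _ i₁ e₁ K₂ hsplit
            refine ⟨by omega, h5, ?_⟩
            simp only [List.append_nil] at hA
            rw [h6, e1, hA]
            simp only [List.map_append, List.map_cons, List.count_append, List.count_cons,
              beq_iff_eq, List.map_nil, List.count_nil]
            omega
          | cons z A =>
            simp only [List.cons_append, List.cons.injEq] at hA'
            obtain ⟨rfl, rfl⟩ := hA'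
            subst hA
            have hsplit : (K₁ ++ (i₁, e₁) :: A) ++ (i, e') :: J₂ =
                K₁ ++ (i₁, e₁) :: (A ++ (i, e') :: J₂) := by simp
            obtain ⟨h4, h5, h6⟩ := hinv.stamp _ i₁ e₁ _ hsplit
            refine ⟨by omega, h5, ?_⟩
            -- An entry in front of the removed one belongs to another channel, since it would block
            -- the removal otherwise.
            have hne : ¬ e'.chan = e₁.chan := by
              intro hc
              exact hbl e₁ (by simp) (Entry.blocks_of_chan hc.symm)
            rw [h6, e1, if_neg hne]
            omega

/-! ### Completeness of computations -/

theorem comp_split {P : Program Thr Reg Lab Dom} {τ : List (Act Thr Dom)} (h : τ ∈ P.Comp)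
    (n : ℕ) : ∃ s u, PSteps P P.initP (τ.take n) s ∧ PSteps P s (τ.drop n) u ∧
      ∀ t, u.pend t = [] := by
  obtain ⟨u, h1, h2⟩ := mem_comp_iff.1 h
  rw [← List.take_append_drop n τ, PSteps_append] at h1
  obtain ⟨s, h3, h4⟩ := h1
  exact ⟨s, u, h3, h4, h2⟩

theorem count_of_le_length {p : ℕ → Prop} [DecidablePred p] {L n : ℕ} (h : ∀ i, p i → i < L)
    (hn : L ≤ n) : Nat.count p n = Nat.count p L := by
  obtain ⟨d, rfl⟩ := Nat.exists_eq_add_of_le hn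
  induction d with
  | zero => rfl
  | succ d ih =>
    have : ¬ p (L + d) := fun hp => by have := h _ hp; omega
    rw [← add_assoc, Nat.count_succ, if_neg this, add_zero, ih (by omega)]

/-- By `PendInv.total`, issues exceed executions by the number of pending entries of the channel,
which is zero at the end. -/
theorem complete_of_comp {P : Program Thr Reg Lab Dom} {τ : List (Act Thr Dom)} (h : τ ∈ P.Comp) :
    Complete τ := by
  have le : ∀ k n, n ≤ τ.length → Nat.count (ExecAt τ k) n ≤ Nat.count (IsuAt τ k) n := by
    intro k n hn
    obtain ⟨s, u, h1, -, -⟩ := comp_split h n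
    obtain ⟨J, -, hJ⟩ := exists_pendInv hn h1 k.1
    have : Nat.count (IsuAt τ k) n = Nat.count (ExecAt τ k) n + _ := hJ.total k.2
    omega
  refine ⟨fun k n => ?_, fun k => ?_⟩
  · rcases le_total n τ.length with hn | hn
    · exact le k n hn
    · rw [count_of_le_length (fun i (hi : ExecAt τ k i) => hi.lt_length) hn,
        count_of_le_length (fun i (hi : IsuAt τ k i) => hi.lt_length) hn]
      exact le k _ le_rfl
  · obtain ⟨s, u, h1, h2, h3⟩ := comp_split h τ.length
    obtain ⟨J, hJ', hJ⟩ := exists_pendInv le_rfl h1 k.1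
    simp only [List.drop_length, PSteps] at h2
    subst h2
    rw [h3] at hJ'
    have : J = [] := by simpa using hJ'.symm
    subst this
    have := hJ.total k.2
    simpa using this.symm

end Pgas

namespace Pgas

variable {Thr Reg Lab Dom : Type*}
variable [DecidableEq Thr] [DecidableEq Reg] [DecidableEq Dom] [Zero Dom]

/-! ### Moves that keep the trace -/

/-- The computation `τ'` results from `τ` by a reordering that keeps the trace and the order of the
actions of each thread. -/
structure Move (P : Program Thr Reg Lab Dom) (τ τ' : List (Act Thr Dom)) (π : Equiv.Perm ℕ) :
    Prop where
  comp : τ' ∈ P.Comp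
  iso : Iso τ τ' π
  lab : ∀ i, τ'[π i]? = τ[i]?
  len : τ'.length = τ.length
  thr_lt : ∀ i j, SameThread τ i j → i < j → π i < π j

namespace Move

variable {P : Program Thr Reg Lab Dom} {τ τ' τ'' : List (Act Thr Dom)} {π π' : Equiv.Perm ℕ}

theorem cost_eq (M : Move P τ τ' π) : cost τ' = cost τ := M.iso.toReord.cost_eq M.thr_lt M.len

theorem same (M : Move P τ τ' π) : (trace τ).Same (trace τ') := M.iso.same M.lab

theorem violation (M : Move P τ τ' π) (h : P.Violation τ) : P.Violation τ' :=
  ⟨M.comp, fun ⟨σ, h1, h2⟩ => h.2 ⟨σ, h1, M.same.trans h2⟩⟩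

theorem minViolation (M : Move P τ τ' π) (h : P.MinViolation τ) : P.MinViolation τ' :=
  ⟨M.violation h.1, fun σ hσ => M.cost_eq ▸ h.2 σ hσ⟩

theorem overtakes (M : Move P τ τ' π) {j m : ℕ} :
    Overtakes τ' (π j) (π m) ↔ Overtakes τ j m := M.iso.toReord.overtakes M.thr_lt

theorem delayed (M : Move P τ τ' π) {j : ℕ} : Delayed τ' (π j) ↔ Delayed τ j := by
  constructor
  · rintro ⟨m, h⟩
    obtain ⟨m, rfl⟩ := π.surjective m
    exact ⟨m, M.overtakes.1 h⟩
  · rintro ⟨m, h⟩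
    exact ⟨_, M.overtakes.2 h⟩

theorem refl (h : τ ∈ P.Comp) : Move P τ τ (Equiv.refl ℕ) where
  comp := h
  iso := ⟨⟨.of_eq fun _ => rfl, fun _ _ _ _ _ h => h, fun _ _ _ _ _ h => h⟩,
    fun _ _ _ _ _ h => h, fun s _ h => ⟨s, le_rfl, h, h⟩, fun s _ h => ⟨s, le_rfl, h, h⟩⟩
  lab _ := rfl
  len := rfl
  thr_lt _ _ _ h := h

end Move

theorem BufStep.congr {m m' : Dom → Dom} {op : Op Dom} {p p' : List (Entry Dom)}
    (h : BufStep m op p p') (hm : ∀ a v, op = .ld a v → storesTo a p = [] → m a = m' a) :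
    BufStep m' op p p' := by
  cases op with
  | ld a v =>
    refine ⟨h.1, h.2.trans ?_⟩
    rcases List.eq_nil_or_concat (storesTo a p) with h1 | ⟨l, z, h1⟩
    · rw [h1]; simpa using hm a v rfl h1
    · rw [h1]; simp
  | _ => exact h

theorem Op.memAfter_apply {op : Op Dom} {m : Dom → Dom} {a : Dom}
    (h : ∀ v, op ≠ .exec (.store a v)) : op.memAfter m a = m a := by
  rcases op with _ | _ | _ | _ | (⟨b, v⟩ | as) <;> try rfl
  have : a ≠ b := by rintro rfl; exact h v rfl
  simp [Op.memAfter, this]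

theorem Op.memAfter_comm {o₁ o₂ : Op Dom} (m : Dom → Dom)
    (h : ∀ a v w, o₁ = .exec (.store a v) → o₂ = .exec (.store a w) → False) :
    o₁.memAfter (o₂.memAfter m) = o₂.memAfter (o₁.memAfter m) := by
  rcases o₁ with _ | _ | _ | _ | (⟨a, v⟩ | as) <;> try rfl
  rcases o₂ with _ | _ | _ | _ | (⟨b, w⟩ | bs) <;> try rfl
  have : a ≠ b := by rintro rfl; exact h a v w rfl rfl
  simp only [Op.memAfter]
  exact Function.update_comm this.symm _ _ _ |>.symm ▸ rfl

/-- Different threads interact through the memory only. A store and a load of the same address still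
commute if the load finds a pending store of its own thread. -/
theorem PStep.comm {P : Program Thr Reg Lab Dom} {s s₁ s₂ : PState Thr Reg Lab Dom}
    {d c : Act Thr Dom} (h₁ : PStep P s d s₁) (h₂ : PStep P s₁ c s₂) (hthr : d.thr ≠ c.thr)
    (hdc : ∀ a v w, d.op = .exec (.store a v) → c.op = .ld a w → storesTo a (s.pend c.thr) ≠ [])
    (hcd : ∀ a v w, c.op = .exec (.store a v) → d.op = .ld a w → storesTo a (s.pend d.thr) ≠ [])
    (hst : ∀ a v w, d.op = .exec (.store a v) → c.op = .exec (.store a w) → False) :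
    ∃ s₁', PStep P s c s₁' ∧ PStep P s₁' d s₂ := by
  obtain ⟨q, p, hc, hb, rfl⟩ := h₁
  obtain ⟨q', p', hc', hb', rfl⟩ := h₂
  simp only [Function.update_of_ne hthr.symm] at hc' hb'
  refine ⟨_, ⟨q', p', hc', hb'.congr fun a w ho hn => ?_, rfl⟩, q, p, ?_, ?_, ?_⟩
  · exact Op.memAfter_apply fun v hv => hdc a v w hv ho hn
  · simpa only [Function.update_of_ne hthr] using hc
  · simp only [Function.update_of_ne hthr]
    refine hb.congr fun a w ho hn => ?_
    exact (Op.memAfter_apply fun v hv => hcd a v w hv ho hn).symm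
  · simp only [Op.memAfter_comm s.mem hst, Function.update_comm hthr]

theorem count_chan_of_storesTo {a : Dom} {J : List (ℕ × Entry Dom)}
    (h : storesTo a (J.map Prod.snd) = []) : (J.map fun x => x.2.chan).count (some a) = 0 := by
  rw [List.count_eq_zero]
  intro hm
  simp only [List.mem_map] at hm
  obtain ⟨⟨i, e⟩, hy, hc⟩ := hm
  rcases e with ⟨b, v⟩ | as
  · obtain rfl : b = a := by simpa [Entry.chan] using hc
    exact storesTo_eq_nil.1 h v (List.mem_map.2 ⟨_, hy, rfl⟩)
  · simp [Entry.chan] at hc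

/-- A load that finds no pending store of its own thread sees only stores that have reached the
memory. -/
theorem vis_lt_of_storesTo {P : Program Thr Reg Lab Dom} {τ : List (Act Thr Dom)} {n l : ℕ}
    {s : PState Thr Reg Lab Dom} (hn : n ≤ τ.length) (h : PSteps P P.initP (τ.take n) s) {t : Thr}
    {a : Dom} (hl : LoadAt τ l t a) (hnl : n ≤ l) (hi : ∀ i, n ≤ i → i < l → ¬ SameThread τ i l)
    (hp : storesTo a (s.pend t) = []) {s' : ℕ} (hv : Vis τ s' l) : s' < l := by
  obtain ⟨t', a', hl', hs, hv⟩ := hv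
  obtain ⟨rfl, rfl⟩ := hl.unique hl'
  by_contra hlt
  obtain ⟨i, h1, h2, h3⟩ := hv.resolve_left hlt
  obtain ⟨J, hJ, hinv⟩ := exists_pendInv hn h t
  rw [hJ] at hp
  obtain ⟨k, h4, h5, h6⟩ := issueOf_iff.1 h2
  obtain ⟨t₁, h7⟩ := storeAt_iff.1 hs
  obtain rfl := h7.unique h5
  obtain rfl : t₁ = t := by
    obtain ⟨t₂, h8, h9⟩ := sameThread_iff.1 h3
    rw [h4.thr] at h8
    rw [hl.thr] at h9
    exact Option.some.inj (h8.trans h9.symm)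
  -- With no pending store to `a`, all stores issued before `n` have been executed before `n`. This
  -- contradicts a store issued at `i < n` and executed after `l`.
  have h8 := hinv.total (some a)
  rw [count_chan_of_storesTo hp] at h8
  have h9 : i < n := by
    by_contra h9
    exact hi i (by omega) h1 h3
  have h10 := Nat.count_strict_mono h4 h9
  have h11 := Nat.count_monotone (ExecAt τ (t₁, some a)) (show n ≤ s' by omega)
  omega

theorem psteps_pair {P : Program Thr Reg Lab Dom} {s u : PState Thr Reg Lab Dom}
    {x y : Act Thr Dom} {β : List (Act Thr Dom)} (h : PSteps P s (x :: y :: β) u) :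
    ∃ s₁ s₂, PStep P s x s₁ ∧ PStep P s₁ y s₂ ∧ PSteps P s₂ β u := by
  obtain ⟨s₁, h1, s₂, h2, h3⟩ := h
  exact ⟨s₁, s₂, h1, h2, h3⟩

theorem exists_pair {τ : List (Act Thr Dom)} {n : ℕ} (h : n + 1 < τ.length) :
    ∃ x y β, τ = τ.take n ++ x :: y :: β ∧ τ.drop n = x :: y :: β ∧ τ[n]? = some x ∧
      τ[n + 1]? = some y := by
  have h2 : τ.drop n = τ[n] :: τ[n + 1] :: τ.drop (n + 2) := by
    rw [List.drop_eq_getElem_cons (by omega), List.drop_eq_getElem_cons h]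
  exact ⟨_, _, _, by conv_lhs => rw [← List.take_append_drop n τ, h2], h2, by simp, by simp [h]⟩

theorem getElem?_swap_take {τ : List (Act Thr Dom)} {n : ℕ} {x y : Act Thr Dom}
    {β : List (Act Thr Dom)} (hn : n ≤ τ.length) (h : τ = τ.take n ++ x :: y :: β) (i : ℕ) :
    (τ.take n ++ y :: x :: β)[Equiv.swap n (n + 1) i]? = τ[i]? := by
  have h1 := getElem?_swap (τ.take n) β x y i
  rw [List.length_take_of_le hn] at h1
  rw [h1, ← h]

/-- Independent neighbours of different threads can be swapped. -/
theorem exists_move_swap {P : Program Thr Reg Lab Dom} {τ : List (Act Thr Dom)} (h : τ ∈ P.Comp)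
    {n : ℕ} (hn : n + 1 < τ.length) (hthr : ¬ SameThread τ n (n + 1)) (hhb : ¬ Hb τ n (n + 1)) :
    ∃ τ', Move P τ τ' (Equiv.swap n (n + 1)) := by
  obtain ⟨d, c, β, hτ, hdrop, hd, hc⟩ := exists_pair hn
  obtain ⟨s, u, h1, h2, h3⟩ := comp_split h n
  rw [hdrop] at h2
  obtain ⟨s₁, s₂, h4, h5, h6⟩ := psteps_pair h2
  have hne : d.thr ≠ c.thr := fun e => hthr ⟨d, c, hd, hc, e⟩
  have load : ∀ {m x a w}, τ[m]? = some x → x.op = .ld a w → LoadAt τ m x.thr a := by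
    rintro m ⟨t, op⟩ a w hx rfl; exact ⟨w, hx⟩
  have store : ∀ {m x a w}, τ[m]? = some x → x.op = .exec (.store a w) → StoreAt τ m a := by
    rintro m ⟨t, op⟩ a w hx rfl; exact ⟨t, w, hx⟩
  have hst : ∀ a, ¬ (StoreAt τ n a ∧ StoreAt τ (n + 1) a) := by
    rintro a ⟨ha, hb⟩
    exact hhb (.inr (.inl ⟨by omega, a, ha, hb⟩))
  -- If the store at `n` is visible to the load at `n + 1` without being its source, the load reads
  -- from a later store, hence from a pending one of its own thread.
  have hv : Vis τ n (n + 1) → ∃ s > n + 1, Vis τ s (n + 1) := by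
    intro hv
    by_contra hno
    push Not at hno
    refine hhb (.inr (.inr (.inl (src_iff.2 ⟨hv, fun s' hs' => ?_⟩))))
    by_contra hlt
    have : s' ≠ n + 1 := by
      rintro rfl
      obtain ⟨t, a, hl, hs, -⟩ := hs'
      exact hl.not_storeAt hs
    exact hno s' (by omega) hs'
  have hv' : ∀ t a, LoadAt τ n t a → StoreAt τ (n + 1) a → ∃ s ≥ n + 1, Vis τ s n := by
    intro t a hl hs
    by_contra hno
    push Not at hno
    refine hhb (.inr (.inr (.inr (Cf.of_vis_lt hl hs (fun s' hs' => ?_) fun s' hs' hlt => ?_))))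
    · by_contra hlt
      exact hno s' (by omega) hs'
    · have : s' ≠ n := by rintro rfl; exact hl.not_storeAt hs'
      exact ⟨t, a, hl, hs', .inl (by omega)⟩
  -- In both store-load cases a store behind the load is visible to it, so the load is an early read
  -- and ignores the memory.
  obtain ⟨s₁', h7, h8⟩ := h4.comm h5 hne (by
      intro a v w ho ho' hemp
      have hl := load hc ho'
      have hs := store hd ho
      obtain ⟨s', h8, h9⟩ := hv ⟨_, a, hl, hs, .inl (by omega)⟩
      have := vis_lt_of_storesTo (by omega) h1 hl (by omega) (fun i h10 h11 => by
        obtain rfl : i = n := by omega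
        exact hthr) hemp h9
      omega) (by
      intro a v w ho ho' hemp
      have hl := load hd ho'
      have hs := store hc ho
      obtain ⟨s', h8, h9⟩ := hv' _ _ hl hs
      have := vis_lt_of_storesTo (by omega) h1 hl le_rfl (fun i h10 h11 => by omega) hemp h9
      omega) (by
      intro a v w ho ho'
      exact hst a ⟨store hd ho, store hc ho'⟩)
  have hlab := getElem?_swap_take (by omega) hτ
  refine ⟨τ.take n ++ c :: d :: β, ?_, ?_, hlab, ?_, ?_⟩
  · exact mem_comp_iff.2 ⟨u, PSteps_append.2 ⟨s, h1, s₁', h7, s₂, h8, h6⟩, h3⟩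
  · refine Iso.of_swap (.of_eq hlab) (fun h => absurd h hthr) (fun k hk => ?_) hst hv hv'
    exact hthr (sameThread_iff.2 ⟨_, hk.1.thr, hk.2.thr⟩)
  · conv_rhs => rw [hτ]
    simp
  · intro i j hs hlt
    refine swap_lt hlt ?_
    rintro ⟨rfl, rfl⟩
    exact hthr hs

theorem Move.trans {P : Program Thr Reg Lab Dom} {τ τ' τ'' : List (Act Thr Dom)}
    {π π' : Equiv.Perm ℕ} (M : Move P τ τ' π) (M' : Move P τ' τ'' π') :
    Move P τ τ'' (π.trans π') where
  comp := M'.comp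
  lab i := (M'.lab _).trans (M.lab i)
  len := M'.len.trans M.len
  thr_lt i j hs h := M'.thr_lt _ _ (M.iso.sameThread.2 hs) (M.thr_lt i j hs h)
  iso := by
    refine ⟨⟨.of_eq fun i => (M'.lab _).trans (M.lab i), fun i j hi hj hs h => ?_,
      fun k i j hi hj h => ?_⟩, fun a i j hi hj h => ?_, fun s l h => ?_, fun s l h => ?_⟩
    · exact M'.iso.node_lt _ _ (M.iso.isNode.2 hi) (M.iso.isNode.2 hj) (M.iso.sameThread.2 hs)
        (M.iso.node_lt _ _ hi hj hs h)
    · exact M'.iso.exec_lt k _ _ ((M.iso.exec _ _).2 hi) ((M.iso.exec _ _).2 hj)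
        (M.iso.exec_lt k _ _ hi hj h)
    · exact M'.iso.store_lt a _ _ (M.iso.store.2 hi) (M.iso.store.2 hj)
        (M.iso.store_lt a _ _ hi hj h)
    -- The visibility clauses do not compose directly, because the store provided by the first move
    -- need not stay visible after the second. Sources are preserved by both moves, so the source
    -- serves as the common visible store.
    · obtain ⟨s', hs', hle⟩ := exists_src h
      refine ⟨s', hle, (src_iff.1 hs').1, ?_⟩
      exact (src_iff.1 (M'.iso.src.2 (M.iso.src.2 hs'))).1
    · obtain ⟨s', hs', hle⟩ := exists_src h
      obtain ⟨s', rfl⟩ := π'.surjective s'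
      obtain ⟨s', rfl⟩ := π.surjective s'
      have h1 := M.iso.src.1 (M'.iso.src.1 hs')
      obtain ⟨a, h2, h3⟩ := Iso.vis_store h (src_iff.1 hs').1
      simp only [Equiv.trans_apply, M'.iso.store, M.iso.store] at h2 h3
      refine ⟨s', ?_, (src_iff.1 h1).1, (src_iff.1 hs').1⟩
      have h4 := M'.iso.store_lt_iff (M.iso.store.2 h2) (M.iso.store.2 h3)
      have h5 := M.iso.store_lt_iff h2 h3
      by_contra hlt
      have h6 := M.iso.store_lt_iff h3 h2
      have h7 := M'.iso.store_lt_iff (M.iso.store.2 h3) (M.iso.store.2 h2)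
      simp only [Equiv.trans_apply] at hle
      omega

/-- An action can be moved to the left over independent actions of other threads. -/
theorem exists_move_left {P : Program Thr Reg Lab Dom} {τ : List (Act Thr Dom)} (h : τ ∈ P.Comp)
    {p c : ℕ} (hpc : p ≤ c) (hc : c < τ.length)
    (hind : ∀ m, p ≤ m → m < c → ¬ SameThread τ m c ∧ ¬ Hb τ m c) :
    ∃ τ', Move P τ τ' (rotate p c hpc) := by
  induction c, hpc using Nat.le_induction generalizing τ with
  | base =>
    refine ⟨τ, ?_⟩
    convert Move.refl h
    ext i
    simp only [rotate_apply, Equiv.refl_apply]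
    split_ifs <;> omega
  | succ c hpc ih =>
    obtain ⟨h1, h2⟩ := hind c hpc (by omega)
    obtain ⟨τ₁, M⟩ := exists_move_swap h hc h1 h2
    have e1 : Equiv.swap c (c + 1) (c + 1) = c := Equiv.swap_apply_right _ _
    have e2 : ∀ m < c, Equiv.swap c (c + 1) m = m := fun m hm =>
      Equiv.swap_apply_of_ne_of_ne (by omega) (by omega)
    obtain ⟨τ₂, M'⟩ := ih M.comp (by rw [M.len]; omega) fun m hm hmc => by
      obtain ⟨h3, h4⟩ := hind m hm (by omega)
      rw [← M.iso.sameThread, e1, e2 m hmc] at h3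
      rw [← M.iso.hb, e1, e2 m hmc] at h4
      exact ⟨h3, h4⟩
    refine ⟨τ₂, ?_⟩
    -- Moving `c + 1` to `p` is the swap of `c` and `c + 1` followed by moving `c` to `p`.
    convert M.trans M'
    ext i
    simp only [rotate_apply, Equiv.trans_apply, Equiv.swap_apply_def]
    split_ifs <;> omega

end Pgas

namespace Pgas

variable {Thr Reg Lab Dom : Type*}
variable [DecidableEq Thr] [DecidableEq Reg] [DecidableEq Dom] [Zero Dom]

/-! ### Undoing a delay -/

theorem Overtakes.lt {τ : List (Act Thr Dom)} {j m : ℕ} (h : Overtakes τ j m) : m < j := by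
  obtain ⟨i, -, -, h, -⟩ := h
  exact h

theorem PStep.exec_iff {P : Program Thr Reg Lab Dom} {s s' : PState Thr Reg Lab Dom} {t : Thr}
    {e : Entry Dom} : PStep P s ⟨t, .exec e⟩ s' ↔ ∃ p, Removes e (s.pend t) p ∧
      s' = ⟨s.ctl, (Op.exec e).memAfter s.mem, Function.update s.pend t p⟩ := by
  constructor
  · rintro ⟨q, p, hc, hb, rfl⟩
    refine ⟨p, hb, ?_⟩
    have hq : q = s.ctl t := by
      simp only at hc
      generalize s.ctl t = q₀ at hc
      cases hc
      rfl
    simp [hq]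
  · rintro ⟨p, hb, rfl⟩
    exact ⟨_, p, .exec _ _, hb, by simp⟩

/-- After the swap of an action with a store or fence of the same thread that overtakes it, there
are fewer delays, or as many delays and fewer reorders. -/
theorem cost_lt_of_swap {τ τ' : List (Act Thr Dom)} {n i : ℕ}
    (hτ : Complete τ) (R : Reord τ τ' (Equiv.swap n (n + 1))) (hlen : τ'.length = τ.length)
    (hx : IssueOf τ i (n + 1)) (hi : i < n) (hs : SameThread τ n (n + 1)) (hd : ¬ Delayed τ n) :
    cost τ' < cost τ := by
  set π := Equiv.swap n (n + 1) with hπ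
  obtain ⟨k, hxi, hxe⟩ := hx.isuAt
  have e0 : π n = n + 1 := Equiv.swap_apply_left _ _
  have e1 : π (n + 1) = n := Equiv.swap_apply_right _ _
  have e2 : ∀ m, π (π m) = m := fun m => Equiv.swap_apply_self n (n + 1) m
  have ei : π i = i := Equiv.swap_apply_of_ne_of_ne (by omega) (by omega)
  have hxe' : ExecAt τ' k n := by rw [← e1, R.exec]; exact hxe
  have iss : ∀ {a b}, IssueOf τ' a b ↔ IssueOf τ (π a) (π b) := by
    intro a b
    rw [← R.issueOf, e2, e2]
  -- The swap reverses only the pair `(n, n + 1)`, so the only possible new overtaking is that of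
  -- `n` by `n + 1`.
  have ovt : ∀ j m, Overtakes τ' j m → ¬ (j = n + 1 ∧ m = n) → Overtakes τ (π j) (π m) := by
    rintro j m ⟨a, h1, h2, h3, h4⟩ hne
    refine ⟨π a, iss.1 h1, swap_lt h2 ?_, swap_lt h3 (by omega), ?_⟩
    · rintro ⟨rfl, -⟩
      obtain ⟨k', h5, -⟩ := h1.isuAt
      exact h5.not_execAt hxe'
    · rw [← R.sameThread, e2, e2]; exact h4
  have hpt : Overtakes τ (n + 1) n := ⟨i, hx, hi, by omega, hs⟩
  -- The possible new pair `(n + 1, n)` is sent to the pair with the same numbers, which counts a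
  -- delay of `τ`. No other pair is mapped there, as it would have to be `(n, n + 1)`.
  have hinj : Set.InjOn (fun x : ℕ × ℕ => if x = (n + 1, n) then (n + 1, n) else (π x.1, π x.2))
      (delaySet τ') := by
    have aux : ∀ x ∈ delaySet τ', (π x.1, π x.2) ≠ (n + 1, n) := by
      rintro ⟨j, m⟩ hx he
      simp only [Prod.mk.injEq] at he
      have h1 : j = n := by rw [← e2 j, he.1, e1]
      have h2 : m = n + 1 := by rw [← e2 m, he.2, e0]
      have := Overtakes.lt hx
      simp only at this
      omega
    intro x hx y hy hxy
    simp only at hxy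
    split_ifs at hxy with h1 h2 h2
    · rw [h1, h2]
    · exact absurd hxy.symm (aux y hy)
    · exact absurd hxy (aux x hx)
    · simp only [Prod.mk.injEq, π.injective.eq_iff] at hxy
      exact Prod.ext hxy.1 hxy.2
  have hinj' : Function.Injective (Prod.map π π) := π.injective.prodMap π.injective
  have hne : ∀ x ∈ delaySet τ', Prod.map π π x ≠ (n + 1, n) := by
    rintro ⟨j, m⟩ hx he
    simp only [Prod.map_apply, Prod.mk.injEq] at he
    have h1 : j = n := by rw [← e2 j, he.1, e1]
    have h2 : m = n + 1 := by rw [← e2 m, he.2, e0]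
    have := Overtakes.lt hx
    simp only at this
    omega
  rw [cost_lt_iff, delays_eq, delays_eq, reorders_eq, reorders_eq, hlen]
  -- If the action at `n` is itself a store or fence, it may overtake the other one after the swap,
  -- so only the reorders are certain to decrease. Otherwise a delay disappears and nothing replaces
  -- it.
  by_cases hn : ∃ k', ExecAt τ k' n
  · have hle : (delaySet τ').ncard ≤ (delaySet τ).ncard := by
      refine Set.ncard_le_ncard_of_injOn _ (fun x hx => ?_) hinj (delaySet_finite τ)
      split_ifs with h1
      · exact hpt
      · exact ovt _ _ hx fun h => h1 (Prod.ext h.1 h.2)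
    suffices (reorderSet τ').ncard < (reorderSet τ).ncard by omega
    obtain ⟨k', hn⟩ := hn
    obtain ⟨iy, hiy⟩ := hτ.exists_issue hn
    have hyn := hτ.lt hiy
    -- With its issue before `i`, the action at `n` would overtake the issue at `i` and be delayed.
    have hlt : i < iy := by
      by_contra hle
      rcases (not_lt.1 hle).lt_or_eq with h1 | h1
      · exact hd ⟨i, iy, hiy, h1, hi, hx.sameThread.trans hs.symm⟩
      · subst h1; have := hx.exec_unique hiy; omega
    have hmem : (n + 1, n) ∈ reorderSet τ :=
      ⟨hpt, iy, hiy, i, hx, hlt, by omega, hiy.sameThread.trans hs⟩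
    refine lt_of_le_of_lt ?_ (Set.ncard_sdiff_singleton_lt_of_mem hmem (reorderSet_finite τ))
    refine Set.ncard_le_ncard_of_injOn (Prod.map π π) ?_ hinj'.injOn ((reorderSet_finite τ).sdiff)
    rintro ⟨j, m⟩ hjm
    obtain ⟨h1, a, h2, h3⟩ := id hjm
    refine ⟨⟨ovt _ _ h1 fun h => ?_, π a, iss.1 h2, ovt _ _ h3 fun h => ?_⟩, hne _ h1⟩
    -- As a reorder of `τ'` this pair would need `iy < i`, contrary to `hlt`.
    · obtain ⟨rfl, rfl⟩ : j = n + 1 ∧ m = n := h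
      obtain ⟨b, h4, h5, -⟩ := h3
      have h6 := iss.1 h2
      have h7 := iss.1 h4
      simp only [e0] at h6
      simp only [e1] at h7
      have h8 : a = i := by rw [← e2 a, h6.issue_unique hx, ei]
      have h9 : b = iy := by
        rw [← e2 b, h7.issue_unique hiy]
        exact Equiv.swap_apply_of_ne_of_ne (by omega) (by omega)
      omega
    · obtain ⟨rfl, rfl⟩ : j = n + 1 ∧ a = n := h
      obtain ⟨k₂, h4, -⟩ := h2.isuAt
      exact h4.not_execAt hxe'
  · left
    refine lt_of_le_of_lt ?_ (Set.ncard_sdiff_singleton_lt_of_mem (a := (n + 1, n)) hpt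
      (delaySet_finite τ))
    refine Set.ncard_le_ncard_of_injOn (Prod.map π π) (fun x hx => ⟨?_, hne x hx⟩) hinj'.injOn
      ((delaySet_finite τ).sdiff)
    refine ovt _ _ hx fun h => ?_
    obtain ⟨j, m⟩ := x
    obtain ⟨rfl, rfl⟩ : j = n + 1 ∧ m = n := h
    obtain ⟨a, h1, -⟩ := hx
    obtain ⟨k', -, h2⟩ := (iss.1 h1).isuAt
    simp only [e1] at h2
    exact hn ⟨k', h2⟩

/-- A delayed store or fence can be swapped with an undelayed action that it overtakes last. -/
theorem exists_cost_lt {P : Program Thr Reg Lab Dom} {τ : List (Act Thr Dom)} (h : τ ∈ P.Comp)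
    {n i : ℕ} (hx : IssueOf τ i (n + 1)) (hi : i < n) (hs : SameThread τ n (n + 1))
    (hd : ¬ Delayed τ n) :
    ∃ τ' ∈ P.Comp, (trace τ).Same (trace τ') ∧ cost τ' < cost τ := by
  have hτ := complete_of_comp h
  obtain ⟨k, hxi, hxe⟩ := hx.isuAt
  have hn : n + 1 < τ.length := hxe.lt_length
  obtain ⟨a, x, β, hτ', hdrop, ha, hxx⟩ := exists_pair hn
  obtain ⟨s, u, h1, h2, h3⟩ := comp_split h n
  rw [hdrop] at h2
  obtain ⟨s₁, s₂, h4, h5, h6⟩ := psteps_pair h2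
  obtain ⟨e, he, hek⟩ := execAt_iff.1 hxe
  obtain ⟨t, c⟩ := k
  simp only at he hek
  subst hek
  rw [hxx] at he
  obtain rfl := Option.some.inj he
  obtain ⟨t', op⟩ := a
  obtain rfl : t' = t := by
    obtain ⟨x, y, h7, h8, h9⟩ := hs
    rw [ha] at h7
    rw [hxx] at h8
    cases h7
    cases h8
    exact h9
  have hearly : ∀ iy, IssueOf τ iy n → i < iy := by
    intro iy hiy
    by_contra hle
    rcases (not_lt.1 hle).lt_or_eq with h1 | h1
    · exact hd ⟨i, iy, hiy, h1, hi, hx.sameThread.trans hs.symm⟩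
    · subst h1; have := hx.exec_unique hiy; omega
  have hexec : ∀ k, ¬ (ExecAt τ k n ∧ ExecAt τ k (n + 1)) := by
    rintro k ⟨h7, h8⟩
    obtain ⟨iy, hiy⟩ := hτ.exists_issue h7
    have := (hiy.lt_iff hx h7 h8).2 (by omega)
    have := hearly iy hiy
    omega
  obtain ⟨J, hJ, hinv⟩ := exists_pendInv (by omega) h1 t'
  obtain ⟨p₂, hrem, rfl⟩ := PStep.exec_iff.1 h5
  obtain ⟨q, p₁, hc, hb, rfl⟩ := h4
  simp only [Function.update_self, Function.update_idem] at hrem h6 hc hb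
  -- the issue of `e` is pending before the action at `n`
  have hcnt : 0 < (J.map fun x => x.2.chan).count e.chan ∨ ExecAt τ (t', e.chan) n := by
    by_contra hno
    push Not at hno
    obtain ⟨k, h7, h8, h9⟩ := issueOf_iff.1 hx
    obtain rfl := hxe.unique h8
    have h10 := hinv.total e.chan
    have h11 := Nat.count_strict_mono h7 hi
    rw [Nat.count_succ, if_neg hno.2] at h9
    have h12 := hno.1
    omega
  -- The entry `e` is pending already and can leave before `op`, after which `op` behaves as before.
  -- Each kind of action needs its own reason.
  have key : ∃ p, Removes e (s.pend t') p ∧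
      BufStep ((Op.exec e).memAfter s.mem) op p p₂ := by
    cases op with
    | ld b v =>
      obtain ⟨rfl, hv⟩ := hb
      refine ⟨p₂, hrem, rfl, ?_⟩
      rw [hv, hrem.storesTo_eq b]
      -- If no store to `b` is pending once `e` is removed, the load read from `e` or from the
      -- memory, and the memory after `e` holds that value in either case.
      rcases List.eq_nil_or_concat (storesTo b p₂) with h7 | ⟨l, z, h7⟩
      · rw [h7]
        rcases e with ⟨b', w⟩ | as
        · by_cases hbb : b' = b
          · subst hbb; simp [storesTo, Op.memAfter]
          · have : ¬ b = b' := fun h => hbb h.symm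
            simp [storesTo, Op.memAfter, hbb, this]
        · simp [storesTo, Op.memAfter]
      · rw [h7]; simp
    | loc =>
      obtain rfl := hb
      exact ⟨p₂, hrem, rfl⟩
    | scfence =>
      obtain ⟨h7, rfl⟩ := hb
      rw [h7] at hrem
      exact absurd hrem not_removes_nil
    | isu y =>
      obtain rfl := hb
      -- The removed entry is not the one just issued: that would require an empty channel before
      -- the issue, whereas `e` was already pending.
      rcases hrem.snoc_cases with ⟨p, h7, rfl⟩ | ⟨rfl, -, h7⟩
      · exact ⟨p, h7, rfl⟩
      · rw [hJ] at h7
        have h8 := count_chan_of_not_blocks h7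
        have h9 : ¬ ExecAt τ (t', e.chan) n := by simp [ExecAt, ha, Act.execChan]
        rcases hcnt with h10 | h10
        · omega
        · exact absurd h10 h9
    | exec y =>
      obtain ⟨l, r, hl, rfl, hbl⟩ := hb
      rw [hJ] at hl
      obtain ⟨J₁, ⟨iy, y'⟩, J₂, rfl, rfl, rfl, rfl⟩ := map_eq_append_cons hl
      have hyn : ExecAt τ (t', y'.chan) n := by simp [ExecAt, ha, Act.execChan]
      obtain ⟨-, hyi, hyc⟩ := hinv.stamp J₁ iy y' J₂ rfl
      rw [count_chan_of_not_blocks hbl, add_zero] at hyc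
      have hiy : IssueOf τ iy n := issueOf_iff.2 ⟨_, hyi, hyn, hyc⟩
      have hlt := hearly iy hiy
      obtain ⟨l', r', hl', rfl, hbl'⟩ := hrem
      rw [← List.map_append] at hl'
      obtain ⟨L, ⟨ie, e'⟩, L', hL, rfl, rfl, rfl⟩ := map_eq_append_cons hl'
      have hyne : ¬ y'.chan = e'.chan := fun hc => hexec _ ⟨hyn, hc ▸ hxe⟩
      have he1 : Nat.count (ExecAt τ (t', e'.chan)) (n + 1) =
          Nat.count (ExecAt τ (t', e'.chan)) n := by
        rw [Nat.count_succ, if_neg, add_zero]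
        intro h
        exact hexec _ ⟨h, hxe⟩
      -- Pending entries are sorted by issue and `i < iy`, so `e` cannot stand behind `y'`. Hence
      -- `e` is in front of it, and the two removals commute.
      have right : ∀ K₁ K₂, J₂ = K₁ ++ (ie, e') :: K₂ → L = J₁ ++ K₁ → False := by
        rintro K₁ K₂ rfl rfl
        obtain ⟨-, h7, h8⟩ := hinv.stamp (J₁ ++ (iy, y') :: K₁) ie e' K₂ (by simp)
        have h9 := count_chan_of_not_blocks hbl'
        simp only [List.map_append, List.map_cons, List.count_append, List.count_cons,
          beq_iff_eq, hyne, if_false] at h8 h9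
        have h10 : IssueOf τ ie (n + 1) := issueOf_iff.2 ⟨_, h7, hxe, by omega⟩
        have h11 := h10.issue_unique hx
        have h12 := hinv.sorted
        rw [List.pairwise_append] at h12
        have h13 := (List.pairwise_cons.1 h12.2.1).1 (ie, e') (by simp)
        simp only at h13
        omega
      rw [List.append_eq_append_iff] at hL
      rcases hL with ⟨A, hA, hA'⟩ | ⟨A, hA, hA'⟩
      · exact absurd hA (fun _ => right A L' hA' hA)
      · cases A with
        | nil => exact absurd hA (fun _ => right [] L' (by simpa using hA'.symm)
            (by simpa using hA.symm))
        | cons z A =>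
          simp only [List.cons_append, List.cons.injEq] at hA'
          obtain ⟨rfl, rfl⟩ := hA'
          subst hA
          rw [hJ]
          refine ⟨_, ⟨L.map Prod.snd, (A ++ (iy, y') :: J₂).map Prod.snd, by simp, rfl, hbl'⟩,
            (L ++ A).map Prod.snd, J₂.map Prod.snd, by simp, by simp, fun z hz => hbl z ?_⟩
          simp only [List.map_append, List.map_cons, List.mem_append, List.mem_cons] at hz ⊢
          tauto
  have hst : ∀ a, ¬ (StoreAt τ n a ∧ StoreAt τ (n + 1) a) := by
    rintro a ⟨h7, h8⟩
    obtain ⟨t₁, h7⟩ := storeAt_iff.1 h7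
    obtain ⟨t₂, h8⟩ := storeAt_iff.1 h8
    obtain ⟨t₃, h9, h10⟩ := sameThread_iff.1 hs
    rw [h7.thr] at h9
    rw [h8.thr] at h10
    obtain rfl := Option.some.inj (h9.trans h10.symm)
    exact hexec _ ⟨h7, h8⟩
  obtain ⟨p, h7, h8⟩ := key
  have hmem : op.memAfter ((Op.exec e).memAfter s.mem) =
      (Op.exec e).memAfter (op.memAfter s.mem) := by
    refine Op.memAfter_comm s.mem fun b v w ho ho' => hst b ⟨⟨t', v, ?_⟩, t', w, ?_⟩
    · rw [ha, ho]
    · rw [hxx, ho']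
  have hlab := getElem?_swap_take (by omega) hτ'
  have R : Iso τ (τ.take n ++ ⟨t', .exec e⟩ :: ⟨t', op⟩ :: β) (Equiv.swap n (n + 1)) := by
    refine Iso.of_swap (.of_eq hlab) (fun _ hk => ?_) hexec hst ?_ ?_
    · exact (isNode_iff.1 hk.2).2 _ hxe
    · rintro ⟨t, a, hl, -⟩
      exact absurd hxe hl.not_execAt
    · intro t a hl hs'
      -- The store is issued before the load by the same thread, so it is visible before and after
      -- the swap.
      exact ⟨n + 1, le_rfl, t, a, hl, hs', .inr ⟨i, hi, hx, hx.sameThread.trans hs.symm⟩⟩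
  have hlen : (τ.take n ++ ⟨t', .exec e⟩ :: ⟨t', op⟩ :: β).length = τ.length := by
    conv_rhs => rw [hτ']
    simp
  refine ⟨_, ?_, R.same hlab, cost_lt_of_swap hτ R.toReord hlen hx hi hs hd⟩
  refine mem_comp_iff.2 ⟨u, PSteps_append.2 ⟨s, h1, _, PStep.exec_iff.2 ⟨p, h7, rfl⟩, _,
    ⟨q, p₂, hc, ?_, rfl⟩, ?_⟩, h3⟩
  · simpa using h8
  · simp only [Function.update_idem, hmem]
    exact h6

end Pgas

namespace Pgas

variable {Thr Reg Lab Dom : Type*}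
variable [DecidableEq Thr] [DecidableEq Reg] [DecidableEq Dom] [Zero Dom]

/-! ### Runs that only empty the buffers -/

/-- The action is a store or fence action. -/
def Act.IsExec (x : Act Thr Dom) : Prop := ∃ e, x.op = .exec e

/-- Whether pending entries can leave depends neither on the memory nor on program counters and
registers. -/
theorem PSteps.congr_of_isExec {P : Program Thr Reg Lab Dom} {s s' u : PState Thr Reg Lab Dom}
    {β : List (Act Thr Dom)} (hβ : ∀ x ∈ β, x.IsExec) (h : PSteps P s β u)
    (hs : s'.pend = s.pend) : ∃ u', PSteps P s' β u' ∧ u'.pend = u.pend := by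
  induction β generalizing s s' with
  | nil => cases h; exact ⟨s', rfl, hs⟩
  | cons x β ih =>
    obtain ⟨s₁, h1, h2⟩ := h
    obtain ⟨t, op⟩ := x
    obtain ⟨e, rfl⟩ : ∃ e, op = .exec e := hβ ⟨t, op⟩ (by simp)
    obtain ⟨p, hp, rfl⟩ := PStep.exec_iff.1 h1
    obtain ⟨u', h3, h4⟩ := ih (fun x hx => hβ x (by simp [hx])) h2
      (s' := ⟨s'.ctl, (Op.exec e).memAfter s'.mem, Function.update s'.pend t p⟩) (by simp [hs])
    exact ⟨u', ⟨_, PStep.exec_iff.2 ⟨p, by rwa [hs], rfl⟩, h3⟩, h4⟩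

/-- If `d` is a load, it may read another value after the execution, so registers may differ
afterwards. Only the pending lists and the action up to its value are kept. -/
theorem PStep.pull_exec {P : Program Thr Reg Lab Dom} {s s₁ s₂ : PState Thr Reg Lab Dom}
    {d : Act Thr Dom} {t : Thr} {e : Entry Dom} (h₁ : PStep P s d s₁)
    (h₂ : PStep P s₁ ⟨t, .exec e⟩ s₂) (hthr : d.thr ≠ t) :
    ∃ d' s₁' s₂', PStep P s ⟨t, .exec e⟩ s₁' ∧ PStep P s₁' d' s₂' ∧ d'.erase = d.erase ∧
      s₂'.pend = s₂.pend := by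
  obtain ⟨p', hr, rfl⟩ := PStep.exec_iff.1 h₂
  obtain ⟨q, p, hc, hb, rfl⟩ := h₁
  obtain ⟨t', op⟩ := d
  simp only [Function.update_of_ne (Ne.symm hthr)] at hr
  simp only at hthr hc hb
  have hpend : ∀ p, Function.update (Function.update s.pend t p') t' p =
      Function.update (Function.update s.pend t' p) t p' := fun p =>
    Function.update_comm hthr.symm _ _ _
  by_cases hld : ∃ a v, op = .ld a v
  · obtain ⟨a, v, rfl⟩ := hld
    obtain ⟨rfl, -⟩ := hb
    have hc' : ∀ v', ∃ q', Ctl (P.code t') (s.ctl t') (.ld a v') q' := by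
      intro v'
      generalize s.ctl t' = q₀ at hc
      cases hc with
      | ld l l' r ea ρ v hI => exact ⟨_, .ld _ _ _ _ _ _ hI⟩
    obtain ⟨q', hq'⟩ := hc' ((storesTo a (s.pend t')).getLast?.getD
      ((Op.exec e).memAfter s.mem a))
    refine ⟨⟨t', .ld a _⟩, _, _, PStep.exec_iff.2 ⟨p', hr, rfl⟩,
      ⟨q', s.pend t', hq', ⟨?_, ?_⟩, rfl⟩, rfl, ?_⟩
    · simp [Function.update_of_ne hthr]
    · simp [Function.update_of_ne hthr]
    · simp [hpend]
  · refine ⟨⟨t', op⟩, _, _, PStep.exec_iff.2 ⟨p', hr, rfl⟩, ⟨q, p, hc, ?_, rfl⟩, rfl, ?_⟩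
    · simp only [Function.update_of_ne hthr]
      exact hb.congr fun a v ho => absurd ⟨a, v, ho⟩ hld
    · simp [hpend]

theorem Act.isExec_of_erase {x y : Act Thr Dom} (h : x.erase = y.erase) (hy : y.IsExec) :
    x.IsExec := by
  obtain ⟨t, op⟩ := x
  obtain ⟨t', op'⟩ := y
  obtain ⟨e, rfl⟩ : ∃ e, op' = .exec e := hy
  cases op <;> simp [Act.erase] at h
  exact ⟨_, rfl⟩

/-- A store or fence action can be executed earlier when at most one of the actions that it passes
is not a store or fence action and only such actions follow. A load that is passed may change its
value. -/
theorem PSteps.pull_exec {P : Program Thr Reg Lab Dom} {s u : PState Thr Reg Lab Dom}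
    {D β : List (Act Thr Dom)} {t : Thr} {e : Entry Dom}
    (h : PSteps P s (D ++ ⟨t, .exec e⟩ :: β) u) (hD : ∀ x ∈ D, x.thr ≠ t)
    (hD' : ∀ x ∈ D.tail, x.IsExec) (hβ : ∀ x ∈ β, x.IsExec) :
    ∃ D' u', PSteps P s (⟨t, .exec e⟩ :: (D' ++ β)) u' ∧ u'.pend = u.pend ∧
      D'.map Act.erase = D.map Act.erase := by
  induction D generalizing s with
  | nil => exact ⟨[], u, h, rfl, rfl⟩
  | cons d D ih =>
    obtain ⟨s₁, h1, h2⟩ := h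
    obtain ⟨D', u₁, ⟨s₂, h3, h4⟩, h5, h6⟩ := ih h2 (fun x hx => hD x (by simp [hx]))
      fun x hx => hD' x (List.mem_of_mem_tail hx)
    obtain ⟨d', s₁', s₂', h7, h8, h9, h10⟩ := h1.pull_exec h3 (hD d (by simp))
    have hex : ∀ x ∈ D' ++ β, x.IsExec := by
      intro x hx
      rcases List.mem_append.1 hx with hx | hx
      · have h11 : x.erase ∈ D.map Act.erase := h6 ▸ List.mem_map_of_mem hx
        obtain ⟨y, hy, hxy⟩ := List.mem_map.1 h11
        exact Act.isExec_of_erase hxy.symm (hD' y hy)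
      · exact hβ x hx
    obtain ⟨u', h11, h12⟩ := h4.congr_of_isExec hex h10
    exact ⟨d' :: D', u', ⟨s₁', h7, s₂', h8, h11⟩, h12.trans h5, by simp [h9, h6]⟩

theorem getElem?_rotate {α : Type*} (A D B : List α) (y : α) (i : ℕ) :
    (A ++ y :: (D ++ B))[rotate A.length (A.length + D.length) (by omega) i]? =
      (A ++ (D ++ y :: B))[i]? := by
  rw [rotate_apply]
  split_ifs with h1 h2
  · subst h1
    rw [List.getElem?_append_right (by omega), List.getElem?_append_right (by omega)]
    simp
  · obtain ⟨k, rfl⟩ := Nat.exists_eq_add_of_le h2.1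
    rw [List.getElem?_append_right (by omega), List.getElem?_append_right (by omega),
      Nat.add_sub_cancel_left, show A.length + k + 1 - A.length = k + 1 by omega,
      List.getElem?_cons_succ, List.getElem?_append_left (by omega),
      List.getElem?_append_left (by omega)]
  · rcases lt_or_ge i A.length with h | h
    · rw [List.getElem?_append_left h, List.getElem?_append_left h]
    · obtain ⟨k, rfl⟩ : ∃ k, i = A.length + D.length + (k + 1) :=
        ⟨i - A.length - D.length - 1, by omega⟩
      rw [List.getElem?_append_right (by omega), List.getElem?_append_right (by omega),
        show A.length + D.length + (k + 1) - A.length = D.length + k + 1 by omega,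
        List.getElem?_cons_succ, List.getElem?_append_right (by omega),
        List.getElem?_append_right (by omega),
        show D.length + k + 1 - D.length = k + 1 by omega, List.getElem?_cons_succ]
      congr 1
      omega

theorem isExec_iff {τ : List (Act Thr Dom)} {i : ℕ} {x : Act Thr Dom} (h : τ[i]? = some x) :
    x.IsExec ↔ ∃ k, ExecAt τ k i := by
  unfold ExecAt
  rw [h]
  obtain ⟨t, op⟩ := x
  cases op <;> simp [Act.IsExec, Act.execChan]

/-- The passed action at `lo` is arbitrary and may be a load whose value changes. This has no
consequence, since behind it there are only stores and fences that have already been issued. -/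
theorem exists_rotate {P : Program Thr Reg Lab Dom} {τ : List (Act Thr Dom)} (h : τ ∈ P.Comp)
    {lo q : ℕ} (hlo : lo ≤ q) {k : Thr × Option Dom} (hq : ExecAt τ k q)
    (hthr : ∀ m, lo ≤ m → m < q → ¬ SameThread τ m q)
    (hex : ∀ m, lo < m → m < τ.length → ∃ k, ExecAt τ k m) :
    ∃ τ' ∈ P.Comp, Relabelling τ τ' (rotate lo q hlo) ∧ τ'.length = τ.length := by
  have hql := hq.lt_length
  obtain ⟨e, he, -⟩ := execAt_iff.1 hq
  set A := τ.take lo with hA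
  set D := (τ.drop lo).take (q - lo) with hD
  set B := τ.drop (q + 1) with hB
  have hsplit : τ.drop lo = D ++ ⟨k.1, .exec e⟩ :: B := by
    have h1 : τ.drop q = ⟨k.1, .exec e⟩ :: B := by
      rw [List.getElem?_eq_getElem hql] at he
      rw [List.drop_eq_getElem_cons hql, Option.some.inj he]
    have h2 := List.take_append_drop (q - lo) (τ.drop lo)
    rw [List.drop_drop, show lo + (q - lo) = q by omega, h1] at h2
    exact h2.symm
  have hAl : A.length = lo := by rw [hA, List.length_take]; omega
  have hDl : D.length = q - lo := by rw [hD, List.length_take, List.length_drop]; omega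
  have hτ : τ = A ++ (D ++ ⟨k.1, .exec e⟩ :: B) := by
    rw [← hsplit, hA, List.take_append_drop]
  obtain ⟨s, u, h1, h2, h3⟩ := comp_split h lo
  rw [hsplit] at h2
  have getD : ∀ m, m < q - lo → D[m]? = τ[lo + m]? := by
    intro m hm
    rw [hD, List.getElem?_take_of_lt hm, List.getElem?_drop]
  obtain ⟨D', u', h4, h5, h6⟩ := h2.pull_exec (fun x hx hxt => by
      obtain ⟨m, hm⟩ := List.mem_iff_getElem?.1 hx
      have hlt : m < q - lo := by
        rw [← hDl]; by_contra hge
        rw [List.getElem?_eq_none (by omega)] at hm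
        cases hm
      rw [getD m hlt] at hm
      exact hthr (lo + m) (by omega) (by omega) ⟨x, _, hm, he, hxt⟩) (fun x hx => by
      obtain ⟨m, hm⟩ := List.mem_iff_getElem?.1 hx
      rw [List.getElem?_tail] at hm
      have hlt : m + 1 < q - lo := by
        rw [← hDl]; by_contra hge
        rw [List.getElem?_eq_none (by omega)] at hm
        cases hm
      rw [getD _ hlt] at hm
      exact (isExec_iff hm).2 (hex _ (by omega) (by omega))) (fun x hx => by
      obtain ⟨m, hm⟩ := List.mem_iff_getElem?.1 hx
      rw [hB, List.getElem?_drop] at hm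
      refine (isExec_iff hm).2 (hex _ (by omega) ?_)
      by_contra hge
      rw [List.getElem?_eq_none (by omega)] at hm
      cases hm)
  have hDl' : D'.length = D.length := by simpa using congrArg List.length h6
  refine ⟨A ++ ⟨k.1, .exec e⟩ :: (D' ++ B), ?_, .of_erase fun i => ?_, ?_⟩
  · exact mem_comp_iff.2 ⟨u', PSteps_append.2 ⟨s, h1, h4⟩, fun t => by rw [h5, h3]⟩
  · rw [← List.getElem?_map, ← List.getElem?_map]
    conv_rhs => rw [hτ]
    have := getElem?_rotate (A.map Act.erase) (D.map Act.erase) (B.map Act.erase)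
      (Act.erase ⟨k.1, .exec e⟩) i
    simp only [List.map_append, List.map_cons, h6]
    simp only [List.length_map, hAl, hDl, show lo + (q - lo) = q by omega] at this
    exact this
  · conv_rhs => rw [hτ]
    simp [hDl']
    omega

/-! ### Deleting the last action -/

/-- Here `p'` describes the positions that remain after the deletion of position `n`. The deleted
position is not counted, either because it is beyond the range or because it fails `p`. -/
theorem count_skip {p p' : ℕ → Prop} [DecidablePred p] [DecidablePred p'] {n : ℕ}
    (hlt : ∀ i < n, p' i ↔ p i) (hge : ∀ i, n ≤ i → (p' i ↔ p (i + 1))) (i : ℕ)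
    (hn : n < i + 1 → ¬ p n ∨ i < n) :
    Nat.count p' i = Nat.count p (if i < n then i else i + 1) := by
  have low : ∀ i, i ≤ n → Nat.count p' i = Nat.count p i := fun i hi =>
    count_congr_lt fun m hm => hlt m (by omega)
  split_ifs with h
  · exact low i h.le
  · obtain ⟨d, rfl⟩ := Nat.exists_eq_add_of_le (not_lt.1 h)
    have hpn : ¬ p n := (hn (by omega)).resolve_right h
    clear h hn
    induction d with
    | zero => rw [add_zero, low n le_rfl, Nat.count_succ, if_neg hpn, add_zero]
    | succ d ih =>
      rw [show n + (d + 1) = n + d + 1 by omega, Nat.count_succ, ih,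
        Nat.count_succ p (n + d + 1)]
      congr 1
      have := hge (n + d) (by omega)
      by_cases hp : p (n + d + 1) <;> simp [this, hp]

/-- No issue or execution of the same kind and channel follows `x`, so the remaining issues keep
their executions and the shift of positions embeds the overtakings. -/
theorem delete_costs_le {α β : List (Act Thr Dom)} {x : Act Thr Dom}
    (hi : ∀ y ∈ β, ∀ k, x.isuChan = some k → y.isuChan ≠ some k)
    (he : ∀ y ∈ β, ∀ k, x.execChan = some k → y.execChan ≠ some k) :
    delays (α ++ β) ≤ delays (α ++ x :: β) ∧ reorders (α ++ β) ≤ reorders (α ++ x :: β) := by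
  set f : ℕ → ℕ := fun i => if i < α.length then i else i + 1 with hf
  have hmono : ∀ {i j}, i < j → f i < f j := by
    intro i j h
    simp only [hf]
    split_ifs <;> omega
  have hlow : ∀ i < α.length, (α ++ β)[i]? = (α ++ x :: β)[i]? := fun i hi => by
    rw [List.getElem?_append_left hi, List.getElem?_append_left hi]
  have hhigh : ∀ i, α.length ≤ i → (α ++ β)[i]? = (α ++ x :: β)[i + 1]? := fun i hi => by
    rw [List.getElem?_append_right hi, List.getElem?_append_right (by omega),
      show i + 1 - α.length = i - α.length + 1 by omega, List.getElem?_cons_succ]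
  have hget : ∀ i, (α ++ β)[i]? = (α ++ x :: β)[f i]? := by
    intro i
    simp only [hf]
    split_ifs with h
    · exact hlow i h
    · exact hhigh i (not_lt.1 h)
  have hx : (α ++ x :: β)[α.length]? = some x := by simp
  have hβ : ∀ i y, α.length < i → (α ++ x :: β)[i]? = some y → y ∈ β := by
    intro i y hlt hy
    rw [List.getElem?_append_right hlt.le] at hy
    obtain ⟨d, hd⟩ : ∃ d, i - α.length = d + 1 := ⟨i - α.length - 1, by omega⟩
    rw [hd, List.getElem?_cons_succ] at hy
    exact List.mem_of_getElem? hy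
  have hiss : ∀ i j, IssueOf (α ++ β) i j → IssueOf (α ++ x :: β) (f i) (f j) := by
    intro i j h
    obtain ⟨k, h1, h2, h3⟩ := issueOf_iff.1 h
    have h1' : IsuAt (α ++ x :: β) k (f i) := by unfold IsuAt at *; rwa [← hget]
    have h2' : ExecAt (α ++ x :: β) k (f j) := by unfold ExecAt at *; rwa [← hget]
    refine issueOf_iff.2 ⟨k, h1', h2', ?_⟩
    rw [← count_skip (p := IsuAt (α ++ x :: β) k) (p' := IsuAt (α ++ β) k), h3,
      count_skip (p := ExecAt (α ++ x :: β) k) (p' := ExecAt (α ++ β) k)]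
    · intro m hm; unfold ExecAt; rw [hlow m hm]
    · intro m hm; unfold ExecAt; rw [hhigh m hm]
    · intro _
      by_contra hno
      push Not at hno
      have h4 : f j = j + 1 := by simp only [hf]; rw [if_neg (by omega)]
      obtain ⟨e, h5, h6⟩ := execAt_iff.1 h2'
      have h7 : x.execChan = some k := by simpa [ExecAt, hx] using hno.1
      refine he _ (hβ _ _ (by omega) h5) k h7 ?_
      simp [Act.execChan, h6]
    · intro m hm; unfold IsuAt; rw [hlow m hm]
    · intro m hm; unfold IsuAt; rw [hhigh m hm]
    · intro _
      by_contra hno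
      push Not at hno
      have h4 : f i = i + 1 := by simp only [hf]; rw [if_neg (by omega)]
      obtain ⟨e, h5, h6⟩ := isuAt_iff.1 h1'
      have h7 : x.isuChan = some k := by simpa [IsuAt, hx] using hno.1
      refine hi _ (hβ _ _ (by omega) h5) k h7 ?_
      simp [Act.isuChan, h6]
  refine costs_le_of_injective (f := f) (fun i j hij => ?_) hiss fun j m => ?_
  · rcases lt_trichotomy i j with h | h | h
    · have := hmono h; omega
    · exact h
    · have := hmono h; omega
  · rintro ⟨i, h1, h2, h3, y, z, h4, h5, h6⟩
    exact ⟨f i, hiss _ _ h1, hmono h2, hmono h3, y, z, by rw [← hget, h4], by rw [← hget, h5], h6⟩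

theorem execChan_ne_of_pend {P : Program Thr Reg Lab Dom} {s u : PState Thr Reg Lab Dom}
    {β : List (Act Thr Dom)} (h : PSteps P s β u) (hβ : ∀ x ∈ β, x.IsExec) {t : Thr}
    {c : Option Dom} (hc : ∀ z ∈ s.pend t, z.chan ≠ c) :
    ∀ x ∈ β, x.execChan ≠ some (t, c) := by
  induction β generalizing s with
  | nil => simp
  | cons x β ih =>
    obtain ⟨s₁, h1, h2⟩ := h
    obtain ⟨t', op⟩ := x
    obtain ⟨e, rfl⟩ : ∃ e, op = .exec e := hβ ⟨t', op⟩ (by simp)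
    obtain ⟨p, ⟨l, r, hl, rfl, -⟩, rfl⟩ := PStep.exec_iff.1 h1
    have h3 := ih h2 (fun x hx => hβ x (by simp [hx])) (by
      by_cases ht : t = t'
      · subst ht
        simp only [Function.update_self]
        intro z hz
        refine hc z ?_
        rw [hl]
        simp only [List.mem_append, List.mem_cons] at hz ⊢
        tauto
      · simpa [ht] using hc)
    intro x hx
    rcases List.mem_cons.1 hx with rfl | hx
    · intro he
      simp only [Act.execChan, Option.some.injEq, Prod.mk.injEq] at he
      obtain ⟨rfl, he⟩ := he
      exact hc e (by rw [hl]; simp) he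
    · exact h3 x hx

/-- An issued entry that is the last pending one need not be issued. -/
theorem PSteps.drop_last {P : Program Thr Reg Lab Dom} {s u : PState Thr Reg Lab Dom}
    {β : List (Act Thr Dom)} (h : PSteps P s β u) (hβ : ∀ x ∈ β, x.IsExec) {t : Thr}
    {e : Entry Dom} {p : List (Entry Dom)} (hp : s.pend t = p ++ [e]) (hu : u.pend t = []) :
    ∃ β₁ β₂, β = β₁ ++ ⟨t, .exec e⟩ :: β₂ ∧ (∀ x ∈ β₂, x.execChan ≠ some (t, e.chan)) ∧
      ∀ s' : PState Thr Reg Lab Dom, s'.pend = Function.update s.pend t p →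
        ∃ u', PSteps P s' (β₁ ++ β₂) u' ∧ u'.pend = u.pend := by
  induction β generalizing s p with
  | nil => cases h; simp [hp] at hu
  | cons x β ih =>
    obtain ⟨s₁, h1, h2⟩ := h
    obtain ⟨t', op⟩ := x
    obtain ⟨y, rfl⟩ : ∃ e, op = .exec e := hβ ⟨t', op⟩ (by simp)
    have hβ' : ∀ x ∈ β, x.IsExec := fun x hx => hβ x (by simp [hx])
    obtain ⟨p₁, hr, rfl⟩ := PStep.exec_iff.1 h1
    by_cases ht : t = t'
    · subst ht
      rw [hp] at hr
      rcases hr.snoc_cases with ⟨p₂, hr', rfl⟩ | ⟨rfl, rfl, hbl⟩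
      · obtain ⟨β₁, β₂, rfl, h4, h5⟩ := ih h2 hβ' (p := p₂) (by simp)
        refine ⟨⟨t, .exec y⟩ :: β₁, β₂, by simp, h4, fun s' hs' => ?_⟩
        obtain ⟨u', h6, h7⟩ := h5 ⟨s'.ctl, (Op.exec y).memAfter s'.mem,
          Function.update s'.pend t p₂⟩ (by simp [hs'])
        exact ⟨u', ⟨_, PStep.exec_iff.2 ⟨p₂, by simpa [hs'] using hr', rfl⟩, h6⟩, h7⟩
      -- When the last pending entry leaves first, nothing else of its channel is pending, so no
      -- further action of this channel follows.
      · refine ⟨[], β, rfl, ?_, fun s' hs' => ?_⟩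
        · exact execChan_ne_of_pend h2 hβ' (by
            simp only [Function.update_self]
            exact fun z hz hc => hbl z hz (Entry.blocks_of_chan hc))
        · exact h2.congr_of_isExec hβ' hs'
    · obtain ⟨β₁, β₂, rfl, h4, h5⟩ := ih h2 hβ' (p := p) (by simpa [ht] using hp)
      refine ⟨⟨t', .exec y⟩ :: β₁, β₂, by simp, h4, fun s' hs' => ?_⟩
      have ht' : ¬ t' = t := fun e => ht e.symm
      obtain ⟨u', h6, h7⟩ := h5 ⟨s'.ctl, (Op.exec y).memAfter s'.mem,
        Function.update s'.pend t' p₁⟩ (by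
          simp only [hs']; exact Function.update_comm ht _ _ _)
      exact ⟨u', ⟨_, PStep.exec_iff.2 ⟨p₁, by simpa [hs', ht'] using hr, rfl⟩, h6⟩, h7⟩

/-- The last action that is not a store or fence action can be deleted. -/
theorem exists_delete {P : Program Thr Reg Lab Dom} {τ : List (Act Thr Dom)} (h : τ ∈ P.Comp)
    {q : ℕ} (hq : q < τ.length) (hnq : ∀ k, ¬ ExecAt τ k q)
    (hex : ∀ m, q < m → m < τ.length → ∃ k, ExecAt τ k m) :
    ∃ τ' ∈ P.Comp, (∀ m < q, τ[m]? = τ'[m]?) ∧ cost τ' < cost τ := by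
  obtain ⟨s, u, h1, h2, h3⟩ := comp_split h q
  set α := τ.take q with hα
  set β := τ.drop (q + 1) with hβ
  have hdrop : τ.drop q = τ[q] :: β := List.drop_eq_getElem_cons hq
  have hτ : τ = α ++ τ[q] :: β := by rw [← hdrop, hα, List.take_append_drop]
  have hget : τ[q]? = some τ[q] := List.getElem?_eq_getElem hq
  have hαl : α.length = q := by rw [hα, List.length_take]; omega
  rw [hdrop] at h2
  generalize τ[q] = x at *
  have hexβ : ∀ y ∈ β, y.IsExec := by
    intro y hy
    obtain ⟨m, hm⟩ := List.mem_iff_getElem?.1 hy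
    rw [hβ, List.getElem?_drop] at hm
    refine (isExec_iff hm).2 (hex _ (by omega) ?_)
    by_contra hge
    rw [List.getElem?_eq_none (by omega)] at hm
    cases hm
  have hxe : x.execChan = none := by
    rw [Option.eq_none_iff_forall_ne_some]
    intro k hk
    exact hnq k (by simpa [ExecAt, hget] using hk)
  have hβi : ∀ y ∈ β, y.isuChan = none := by
    rintro ⟨t, op⟩ hy
    obtain ⟨e, rfl⟩ : ∃ e, op = .exec e := hexβ _ hy
    rfl
  have hprefix : ∀ γ : List (Act Thr Dom), ∀ m < q, τ[m]? = (α ++ γ)[m]? := by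
    intro γ m hm
    rw [List.getElem?_append_left (by omega)]
    conv_lhs => rw [hτ]
    rw [List.getElem?_append_left (by omega)]
  obtain ⟨s₁, h4, h5⟩ := h2
  obtain ⟨q', p, hc, hb, rfl⟩ := h4
  have plain : p = s.pend x.thr → x.isuChan = none →
      ∃ τ' ∈ P.Comp, (∀ m < q, τ[m]? = τ'[m]?) ∧ cost τ' < cost τ := by
    rintro rfl hxi
    -- The deleted action leaves the pending lists unchanged, and only stores and fences follow.
    obtain ⟨u', h6, h7⟩ := h5.congr_of_isExec hexβ (s' := s) (by simp)
    refine ⟨α ++ β, mem_comp_iff.2 ⟨u', PSteps_append.2 ⟨s, h1, h6⟩, fun t => by rw [h7, h3]⟩,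
      hprefix β, ?_⟩
    have h8 := delete_costs_le (α := α) (β := β) (x := x) (by simp [hxi]) (by simp [hxe])
    rw [← hτ] at h8
    refine cost_lt_of_length h8.1 h8.2 ?_
    conv_rhs => rw [hτ]
    simp
  obtain ⟨t, op⟩ := x
  cases op with
  | ld a v => exact plain hb.1 rfl
  | loc => exact plain hb rfl
  | scfence => exact plain hb.2 rfl
  | exec e => simp [Act.execChan] at hxe
  | isu e =>
    obtain rfl := hb
    obtain ⟨β₁, β₂, h6, h7, h8⟩ := h5.drop_last hexβ (t := t) (e := e) (p := s.pend t) (by simp)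
      (h3 t)
    obtain ⟨u', h9, h10⟩ := h8 s (by simp)
    refine ⟨α ++ (β₁ ++ β₂),
      mem_comp_iff.2 ⟨u', PSteps_append.2 ⟨s, h1, h9⟩, fun t => by rw [h10, h3]⟩, hprefix _, ?_⟩
    -- An issue has to be deleted together with its execution. Deleting the execution first and then
    -- the issue removes the last action of its kind in the channel each time.
    have h11 := delete_costs_le (α := α ++ ⟨t, .isu e⟩ :: β₁) (β := β₂) (x := ⟨t, .exec e⟩)
      (by simp [Act.isuChan]) (by
        intro y hy k hk
        simp only [Act.execChan, Option.some.injEq] at hk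
        exact hk ▸ h7 y hy)
    have h12 := delete_costs_le (α := α) (β := β₁ ++ β₂) (x := ⟨t, .isu e⟩) (by
        intro y hy k _ hk
        have hy' : y ∈ β := by
          rw [h6]
          simp only [List.mem_append, List.mem_cons] at hy ⊢
          tauto
        rw [hβi y hy'] at hk
        cases hk) (by simp [Act.execChan])
    have h13 : τ = (α ++ ⟨t, .isu e⟩ :: β₁) ++ ⟨t, .exec e⟩ :: β₂ := by
      conv_lhs => rw [hτ, h6]
      simp
    rw [← h13] at h11
    have h14 : (α ++ ⟨t, .isu e⟩ :: β₁) ++ β₂ = α ++ ⟨t, .isu e⟩ :: (β₁ ++ β₂) := by simp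
    rw [h14] at h11
    refine cost_lt_of_length (h12.1.trans h11.1) (h12.2.trans h11.2) ?_
    conv_rhs => rw [hτ, h6]
    simp

end Pgas

namespace Pgas
variable {Thr Reg Lab Dom : Type*}
variable [DecidableEq Thr] [DecidableEq Reg] [DecidableEq Dom] [Zero Dom]

/-! ### Computations without delays -/

/-- Issues take part in program order only, so they are independent of other threads. -/
theorem IsuAt.not_hb_left {τ : List (Act Thr Dom)} {k : Thr × Option Dom} {m n : ℕ}
    (h : IsuAt τ k m) (hs : ¬ SameThread τ m n) : ¬ Hb τ m n := by
  rintro (hb | ⟨-, a, hb, -⟩ | hb | ⟨t, a, hb, -⟩)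
  · exact hs hb.1
  · obtain ⟨t, hb⟩ := storeAt_iff.1 hb
    exact h.not_execAt hb
  · obtain ⟨t, a, -, hb, -⟩ := (src_iff.1 hb).1
    obtain ⟨t, hb⟩ := storeAt_iff.1 hb
    exact h.not_execAt hb
  · exact hb.not_isuAt h

theorem IsuAt.po_of_hb {τ : List (Act Thr Dom)} {k : Thr × Option Dom} {m n : ℕ}
    (h : IsuAt τ k n) (hb : Hb τ m n) : Po τ m n := by
  rcases hb with hb | ⟨-, a, -, hb⟩ | hb | ⟨t, a, -, hb, -⟩
  · exact hb
  · obtain ⟨t, hb⟩ := storeAt_iff.1 hb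
    exact absurd hb h.not_execAt
  · obtain ⟨t, a, hb, -⟩ := (src_iff.1 hb).1
    exact absurd h hb.not_isuAt
  · obtain ⟨t, hb⟩ := storeAt_iff.1 hb
    exact absurd hb h.not_execAt

/-- The issue at `i` has to be moved behind position `m` to reach a sequentially consistent
computation. -/
def Late (τ : List (Act Thr Dom)) (i m : ℕ) : Prop :=
  ∃ j, IssueOf τ i j ∧ i < m ∧ m < j ∧ ∀ j', IssueOf τ m j' → j' < j

theorem IssueOf.not_left {τ : List (Act Thr Dom)} {i j j' : ℕ} (h : IssueOf τ i j) :
    ¬ IssueOf τ j j' := by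
  intro h'
  obtain ⟨k, -, h1⟩ := h.isuAt
  obtain ⟨k', h2, -⟩ := h'.isuAt
  exact h2.not_execAt h1

/-- As in bubble sort, an inversion yields an adjacent one: if `i` need not pass `m - 1`, then `m -
1` is an issue executed no earlier than the action of `i`, so it has to pass `m` itself. -/
theorem Late.exists_adjacent {τ : List (Act Thr Dom)} (d : ℕ) :
    ∀ {i m : ℕ}, m = i + 1 + d → Late τ i m → ∃ n, Late τ n (n + 1) := by
  induction d with
  | zero => rintro i m rfl h; exact ⟨i, h⟩
  | succ d ih =>
    rintro i m hm h
    by_cases h1 : Late τ i (m - 1)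
    · exact ih (by omega) h1
    · obtain ⟨j, h2, h3, h4, h5⟩ := h
      unfold Late at h1
      push Not at h1
      obtain ⟨j', h6, h7⟩ := h1 j h2 (by omega) (by omega)
      refine ⟨m - 1, j', h6, by omega, by omega, fun j'' h8 => ?_⟩
      rw [show m - 1 + 1 = m by omega] at h8
      exact (h5 _ h8).trans_le h7

/-- The last position before `j` either has to be passed by `i`, or it is an issue whose execution
comes after `j` and which has to pass `j`. -/
theorem exists_late {τ : List (Act Thr Dom)} (hτ : Complete τ) {i j : ℕ} (h : IssueOf τ i j)
    (hne : j ≠ i + 1) : ∃ n, Late τ n (n + 1) := by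
  have hlt := hτ.lt h
  by_cases h1 : Late τ i (j - 1)
  · exact h1.exists_adjacent (j - 2 - i) (by omega)
  · unfold Late at h1
    push Not at h1
    obtain ⟨j', h2, h3⟩ := h1 j h (by omega) (by omega)
    have h4 : j' ≠ j := by
      rintro rfl
      have := h.issue_unique h2
      omega
    refine ⟨j - 1, j', h2, by omega, by omega, fun j'' h5 => ?_⟩
    rw [show j - 1 + 1 = j by omega] at h5
    exact absurd h5 h.not_left

theorem late_finite (τ : List (Act Thr Dom)) : {x : ℕ × ℕ | Late τ x.1 x.2}.Finite := by
  refine ((Set.finite_Iio τ.length).prod (Set.finite_Iio τ.length)).subset ?_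
  rintro ⟨i, m⟩ ⟨j, h1, h2, h3, -⟩
  obtain ⟨k, -, h4⟩ := h1.isuAt
  have := h4.lt_length
  simp only at h2 h3
  simp only [Set.mem_prod, Set.mem_Iio]
  omega

/-- Swapping an adjacent inversion removes it and creates no new one, so the number of late pairs
decreases. -/
theorem Late.of_move {P : Program Thr Reg Lab Dom} {τ τ' : List (Act Thr Dom)} {n : ℕ}
    (hτ : Complete τ) (M : Move P τ τ' (Equiv.swap n (n + 1))) (hn : Late τ n (n + 1)) {i m : ℕ}
    (h : Late τ' (Equiv.swap n (n + 1) i) (Equiv.swap n (n + 1) m)) :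
    Late τ i m ∧ ¬ (i = n ∧ m = n + 1) := by
  set π := Equiv.swap n (n + 1) with hπ
  have R := M.iso.toReord
  obtain ⟨j₀, h1, h2, h3, h4⟩ := hn
  obtain ⟨j, h, h6, h7, h8⟩ := h
  obtain ⟨j, rfl⟩ := π.surjective j
  have h5 := R.issueOf.1 h
  have hπn : π n = n + 1 := Equiv.swap_apply_left _ _
  have hπn' : π (n + 1) = n := Equiv.swap_apply_right _ _
  have lt : ∀ a b, a ≠ b → π a < π b → ¬ (b = n ∧ a = n + 1) → a < b := by
    intro a b hab hlt hne
    rcases lt_or_gt_of_ne hab with h | h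
    · exact h
    · exact absurd (swap_lt h hne) (by rw [← hπ]; omega)
  have hjn : j ≠ n := by
    rintro rfl
    exact h5.not_left h1
  have him : i ≠ m := by rintro rfl; omega
  have hmj : m ≠ j := by rintro rfl; omega
  have hnm : ¬ (i = n ∧ m = n + 1) := by
    rintro ⟨rfl, rfl⟩
    omega
  refine ⟨⟨j, h5, lt _ _ him h6 ?_, lt _ _ hmj h7 fun h => hjn h.1, fun j' hj' => ?_⟩, hnm⟩
  · rintro ⟨rfl, rfl⟩
    have h9 := h8 _ (R.issueOf.2 h1)
    have h10 := h4 _ h5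
    have h11 := hτ.lt h5
    rw [hπ, Equiv.swap_apply_of_ne_of_ne (by omega) (by omega),
      Equiv.swap_apply_of_ne_of_ne (by omega) (by omega)] at h9
    omega
  · refine lt _ _ ?_ (h8 _ (R.issueOf.2 hj')) fun h => hjn h.1
    rintro rfl
    exact him (h5.issue_unique hj')

/-- Without delays, no action of the same thread lies between an issue and its execution, so an
issue commutes with every action that it has to pass. Sorting by such swaps ends in a sequentially
consistent computation; `N` is the number of late pairs. -/
theorem exists_sc_of_not_delayed {P : Program Thr Reg Lab Dom} (N : ℕ) :
    ∀ {τ : List (Act Thr Dom)}, {x : ℕ × ℕ | Late τ x.1 x.2}.ncard = N → τ ∈ P.Comp →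
      (∀ j, ¬ Delayed τ j) → ∃ σ ∈ P.SCComp, (trace τ).Same (trace σ) := by
  induction N using Nat.strong_induction_on with
  | _ N ih =>
    rintro τ rfl h hd
    by_cases hsc : ∀ i j, IssueOf τ i j → j = i + 1
    · exact ⟨τ, ⟨h, hsc⟩, .refl _⟩
    · push Not at hsc
      obtain ⟨i, j, hij, hne⟩ := hsc
      have hτ := complete_of_comp h
      obtain ⟨n, hn⟩ := exists_late hτ hij hne
      obtain ⟨j₀, h1, h2, h3, h4⟩ := id hn
      obtain ⟨k, hk, hk'⟩ := h1.isuAt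
      have hs : ¬ SameThread τ n (n + 1) := fun hs =>
        hd j₀ ⟨n + 1, n, h1, h2, h3, hs.symm.trans h1.sameThread⟩
      obtain ⟨τ', M⟩ := exists_move_swap h (by have := hk'.lt_length; omega) hs
        (hk.not_hb_left hs)
      have hd' : ∀ j, ¬ Delayed τ' j := by
        intro j hj
        obtain ⟨j, rfl⟩ := (Equiv.swap n (n + 1)).surjective j
        exact hd j (M.delayed.1 hj)
      have hlt : {x : ℕ × ℕ | Late τ' x.1 x.2}.ncard < {x : ℕ × ℕ | Late τ x.1 x.2}.ncard := by
        set π := Equiv.swap n (n + 1) with hπ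
        have hinj : Function.Injective (Prod.map π.symm π.symm) :=
          π.symm.injective.prodMap π.symm.injective
        rw [← Set.ncard_image_of_injective _ hinj]
        refine Set.ncard_lt_ncard ?_ (late_finite τ)
        refine Set.ssubset_iff_of_subset ?_ |>.2 ⟨(n, n + 1), hn, ?_⟩
        · rintro _ ⟨⟨i, m⟩, h5, rfl⟩
          exact (Late.of_move hτ M hn (i := π.symm i) (m := π.symm m) (by
              rw [← hπ, π.apply_symm_apply, π.apply_symm_apply]; exact h5)).1
        · rintro ⟨⟨i, m⟩, h5, h6⟩
          simp only [Prod.map_apply, Prod.mk.injEq] at h6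
          exact (Late.of_move hτ M hn (i := π.symm i) (m := π.symm m) (by
              rw [← hπ, π.apply_symm_apply, π.apply_symm_apply]; exact h5)).2 h6
      obtain ⟨σ, hσ, hs⟩ := ih _ hlt rfl M.comp hd'
      exact ⟨σ, hσ, M.same.trans hs⟩

/-! ### Violations and minimal violations -/

theorem violation_of_cyclic {P : Program Thr Reg Lab Dom} {τ : List (Act Thr Dom)}
    (h : τ ∈ P.Comp) (hc : Cyclic τ) : P.Violation τ :=
  ⟨h, fun ⟨_, hσ, hs⟩ => hc.not_same (complete_of_comp h) hσ.2 hs⟩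

theorem Program.Violation.exists_delayed {P : Program Thr Reg Lab Dom} {τ : List (Act Thr Dom)}
    (h : P.Violation τ) : ∃ j, Delayed τ j := by
  by_contra hd
  push Not at hd
  exact h.2 (exists_sc_of_not_delayed _ rfl h.1 hd)

theorem Program.Violation.exists_minViolation {P : Program Thr Reg Lab Dom}
    {τ : List (Act Thr Dom)} (h : P.Violation τ) : ∃ τ', P.MinViolation τ' := by
  obtain ⟨σ, h1, h2⟩ := (InvImage.wf (cost (Thr := Thr) (Dom := Dom)) wellFounded_lt).has_min
    {σ | P.Violation σ} ⟨τ, h⟩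
  exact ⟨σ, h1, fun σ' h' => not_lt.1 (h2 σ' h')⟩

theorem Program.MinViolation.not_cost_lt {P : Program Thr Reg Lab Dom} {τ τ' : List (Act Thr Dom)}
    (h : P.MinViolation τ) (h' : τ' ∈ P.Comp) (hs : (trace τ).Same (trace τ')) :
    ¬ cost τ' < cost τ := fun hlt =>
  (h.2 τ' ⟨h', fun ⟨σ, hσ, hσs⟩ => h.1.2 ⟨σ, hσ, hs.trans hσs⟩⟩).not_gt hlt

/-! ### The first delayed action -/

/-- The first delayed action is at `j`, its issue at `i`, and `p` is the last action of the same
thread in between. -/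
structure Front (τ : List (Act Thr Dom)) (i p j : ℕ) : Prop where
  issue : IssueOf τ i j
  lt_left : i < p
  lt_right : p < j
  same : SameThread τ p j
  gap : ∀ m, p < m → m < j → ¬ SameThread τ m j
  undelayed : ∀ m < j, ¬ Delayed τ m

theorem Front.of_delayed {τ : List (Act Thr Dom)} {j : ℕ} (h : Delayed τ j)
    (hm : ∀ m < j, ¬ Delayed τ m) : ∃ i p, Front τ i p j := by
  classical
  obtain ⟨m, i, h1, h2, h3, h4⟩ := h
  set p := Nat.findGreatest (fun m => m < j ∧ SameThread τ m j) j
  have hp : p < j ∧ SameThread τ p j :=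
    Nat.findGreatest_spec (P := fun m => m < j ∧ SameThread τ m j) h3.le ⟨h3, h4⟩
  have hmp : m ≤ p := Nat.le_findGreatest h3.le ⟨h3, h4⟩
  exact ⟨i, p, h1, h2.trans_le hmp, hp.1, hp.2, fun m' h5 h6 h7 =>
    Nat.findGreatest_is_greatest h5 h6.le ⟨h6, h7⟩, hm⟩

theorem Program.Violation.exists_front {P : Program Thr Reg Lab Dom} {τ : List (Act Thr Dom)}
    (h : P.Violation τ) : ∃ i p j, Front τ i p j := by
  classical
  have hd := h.exists_delayed
  obtain ⟨i, p, hF⟩ := Front.of_delayed (Nat.find_spec hd) fun m hm => Nat.find_min hd hm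
  exact ⟨i, p, _, hF⟩

theorem HbThrough.exists_last {τ : List (Act Thr Dom)} {m n : ℕ} (h : HbThrough τ m n) :
    ∃ k, (k = m ∨ HbThrough τ m k) ∧ m ≤ k ∧ k < n ∧ Hb τ k n := by
  have aux : ∀ {k}, HbThrough τ m k → m < k := by
    intro k hk
    induction hk with
    | single h => exact h.1
    | tail _ h ih => exact ih.trans h.1
  cases h with
  | single h => exact ⟨m, .inl rfl, le_rfl, h.1, h.2⟩
  | tail h h' => exact ⟨_, .inr h, (aux h).le, h'.1, h'.2⟩

/-- Let `c` be the first position in `(p, j]` that does not depend on `p`. Everything between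
depends on `p`, so `c` depends on nothing from `p` on and can move to the left. Every time it passes
`p`, the distance from `p` to `j` shrinks. -/
theorem Front.exists_closer {P : Program Thr Reg Lab Dom} {τ : List (Act Thr Dom)} {i p j : ℕ}
    (h : P.MinViolation τ) (F : Front τ i p j) :
    (∀ c, p < c → c ≤ j → HbThrough τ p c) ∨ ∃ τ' π, Move P τ τ' π ∧ Front τ' i (p + 1) j ∧
      ∀ m, j ≤ m → π m = m := by
  classical
  by_contra hcon
  push Not at hcon
  obtain ⟨hex, hcon⟩ := hcon
  have hτ := complete_of_comp h.1.1
  obtain ⟨c, ⟨hpc, hcj, hc⟩, hmin⟩ : ∃ c, (p < c ∧ c ≤ j ∧ ¬ HbThrough τ p c) ∧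
      ∀ c' < c, ¬ (p < c' ∧ c' ≤ j ∧ ¬ HbThrough τ p c') :=
    ⟨Nat.find hex, Nat.find_spec hex, fun c' hc' => Nat.find_min hex hc'⟩
  have hthr : ∀ m, p < m → m < c → HbThrough τ p m := by
    intro m h1 h2
    by_contra h3
    exact hmin m h2 ⟨h1, by omega, h3⟩
  have hhb : ∀ m, p ≤ m → m < c → ¬ Hb τ m c := by
    intro m h1 h2 h3
    rcases h1.eq_or_lt with rfl | h1
    · exact hc (.single ⟨h2, h3⟩)
    · exact hc ((hthr m h1 h2).tail ⟨h2, h3⟩)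
  obtain ⟨k, -, hk⟩ := F.issue.isuAt
  have hjl := hk.lt_length
  have hlt := F.lt_left
  rcases hcj.eq_or_lt with rfl | hcj
  -- If `c = j`, the delayed action can be moved next to `p`, and swapping the two gives a cheaper
  -- computation with the same trace. The move stops at `p + 1` because `p` belongs to the same
  -- thread.
  · obtain ⟨τ', M⟩ := exists_move_left h.1.1 (show p + 1 ≤ c by omega) hjl fun m h1 h2 =>
      ⟨F.gap m (by omega) h2, hhb m (by omega) h2⟩
    have hi : rotate (p + 1) c hpc i = i := by rw [rotate_apply]; split_ifs <;> omega
    have hp : rotate (p + 1) c hpc p = p := by rw [rotate_apply]; split_ifs <;> omega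
    have hc' : rotate (p + 1) c hpc c = p + 1 := by rw [rotate_apply, if_pos rfl]
    have h1 := M.iso.issueOf.2 F.issue
    have h2 := M.iso.sameThread.2 F.same
    have h3 : ¬ Delayed τ' p := by
      have := (M.delayed (j := p)).not.2 (F.undelayed p F.lt_right)
      rwa [hp] at this
    rw [hi, hc'] at h1
    rw [hp, hc'] at h2
    obtain ⟨τ'', h4, h5, h6⟩ := exists_cost_lt M.comp h1 hlt h2 h3
    exact (M.minViolation h).not_cost_lt h4 h5 h6
  · obtain ⟨τ', M⟩ := exists_move_left h.1.1 hpc.le (hcj.trans hjl) fun m h1 h2 => by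
      refine ⟨fun hs => ?_, hhb m h1 h2⟩
      rcases h1.eq_or_lt with rfl | h1
      · exact F.gap c hpc hcj (hs.symm.trans F.same)
      -- A passed action `m` of the thread of `c` does not precede `c` in program order, and the
      -- undelayed `c` does not overtake it. So `m` could only be the issue of `c`.
      obtain ⟨r, hr⟩ := hτ.exists_rep (h2.trans (hcj.trans hjl))
      obtain ⟨r', hr'⟩ := hτ.exists_rep (hcj.trans hjl)
      have h3 : r' ≤ r := by
        by_contra h3
        exact hhb m h1.le h2 (.inl ⟨hs, r, r', hr, hr', by omega⟩)
      have h4 := hτ.rep_le hr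
      have h5 : IssueOf τ r' c := by
        rcases hr' with ⟨rfl, -⟩ | h5
        · omega
        · exact h5
      have h6 : m ≤ r' := by
        by_contra h6
        exact F.undelayed c hcj ⟨m, r', h5, by omega, h2, hs⟩
      obtain rfl : m = r := by omega
      obtain rfl : m = r' := by omega
      obtain ⟨k', hk', -⟩ := h5.isuAt
      obtain ⟨l, -, h7, h8, h9⟩ := (hthr m h1 h2).exists_last
      obtain ⟨h10, r₁, r₂, h11, h12, h13⟩ := hk'.po_of_hb h9
      obtain rfl := h12.unique hr
      -- An issue depends on its predecessors by program order only, so the predecessor `l` in the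
      -- chain to `m` also precedes `c` in program order, although `c` is independent of it.
      exact hhb l h7 (by omega) (.inl ⟨h10.trans hs, r₁, r₂, h11, hr', h13⟩)
    have hi : rotate p c hpc.le i = i := by rw [rotate_apply]; split_ifs <;> omega
    have hp : rotate p c hpc.le p = p + 1 := by rw [rotate_apply]; split_ifs <;> omega
    have hj : ∀ m, j ≤ m → rotate p c hpc.le m = m := by
      intro m hm
      rw [rotate_apply]; split_ifs <;> omega
    have h1 := M.iso.issueOf.2 F.issue
    have h2 := M.iso.sameThread.2 F.same
    rw [hi, hj j le_rfl] at h1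
    rw [hp, hj j le_rfl] at h2
    refine hcon τ' _ M ⟨h1, by omega, by omega, h2, fun m h3 h4 h5 => ?_, fun m h3 h4 => ?_⟩ |>.elim
      fun m hm => hm.2 (hj m hm.1)
    · obtain ⟨m, rfl⟩ := (rotate p c hpc.le).surjective m
      rw [← hj j le_rfl] at h5
      have h5 := M.iso.sameThread.1 h5
      rw [rotate_apply] at h3 h4
      split_ifs at h3 h4
      · omega
      · exact F.gap m (by omega) (by omega) h5
      · exact F.gap m (by omega) (by omega) h5
    · obtain ⟨m, rfl⟩ := (rotate p c hpc.le).surjective m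
      rw [rotate_apply] at h3
      exact F.undelayed m (by split_ifs at h3 <;> omega) (M.delayed.1 h4)

/-- All actions between the overtaken action `p` and the delayed action `j` depend on `p`. -/
def Tight (τ : List (Act Thr Dom)) (p j : ℕ) : Prop := ∀ c, p < c → c ≤ j → HbThrough τ p c

theorem Front.exists_tight {P : Program Thr Reg Lab Dom} (d : ℕ) :
    ∀ {τ : List (Act Thr Dom)} {i p j : ℕ}, j - p ≤ d → P.MinViolation τ → Front τ i p j →
      ∃ τ' π p', Move P τ τ' π ∧ Front τ' i p' j ∧ Tight τ' p' j ∧ ∀ m, j ≤ m → π m = m := by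
  induction d with
  | zero =>
    intro τ i p j hd h F
    have := F.lt_right
    omega
  | succ d ih =>
    intro τ i p j hd h F
    rcases F.exists_closer h with h1 | ⟨τ', π, M, F', hπ⟩
    · exact ⟨τ, _, p, .refl h.1.1, F, h1, fun _ _ => rfl⟩
    · have := F'.lt_right
      obtain ⟨τ'', π', p', M', F'', h2, hπ'⟩ := ih (by omega) (M.minViolation h) F'
      refine ⟨τ'', _, p', M.trans M', F'', h2, fun m hm => ?_⟩
      rw [Equiv.trans_apply, hπ m hm, hπ' m hm]

/-- Were `p` issued before `i`, it would overtake the issue at `i` and be delayed itself. -/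
theorem Front.rep_lt {τ : List (Act Thr Dom)} {i p j r : ℕ} (F : Front τ i p j)
    (hr : Rep τ p r) : i < r := by
  have h1 := F.lt_left
  rcases hr with ⟨rfl, -⟩ | hr
  · exact h1
  · by_contra h2
    rcases (not_lt.1 h2).eq_or_lt with rfl | h2
    · exact F.lt_right.ne (hr.exec_unique F.issue)
    · exact F.undelayed p F.lt_right ⟨i, r, hr, h2, h1, F.issue.sameThread.trans F.same.symm⟩

theorem Front.po {τ : List (Act Thr Dom)} {i p j : ℕ} (hτ : Complete τ) (F : Front τ i p j) :
    Po τ j p := by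
  obtain ⟨k, -, hk⟩ := F.issue.isuAt
  obtain ⟨r, hr⟩ := hτ.exists_rep (F.lt_right.trans hk.lt_length)
  exact ⟨F.same.symm, i, r, .inr F.issue, hr, F.rep_lt hr⟩

/-- Program order runs from `j` to `p`, two stores of one channel keep the order of their issues,
and a load at `p` from the address of the store at `j` sees that store, which is issued before `p`
by the same thread. -/
theorem Front.not_hb {τ : List (Act Thr Dom)} {i p j : ℕ} (hτ : Complete τ) (F : Front τ i p j) :
    ¬ Hb τ p j := by
  obtain ⟨k, hki, hk⟩ := F.issue.isuAt
  rintro (⟨-, r, r', h1, h2, h3⟩ | ⟨-, a, h1, h2⟩ | hb | hb)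
  · obtain rfl := h2.unique (.inr F.issue)
    have := F.rep_lt h1
    omega
  · obtain ⟨t, h1⟩ := storeAt_iff.1 h1
    obtain ⟨t', h2⟩ := storeAt_iff.1 h2
    obtain ⟨r, hr⟩ := hτ.exists_issue h1
    obtain ⟨u, h3, h4⟩ := sameThread_iff.1 F.same
    rw [h1.thr] at h3
    rw [h2.thr] at h4
    obtain rfl : t = t' := Option.some.inj (h3.trans h4.symm)
    have h5 := F.issue.lt_of_lt hr h2 h1 (F.rep_lt (.inr hr))
    have := F.lt_right
    omega
  · obtain ⟨t, a, h1, -⟩ := (src_iff.1 hb).1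
    exact h1.not_execAt hk
  · obtain ⟨t, a, h1, h2, -⟩ := id hb
    exact not_vis_of_cf hb ⟨t, a, h1, h2, .inr ⟨i, F.lt_left, F.issue,
      F.issue.sameThread.trans F.same.symm⟩⟩

theorem Front.exists_hb {τ : List (Act Thr Dom)} {i p j : ℕ} (hτ : Complete τ)
    (F : Front τ i p j) (hT : Tight τ p j) :
    ∃ k, p < k ∧ k < j ∧ Hb τ k j := by
  obtain ⟨k, -, h1, h2, h3⟩ := (hT j F.lt_right le_rfl).exists_last
  exact ⟨k, lt_of_le_of_ne h1 fun h => F.not_hb hτ (h ▸ h3), h2, h3⟩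

/-- The last step of the chain into `j` starts at another thread, so it is a store-order or conflict
edge, and a fence has neither. -/
theorem Front.exists_storeAt {τ : List (Act Thr Dom)} {i p j : ℕ} (hτ : Complete τ)
    (F : Front τ i p j) (hT : Tight τ p j) : ∃ a, StoreAt τ j a := by
  obtain ⟨k', hki, hk⟩ := F.issue.isuAt
  obtain ⟨k, h1, h2, hb | ⟨-, a, -, hb⟩ | hb | ⟨t, a, -, hb, -⟩⟩ := F.exists_hb hτ hT
  · exact absurd hb.1 (F.gap k h1 h2)
  · exact ⟨a, hb⟩
  · obtain ⟨t, a, h1, -⟩ := (src_iff.1 hb).1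
    exact absurd hk h1.not_execAt
  · exact ⟨a, hb⟩

theorem HbThrough.bounded {τ : List (Act Thr Dom)} {m n N : ℕ} (h : HbThrough τ m n)
    (hn : n < N) : Relation.TransGen (fun a b => Hb τ a b ∧ a < N ∧ b < N) m n := by
  induction h with
  | single h => exact .single ⟨h.2, h.1.trans hn, hn⟩
  | tail _ h ih => exact (ih (h.1.trans hn)).tail ⟨h.2, h.1.trans hn, hn⟩

/-- The chain from `p` to `j` is closed by program order from `j` to `p`. The bound is essential:
whatever happens behind `j` can be changed without affecting the cycle. -/
theorem Front.cycle {τ : List (Act Thr Dom)} {i p j : ℕ} (hτ : Complete τ)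
    (F : Front τ i p j) (hT : Tight τ p j) :
    Relation.TransGen (fun a b => Hb τ a b ∧ a < j + 1 ∧ b < j + 1) j j := by
  have h := F.lt_right
  exact .head ⟨.inl (F.po hτ), by omega, by omega⟩
    ((hT j h le_rfl).bounded (Nat.lt_succ_self j))

/-! ### The actions behind the first delayed action -/

/-- In tight form, at the same cost, the last action behind `j` that is not a store or fence action
could be deleted. The cycle lies in the unchanged prefix, so a cheaper violation would remain. -/
theorem Front.execAt_of_lt {P : Program Thr Reg Lab Dom} {τ : List (Act Thr Dom)} {i p j : ℕ}
    (h : P.MinViolation τ) (F : Front τ i p j) {q : ℕ} (hq : j < q) (hql : q < τ.length) :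
    ∃ k, ExecAt τ k q := by
  classical
  by_contra hex
  obtain ⟨τ', π, p', M, F', hT, hπ⟩ := F.exists_tight _ le_rfl h
  have hm := M.minViolation h
  rw [← M.len] at hql
  have hex' : ∀ k, ¬ ExecAt τ' k q := by
    intro k hk
    rw [← hπ q hq.le] at hk
    exact hex ⟨k, (M.iso.exec _ _).1 hk⟩
  set c := Nat.findGreatest (fun m => m < τ'.length ∧ ∀ k, ¬ ExecAt τ' k m) τ'.length
  have hc : c < τ'.length ∧ ∀ k, ¬ ExecAt τ' k c :=
    Nat.findGreatest_spec (P := fun m => m < τ'.length ∧ ∀ k, ¬ ExecAt τ' k m) hql.le ⟨hql, hex'⟩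
  have hqc : q ≤ c := Nat.le_findGreatest hql.le ⟨hql, hex'⟩
  obtain ⟨τ'', h1, h2, h3⟩ := exists_delete hm.1.1 hc.1 hc.2 fun m h1 h2 => by
    by_contra h3
    push Not at h3
    exact Nat.findGreatest_is_greatest h1 h2.le ⟨h2, h3⟩
  have hτ' := complete_of_comp hm.1.1
  have h4 : Relation.TransGen (Hb τ'') j j :=
    Relation.TransGen.mono (fun a b hab =>
      hab.1.of_prefix hτ' (complete_of_comp h1) h2 (by omega) (by omega)) _ _ (F'.cycle hτ' hT)
  exact (hm.2 τ'' (violation_of_cyclic h1 ⟨j, h4⟩)).not_gt h3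

theorem Front.of_swap {P : Program Thr Reg Lab Dom} {τ τ' : List (Act Thr Dom)} {i p j n : ℕ}
    (F : Front τ i p j) (M : Move P τ τ' (Equiv.swap n (n + 1))) (hn : ¬ SameThread τ n j) :
    Front τ' (Equiv.swap n (n + 1) i) (Equiv.swap n (n + 1) p) (Equiv.swap n (n + 1) j) := by
  set π := Equiv.swap n (n + 1) with hπ
  have hlt : ∀ {a b}, a ≠ n → a < b → π a < π b := fun ha hab => swap_lt hab fun h => ha h.1
  have hne : ∀ {a}, SameThread τ a j → a ≠ n := by
    rintro a ha rfl
    exact hn ha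
  have hj : j ≠ n := hne (F.issue.sameThread.symm.trans F.issue.sameThread)
  refine ⟨M.iso.issueOf.2 F.issue, hlt (hne F.issue.sameThread) F.lt_left,
    hlt (hne F.same) F.lt_right, M.iso.sameThread.2 F.same, fun m h1 h2 h3 => ?_,
    fun m h1 h2 => ?_⟩
  · obtain ⟨m, rfl⟩ := π.surjective m
    have h3 := M.iso.sameThread.1 h3
    refine F.gap m ?_ ?_ h3
    · by_contra h4
      rcases (not_lt.1 h4).eq_or_lt with rfl | h4
      · omega
      · have := hlt (hne h3) h4
        omega
    · by_contra h4
      rcases (not_lt.1 h4).eq_or_lt with rfl | h4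
      · omega
      · have := hlt hj h4
        omega
  · obtain ⟨m, rfl⟩ := π.surjective m
    refine F.undelayed m ?_ (M.delayed.1 h2)
    by_contra h4
    rcases (not_lt.1 h4).eq_or_lt with rfl | h4
    · omega
    · have := hlt hj h4
      omega

/-- The issue of an undelayed store or fence meets no action of its own thread before its execution,
so it can be pushed to the right beyond `j`. There it contradicts `Front.execAt_of_lt`. The
induction is on the distance of the issue to `j`. -/
theorem Front.delayed_of_issue {P : Program Thr Reg Lab Dom} (d : ℕ) :
    ∀ {τ : List (Act Thr Dom)} {i p j n q : ℕ}, j - n ≤ d → P.MinViolation τ → Front τ i p j →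
      IssueOf τ n q → n < j → j < q → Delayed τ q := by
  induction d with
  | zero => intro τ i p j n q hd _ _ _ hn; omega
  | succ d ih =>
    intro τ i p j n q hd h F hnq hn hq
    by_contra hdel
    obtain ⟨k, hk, hk'⟩ := hnq.isuAt
    have hql := hk'.lt_length
    have hthr : ∀ m, n < m → m < q → ¬ SameThread τ n m := fun m h1 h2 h3 =>
      hdel ⟨m, n, hnq, h1, h2, h3.symm.trans hnq.sameThread⟩
    have hs := hthr (n + 1) (by omega) (by omega)
    obtain ⟨τ', M⟩ := exists_move_swap h.1.1 (by omega) hs (hk.not_hb_left hs)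
    have F' := F.of_swap M (hthr j hn hq)
    have hm := M.minViolation h
    have h1 := M.iso.issueOf.2 hnq
    rw [Equiv.swap_apply_left, Equiv.swap_apply_of_ne_of_ne (by omega) (by omega)] at h1
    rcases (Nat.succ_le_of_lt hn).eq_or_lt with rfl | hn'
    -- This swap makes the issue pass `j`: the first delayed action is now at `n` and the issue at
    -- `n + 1`.
    · rw [Nat.succ_eq_add_one, Equiv.swap_apply_right] at F'
      obtain ⟨k', h2, -⟩ := h1.isuAt
      obtain ⟨k'', h3⟩ := F'.execAt_of_lt hm (Nat.lt_succ_self n) h2.lt_length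
      exact h2.not_execAt h3
    · rw [Equiv.swap_apply_of_ne_of_ne (x := j) (by omega) (by omega)] at F'
      have h2 := ih (by omega) hm F' h1 (by omega) hq
      rw [← Equiv.swap_apply_of_ne_of_ne (a := n) (b := n + 1) (x := q) (by omega) (by omega)] at h2
      exact hdel (M.delayed.1 h2)

theorem Front.issue_lt {P : Program Thr Reg Lab Dom} {τ : List (Act Thr Dom)} {i p j n q : ℕ}
    (h : P.MinViolation τ) (F : Front τ i p j) (hnq : IssueOf τ n q) : n < j := by
  obtain ⟨k, hk, -⟩ := hnq.isuAt
  by_contra hn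
  rcases (not_lt.1 hn).eq_or_lt with rfl | hn
  · exact F.issue.not_left hnq
  · obtain ⟨k', h1⟩ := F.execAt_of_lt h hn hk.lt_length
    exact hk.not_execAt h1

theorem Front.delayed_of_lt {P : Program Thr Reg Lab Dom} {τ : List (Act Thr Dom)} {i p j : ℕ}
    (h : P.MinViolation τ) (F : Front τ i p j) {q : ℕ} (hq : j < q) (hql : q < τ.length) :
    Delayed τ q := by
  obtain ⟨k, hk⟩ := F.execAt_of_lt h hq hql
  obtain ⟨n, hn⟩ := (complete_of_comp h.1.1).exists_issue hk
  exact Front.delayed_of_issue _ le_rfl h F hn (F.issue_lt h hn) hq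

/-- The cycle through `j` avoids `q`, so its image still yields a cycle by `Hb.rotate`. The order
within threads is kept, hence so is the cost. The trace may change, so the cycle is what makes the
result a violation. The bound on `lo` ensures that behind `lo` there are only stores and fences. -/
theorem Front.exists_rotate {P : Program Thr Reg Lab Dom} {τ : List (Act Thr Dom)}
    {i p j lo q : ℕ} (h : P.MinViolation τ) (F : Front τ i p j) (hT : Tight τ p j) (hlo : lo ≤ q)
    (hlj : j ≤ lo + 1) (hjq : j < q) (hql : q < τ.length)
    (hthr : ∀ m, lo ≤ m → m < q → ¬ SameThread τ m q) :
    ∃ τ', P.MinViolation τ' ∧ Reord τ τ' (rotate lo q hlo) ∧ τ'.length = τ.length ∧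
      ∀ m, Delayed τ' (rotate lo q hlo m) ↔ Delayed τ m := by
  obtain ⟨k, hk⟩ := F.execAt_of_lt h hjq hql
  have hτ := complete_of_comp h.1.1
  obtain ⟨τ', h1, R, hlen⟩ := Pgas.exists_rotate h.1.1 hlo hk hthr fun m h1 h2 => by
    rcases (show j ≤ m by omega).eq_or_lt with rfl | h3
    · obtain ⟨k, -, hk⟩ := F.issue.isuAt
      exact ⟨k, hk⟩
    · exact F.execAt_of_lt h h3 h2
  have R' := Reord.of_rotate hlo R hthr
  have hlt : ∀ a b, SameThread τ a b → a < b → rotate lo q hlo a < rotate lo q hlo b :=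
    fun a b => rotate_lt_of_sameThread hlo hthr
  have h2 : Relation.TransGen (Hb τ') (rotate lo q hlo j) (rotate lo q hlo j) := by
    have h3 := (F.cycle hτ hT).lift' (rotate lo q hlo) (p := Hb τ') fun a b hab =>
      hab.1.rotate hlo R hthr hk (by omega) (by omega)
    exact h3
  have hv := violation_of_cyclic h1 ⟨_, h2⟩
  have hc := R'.cost_eq hlt hlen
  refine ⟨τ', ⟨hv, fun σ hσ => hc ▸ h.2 σ hσ⟩, R', hlen, fun m => ⟨?_, ?_⟩⟩
  · rintro ⟨x, hx⟩
    obtain ⟨x, rfl⟩ := (rotate lo q hlo).surjective x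
    exact ⟨x, (R'.overtakes hlt).1 hx⟩
  · rintro ⟨x, hx⟩
    exact ⟨_, (R'.overtakes hlt).2 hx⟩

/-- The first action `q` behind `j` of another thread can be pulled forward to `j` at no cost.
Minimality then excludes both possible threads of the action at `j - 1`. -/
theorem Front.sameThread_of_lt {P : Program Thr Reg Lab Dom} {τ : List (Act Thr Dom)} {i p j : ℕ}
    (h : P.MinViolation τ) (F : Front τ i p j) (hT : Tight τ p j) {q : ℕ} (hq : j < q)
    (hql : q < τ.length) : SameThread τ q j := by
  induction q using Nat.strong_induction_on with
  | _ q ih =>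
  by_contra hs
  have hτ := complete_of_comp h.1.1
  have hjj : SameThread τ j j := F.issue.sameThread.symm.trans F.issue.sameThread
  have hthr : ∀ m, j ≤ m → m < q → ¬ SameThread τ m q := by
    intro m h1 h2 h3
    refine hs (h3.symm.trans ?_)
    rcases h1.eq_or_lt with rfl | h1
    · exact hjj
    · exact ih m h2 h1 (by omega)
  obtain ⟨b, n, hn, h1, h2, h3⟩ := F.delayed_of_lt h hq hql
  -- The actions from `j` up to `q` are not of the thread of `q`, so the overtaken action lies
  -- before `j`.
  have hbj : b < j := by
    by_contra hb
    exact hthr b (by omega) h2 h3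
  obtain ⟨l, h4, h5, -⟩ := F.exists_hb hτ hT
  have hp := F.lt_right
  -- If `j - 1` belongs to the thread of `q`, then `q`, moved to `j`, directly follows an undelayed
  -- action that it overtakes, and swapping them lowers the cost.
  by_cases hsj : SameThread τ (j - 1) q
  · obtain ⟨τ', hm, R, -, hd⟩ := F.exists_rotate h hT hq.le (by omega) hq hql hthr
    have hq' : rotate j q hq.le q = j := by rw [rotate_apply, if_pos rfl]
    have hlt : ∀ m < j, rotate j q hq.le m = m := by
      intro m hm
      rw [rotate_apply]; split_ifs <;> omega
    have h6 := R.issueOf.2 hn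
    have h7 := R.sameThread.2 hsj
    have h8 := (hd (j - 1)).not.2 (F.undelayed (j - 1) (by omega))
    rw [hq', hlt n (by omega), show j = j - 1 + 1 by omega] at h6
    rw [hq', hlt (j - 1) (by omega)] at h7
    rw [hlt (j - 1) (by omega)] at h8
    obtain ⟨τ'', h9, h10, h11⟩ := exists_cost_lt hm.1.1 (n := j - 1) (i := n)
      (by convert h6 using 1) (by omega) (by convert h7 using 1; omega) h8
    exact hm.not_cost_lt h9 h10 h11
  -- Otherwise `q` passes `j - 1` as well and becomes the first delayed action. The undelayed action
  -- from `j - 1` is then behind it, where all actions have to be delayed.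
  · have hlo : j - 1 ≤ q := by omega
    obtain ⟨τ', hm, R, hlen, hd⟩ := F.exists_rotate h hT hlo (by omega) hq hql fun m h6 h7 => by
      rcases (show j - 1 ≤ m from h6).eq_or_lt with rfl | h6
      · exact hsj
      · exact hthr m (by omega) h7
    have hq' : rotate (j - 1) q hlo q = j - 1 := by rw [rotate_apply, if_pos rfl]
    have hj' : rotate (j - 1) q hlo (j - 1) = j := by rw [rotate_apply]; split_ifs <;> omega
    have h6 := (hd q).2 ⟨b, n, hn, h1, h2, h3⟩
    rw [hq'] at h6
    obtain ⟨i', p', F'⟩ := Front.of_delayed h6 fun m h7 h8 => by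
      have h9 : rotate (j - 1) q hlo m = m := by rw [rotate_apply]; split_ifs <;> omega
      rw [← h9] at h8
      exact F.undelayed m (by omega) ((hd m).1 h8)
    have h7 := F'.delayed_of_lt hm (q := j) (by omega) (by omega)
    rw [← hj'] at h7
    exact F.undelayed (j - 1) (by omega) ((hd _).1 h7)

/-! ### The witness -/

theorem eq_append_of_getElem? {α : Type*} {τ : List α} {i p j : ℕ} {x y z : α} (hip : i < p)
    (hpj : p < j) (hx : τ[i]? = some x) (hy : τ[p]? = some y) (hz : τ[j]? = some z) :
    τ = τ.take i ++ [x] ++ (τ.drop (i + 1)).take (p - (i + 1)) ++ [y] ++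
      (τ.drop (p + 1)).take (j - (p + 1)) ++ [z] ++ τ.drop (j + 1) := by
  have key : ∀ {n w}, τ[n]? = some w → τ.drop n = w :: τ.drop (n + 1) := by
    intro n w hw
    obtain ⟨hn, rfl⟩ := List.getElem?_eq_some_iff.1 hw
    exact List.drop_eq_getElem_cons hn
  have key' : ∀ {m n}, m ≤ n → τ.drop m = (τ.drop m).take (n - m) ++ τ.drop n := by
    intro m n hmn
    have h := List.take_append_drop (n - m) (τ.drop m)
    rw [List.drop_drop, Nat.add_sub_cancel' hmn] at h
    exact h.symm
  conv_lhs => rw [← List.take_append_drop i τ, key hx, key' (show i + 1 ≤ p from hip), key hy,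
    key' (show p + 1 ≤ j from hpj), key hz]
  simp

theorem Front.exists_isWitness {P : Program Thr Reg Lab Dom} {τ : List (Act Thr Dom)} {i p j : ℕ}
    (h : P.MinViolation τ) (F : Front τ i p j) (hT : Tight τ p j) :
    ∃ τ₁ τ₂ τ₃ τ₄ isuSt a st, IsWitness τ τ₁ τ₂ τ₃ τ₄ isuSt a st := by
  have hτ := complete_of_comp h.1.1
  have hip := F.lt_left
  have hpj := F.lt_right
  obtain ⟨b, t, v, hz⟩ := F.exists_storeAt hτ hT
  obtain ⟨y, z, hy, hz', hyz⟩ := F.same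
  obtain ⟨x, z', hx, -, -⟩ := F.issue.sameThread
  have hjl := (List.getElem?_eq_some_iff.1 hz).1
  obtain rfl : z = ⟨t, .exec (.store b v)⟩ := Option.some.inj (hz'.symm.trans hz)
  have l₁ : (τ.take i).length = i := by rw [List.length_take]; omega
  have l₂ : (τ.take i ++ [x] ++ (τ.drop (i + 1)).take (p - (i + 1))).length = p := by
    simp only [List.length_append, List.length_take, List.length_drop, List.length_singleton]
    omega
  have l₃ : (τ.take i ++ [x] ++ (τ.drop (i + 1)).take (p - (i + 1)) ++ [y] ++
      (τ.drop (p + 1)).take (j - (p + 1))).length = j := by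
    rw [List.length_append, List.length_append, l₂]
    simp only [List.length_take, List.length_drop, List.length_singleton]
    omega
  refine ⟨_, _, _, _, x, y, _, eq_append_of_getElem? hip hpj hx hy hz, ⟨b, v, rfl⟩,
    l₁.symm ▸ l₃.symm ▸ F.issue, hyz, fun q w hw hd => ?_, fun w hw hwt => ?_,
    fun m hm => F.undelayed m (l₃ ▸ hm), fun c h1 h2 => ?_, fun q w h1 hw => ?_⟩
  · have hql := (List.getElem?_eq_some_iff.1 hw).1
    rcases lt_trichotomy q j with h1 | rfl | h1
    · exact absurd hd (F.undelayed q h1)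
    · rw [hw] at hz
      rw [Option.some.inj hz]
    · obtain ⟨w', z', h2, h3, h4⟩ := F.sameThread_of_lt h hT h1 hql
      rw [hw] at h2
      rw [hz] at h3
      rw [Option.some.inj h2, h4, Option.some.inj h3]
  · obtain ⟨m, hm⟩ := List.mem_iff_getElem?.1 hw
    have hlt : m < j - (p + 1) := by
      have := (List.getElem?_eq_some_iff.1 hm).1
      rw [List.length_take] at this
      omega
    rw [List.getElem?_take_of_lt hlt, List.getElem?_drop] at hm
    exact F.gap (p + 1 + m) (by omega) (by omega) ⟨w, _, hm, hz, hwt⟩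
  · rw [l₂] at h1 ⊢
    rw [l₃] at h2
    exact hT c h1 h2
  · rw [List.length_append, l₃, List.length_singleton] at h1
    have hql := (List.getElem?_eq_some_iff.1 hw).1
    obtain ⟨k, hk⟩ := F.execAt_of_lt h (show j < q by omega) hql
    obtain ⟨e, he, -⟩ := execAt_iff.1 hk
    obtain ⟨w', z', h2, h3, h4⟩ := F.sameThread_of_lt h hT (show j < q by omega) hql
    rw [hw] at h2
    rw [hz] at h3
    rw [hw] at he
    refine ⟨F.delayed_of_lt h (by omega) hql, ?_, e, by rw [Option.some.inj he]⟩
    rw [Option.some.inj h2, h4, Option.some.inj h3]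

end Pgas

/-! ### The proposition -/

theorem proposition3 {Thr Reg Lab Dom : Type*} [DecidableEq Thr] [DecidableEq Reg]
    [DecidableEq Dom] [Zero Dom] (P : Pgas.Program Thr Reg Lab Dom) :
    P.Robust ↔
      ¬ ∃ (τ τ₁ τ₂ τ₃ τ₄ : List (Pgas.Act Thr Dom)) (isuSt a st : Pgas.Act Thr Dom),
        P.MinViolation τ ∧ Pgas.IsWitness τ τ₁ τ₂ τ₃ τ₄ isuSt a st := by
  constructor
  · rintro h ⟨τ, τ₁, τ₂, τ₃, τ₄, isuSt, a, st, hm, -⟩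
    exact hm.1.2 (h τ hm.1.1)
  · intro h τ hτ
    by_contra hv
    obtain ⟨σ, hσ⟩ := Pgas.Program.Violation.exists_minViolation (P := P) ⟨hτ, hv⟩
    obtain ⟨i, p, j, F⟩ := hσ.1.exists_front
    obtain ⟨σ', π, p', M, F', hT, -⟩ := F.exists_tight _ le_rfl hσ
    have hm := M.minViolation hσ
    obtain ⟨τ₁, τ₂, τ₃, τ₄, isuSt, a, st, hw⟩ := F'.exists_isWitness hm hT
    exact h ⟨σ', τ₁, τ₂, τ₃, τ₄, isuSt, a, st, hm, hw⟩
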